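/- Let $\mu>0$, $2\mu+\lambda>0$, $\omega>0$ be real, and put $k_p=\omega/\sqrt{2\mu+\lambda}$, $k_s=\omega/\sqrt{\mu}$. For $x=(x_1,x_2)\in\mathbb{R}^2$ write $r=|x|$, $\hat x=x/|x|$, $\hat x^{\perp}=(-\hat x_2,\hat x_1)$, and let $\mathbb{S}$ be the unit circle. Put $\operatorname{grad} f=(\partial_1 f,\partial_2 f)$, $\operatorname{grad}^\perp f=(-\partial_2 f,\partial_1 f)$, $\operatorname{div} u=\partial_1u_1+\partial_2u_2$, $\operatorname{div}^\perp u=\partial_1u_2-\partial_2u_1$ and $\Delta^*u=\mu\Delta u+(\lambda+\mu)\operatorname{grad}\operatorname{div}u$. Let $D\subset\mathbb{R}^2$ be bounded (in applications, a bounded domain of class $C^2$; no regularity of $D$, and no condition on $u$ at $\partial D$, is needed). Let $u\in C^2(\mathbb{R}^2\setminus\overline D;\mathbb{C}^2)$ be a radiating solution of the elastic scattering problem outside $D$, that is, $$\Delta^*u+\omega^2u=0\ \text{ in }\mathbb{R}^2\setminus\overline D,\qquad \lim_{r\to\infty}\sqrt r\Big(\frac{\partial u_p}{\partial r}-ik_pu_p\Big)=0,\qquad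 \lim_{r\to\infty}\sqrt r\Big(\frac{\partial u_s}{\partial r}-ik_su_s\Big)=0$$ uniformly in all directions $\hat x\in\mathbb{S}$, where $u_p=-k_p^{-2}\operatorname{grad}\operatorname{div}u$ and $u_s=-k_s^{-2}\operatorname{grad}^\perp\operatorname{div}^\perp u$. Define $$\phi=-\frac1{k_p^2}\operatorname{div}u,\qquad \psi=-\frac1{k_s^2}\operatorname{div}^\perp u .$$ Then: 1. $\phi$ and $\psi$ are radiating solutions of the Helmholtz equations with wave numbers $k_p$ and $k_s$ outside $D$: they are of class $C^2$ in $\mathbb{R}^2\setminus\overline D$, they satisfy $\Delta\phi+k_p^2\phi=0$ and $\Delta\psi+k_s^2\psi=0$ in $\mathbb{R}^2\setminus\overline D$, and $$\lim_{r\to\infty}\sqrt r\Big(\frac{\partial\phi}{\partial r}-ik_p\phi\Big)=0,\qquad \lim_{r\to\infty}\sqrt r\Big(\frac{\partial\psi}{\partial r}-ik_s\psi\Big)=0$$ uniformly in all directions. 2. $u$ has a far field pattern, i.e. there are functions $u_p^\infty,u_s^\infty:\mathbb{S}\to\mathbb{C}$ with $$u(x)=\frac{e^{ik_p|x|}}{\sqrt{|x|}}u_p^\infty(\hat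 x)\,\hat x+\frac{e^{ik_s|x|}}{\sqrt{|x|}}u_s^\infty(\hat x)\,\hat x^\perp+O(|x|^{-3/2}),\qquad |x|\to\infty,$$ uniformly in $\hat x$. For any such $u_p^\infty$, $u_s^\infty$, the functions $\phi$ and $\psi$ have unique far field patterns $\phi_\infty,\psi_\infty:\mathbb{S}\to\mathbb{C}$, defined by $$\phi(x)=\frac{e^{ik_p|x|}}{\sqrt{|x|}}\Big\{\phi_\infty(\hat x)+O\Big(\frac1{|x|}\Big)\Big\},\qquad \psi(x)=\frac{e^{ik_s|x|}}{\sqrt{|x|}}\Big\{\psi_\infty(\hat x)+O\Big(\frac1{|x|}\Big)\Big\},\qquad |x|\to\infty,$$ uniformly in $\hat x$, and these are $$\phi_\infty(\hat x)=\frac1{ik_p}u_p^\infty(\hat x),\qquad \psi_\infty(\hat x)=\frac1{ik_s}u_s^\infty(\hat x),\qquad \hat x\in\mathbb{S}.$$ -/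

import Mathlib

open Filter Topology

noncomputable section

namespace Elastic

/-- The plane `ℝ²` with its Euclidean norm. -/
abbrev Plane : Type := EuclideanSpace ℝ (Fin 2)

/-- Complex two-vectors, the values of (time-harmonic) displacement fields. -/
abbrev CVec : Type := EuclideanSpace ℂ (Fin 2)

/-- The unit circle. -/
abbrev Circ : Type := Metric.sphere (0 : Plane) 1

/-- The partial derivative `∂ᵢ f` of a complex-valued function on the plane. -/
def pd (i : Fin 2) (f : Plane → ℂ) (x : Plane) : ℂ :=
  fderiv ℝ f x (EuclideanSpace.single i 1)

/-- `grad f = (∂₁ f, ∂₂ f)`. -/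
def grad (f : Plane → ℂ) (x : Plane) : CVec := !₂[pd 0 f x, pd 1 f x]

/-- `grad^⊥ f = (-∂₂ f, ∂₁ f)`. -/
def gradPerp (f : Plane → ℂ) (x : Plane) : CVec := !₂[-pd 1 f x, pd 0 f x]

/-- `div u = ∂₁ u₁ + ∂₂ u₂`. -/
def div (u : Plane → CVec) (x : Plane) : ℂ :=
  pd 0 (fun y => u y 0) x + pd 1 (fun y => u y 1) x

/-- `div^⊥ u = ∂₁ u₂ - ∂₂ u₁`. -/
def divPerp (u : Plane → CVec) (x : Plane) : ℂ :=
  pd 0 (fun y => u y 1) x - pd 1 (fun y => u y 0) x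

/-- `Δ* u = μ Δ u + (lam + μ) grad div u`. -/
def lameOp (lam μ : ℝ) (u : Plane → CVec) (x : Plane) : CVec :=
  μ • Laplacian.laplacian u x + (lam + μ) • grad (div u) x

/-- The compressional wave number `k_p = ω / √(2μ + lam)`. -/
def waveP (lam μ ω : ℝ) : ℝ := ω / √(2 * μ + lam)

/-- The shear wave number `k_s = ω / √μ`. -/
def waveS (μ ω : ℝ) : ℝ := ω / √μ

/-- The compressional part `u_p = -(1 / k_p²) grad div u`, with `k = k_p`. -/
def compressionalPart (k : ℝ) (u : Plane → CVec) (x : Plane) : CVec :=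
  (-(1 / k ^ 2)) • grad (div u) x

/-- The shear part `u_s = -(1 / k_s²) grad^⊥ div^⊥ u`, with `k = k_s`. -/
def shearPart (k : ℝ) (u : Plane → CVec) (x : Plane) : CVec :=
  (-(1 / k ^ 2)) • gradPerp (divPerp u) x

/-- The radial derivative `∂w/∂r` at `x ≠ 0`, i.e. the derivative in the direction `x / |x|`. -/
def radialDeriv {F : Type*} [NormedAddCommGroup F] [NormedSpace ℝ F]
    (w : Plane → F) (x : Plane) : F :=
  fderiv ℝ w x (‖x‖⁻¹ • x)

/-- The Sommerfeld radiation condition `√r (∂w/∂r - i k w) → 0` as `r = |x| → ∞`, uniformly in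
all directions (the filter `cobounded` lets `|x| → ∞` with no restriction on the direction). -/
def SommerfeldCondition {F : Type*} [NormedAddCommGroup F] [NormedSpace ℝ F] [NormedSpace ℂ F]
    (k : ℝ) (w : Plane → F) : Prop :=
  Tendsto (fun x : Plane => √‖x‖ • (radialDeriv w x - (Complex.I * (k : ℂ)) • w x))
    (Bornology.cobounded Plane) (𝓝 0)

/-- `u` is a radiating (scattered-field) solution of the Navier equation
`Δ* u + ω² u = 0` outside `closure D`. -/
structure IsRadiatingNavier (D : Set Plane) (lam μ ω : ℝ) (u : Plane → CVec) : Prop where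
  contDiffOn : ContDiffOn ℝ 2 u (closure D)ᶜ
  navier : ∀ x ∈ (closure D)ᶜ, lameOp lam μ u x + (ω ^ 2) • u x = 0
  radiation_p : SommerfeldCondition (waveP lam μ ω) (compressionalPart (waveP lam μ ω) u)
  radiation_s : SommerfeldCondition (waveS μ ω) (shearPart (waveS μ ω) u)

/-- `v` is a radiating solution of the Helmholtz equation `Δ v + k² v = 0` outside `closure D`. -/
structure IsRadiatingHelmholtz (D : Set Plane) (k : ℝ) (v : Plane → ℂ) : Prop where
  contDiffOn : ContDiffOn ℝ 2 v (closure D)ᶜ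
  helmholtz : ∀ x ∈ (closure D)ᶜ, Laplacian.laplacian v x + (k : ℂ) ^ 2 * v x = 0
  radiation : SommerfeldCondition k v

/-- The outgoing factor `e^{ikr} / √r`. -/
def outgoing (k r : ℝ) : ℂ := Complex.exp (Complex.I * (k : ℂ) * (r : ℂ)) / ((√r : ℝ) : ℂ)

/-- A direction `(a, b)` of the unit circle as a complex vector. -/
def dir (e : Circ) : CVec := !₂[((e.1 0 : ℝ) : ℂ), ((e.1 1 : ℝ) : ℂ)]

/-- The direction `(-b, a)` obtained from `(a, b)` by the anticlockwise rotation through `π/2`. -/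
def dirPerp (e : Circ) : CVec := !₂[-((e.1 1 : ℝ) : ℂ), ((e.1 0 : ℝ) : ℂ)]

/-- `vInf` is the far field pattern of the scalar field `v` with wave number `k`:
`v(x) = e^{ik|x|}/√|x| (vInf(x̂) + O(1/|x|))`, uniformly in `x̂`. -/
def IsFarField (k : ℝ) (v : Plane → ℂ) (vInf : Circ → ℂ) : Prop :=
  ∃ C R : ℝ, 0 < R ∧ ∀ e : Circ, ∀ r : ℝ, R ≤ r →
    ‖v (r • e.1) - outgoing k r * vInf e‖ ≤ C * r ^ (-(3 / 2) : ℝ)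

/-- `(upInf; usInf)` is the far field pattern of the displacement field `u`:
`u(x) = e^{ik_p|x|}/√|x| upInf(x̂) x̂ + e^{ik_s|x|}/√|x| usInf(x̂) x̂^⊥ + O(|x|^{-3/2})`,
uniformly in `x̂`. -/
def IsElasticFarField (kp ks : ℝ) (u : Plane → CVec) (upInf usInf : Circ → ℂ) : Prop :=
  ∃ C R : ℝ, 0 < R ∧ ∀ e : Circ, ∀ r : ℝ, R ≤ r →
    ‖u (r • e.1) - ((outgoing kp r * upInf e) • dir e + (outgoing ks r * usInf e) • dirPerp e)‖
      ≤ C * r ^ (-(3 / 2) : ℝ)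

end Elastic

end

open Filter Topology

namespace Elastic

/-! Since `Δu = grad div u + grad^⊥ div^⊥ u`, the Navier equation divided by `ω²` reads `u = grad φ
+ grad^⊥ ψ`, with `div u = -k_p² φ` and `div^⊥ u = -k_s² ψ` (`HodgeHelmholtz.of_navier`). Because
`u` is only `C²`, the potentials are a priori only `C¹`, so the Helmholtz equation is first used in
this first-order form. The system is symmetric under a quarter turn (`HodgeHelmholtz.rotate`), so
each result for `φ` also serves `ψ`.

Regularity: circle averages of `φ` about `x` solve the Bessel equation of order zero, so they equal
`φ x` times those of a plane wave about the origin (`HodgeHelmholtz.angularIntegral_eq`).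
Convolution with a small radial bump therefore reproduces `φ` up to a nonzero constant, and `φ` is
smooth (`HodgeHelmholtz.contDiffOn_top`). The second-order Helmholtz equations follow.

Radiation: the hypotheses control `grad φ` and `grad^⊥ ψ`, hence only `∂φ/∂r` and `∂ψ/∂r`. Let `v`
be either potential. Each angular Fourier mode of `v` solves a Bessel equation, and that equation
carries the radiation condition from the derivative back to the mode
(`sommerfeld_of_sommerfeld_deriv`). Energy and Wronskian arguments then bound the `n`-th mode for
all large `r` by its data on one circle, with a loss polynomial in `n` (`norm_le_of_mode_pos`,
`norm_le_of_mode_nonpos`). Smoothness makes those data decay rapidly in `n`, so `v`, `∂v/∂θ` and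
`∂²v/∂θ²` are `O(r^{-1/2})` uniformly (`exists_angular_bounds`).

Asymptotics: on each ray `V = √r v` now satisfies `V'' + k²V = O(r^{-2})` and is outgoing, so `V =
e^{ikr}L + O(1/r)` and `∂v/∂r - ikv = O(r^{-3/2})` (`exists_far_field`). Writing `grad φ + grad^⊥ ψ`
in the polar frame, radial derivatives become multiplication by `ik` and angular ones are of lower
order, which gives the pattern of `u` (`HodgeHelmholtz.norm_sub_elastic_le`). Uniqueness of patterns
extends the relation to any pattern of `u`. -/

/-! ### Parameter integrals and Fourier coefficients on the circle -/

theorem hasDerivAt_intervalIntegral_of_continuousOn {f f' : ℝ → ℝ → ℂ} {U : Set ℝ}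
    (hU : IsOpen U) {r : ℝ} (hr : r ∈ U) (a b : ℝ) (hf : ∀ s ∈ U, Continuous (f s))
    (hf' : ContinuousOn (Function.uncurry f') (U ×ˢ Set.univ))
    (hd : ∀ s ∈ U, ∀ θ, HasDerivAt (fun s => f s θ) (f' s θ) s) :
    HasDerivAt (fun s => ∫ θ in a..b, f s θ) (∫ θ in a..b, f' r θ) r := by
  obtain ⟨ε, hε, hball⟩ := Metric.nhds_basis_closedBall.mem_iff.1 (hU.mem_nhds hr)
  have hK : IsCompact (Metric.closedBall r ε ×ˢ Set.uIcc a b) :=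
    (isCompact_closedBall r ε).prod isCompact_uIcc
  obtain ⟨C, hC⟩ := hK.exists_bound_of_continuousOn
    (hf'.mono (Set.prod_mono hball (Set.subset_univ _)))
  have hcont : Continuous (f' r) :=
    hf'.comp_continuous (by fun_prop : Continuous fun θ : ℝ => (r, θ)) (fun θ => ⟨hr, trivial⟩)
  refine (intervalIntegral.hasDerivAt_integral_of_dominated_loc_of_deriv_le
    (F := f) (F' := f') (bound := fun _ => C) (Metric.closedBall_mem_nhds r hε) ?_
    ((hf r hr).intervalIntegrable _ _) hcont.aestronglyMeasurable ?_ (by simp) ?_).2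
  · filter_upwards [hU.mem_nhds hr] with s hs using (hf s hs).aestronglyMeasurable
  · exact Eventually.of_forall fun θ hθ s hs => hC (s, θ) ⟨hs, Set.uIoc_subset_uIcc hθ⟩
  · exact Eventually.of_forall fun θ _ s hs => hd s (hball hs) θ

/-- The (unnormalised) `n`-th Fourier coefficient of a function on the circle `ℝ / 2πℤ`. -/
noncomputable def fcoeff (n : ℤ) (f : ℝ → ℂ) : ℂ :=
  ∫ θ in (0 : ℝ)..2 * Real.pi, f θ * Complex.exp (-(n * θ * Complex.I))

theorem norm_fcoeff_le {f : ℝ → ℂ} {B : ℝ} (hB : ∀ θ, ‖f θ‖ ≤ B) (n : ℤ) :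
    ‖fcoeff n f‖ ≤ 2 * Real.pi * B := by
  have h := intervalIntegral.norm_integral_le_of_norm_le_const (a := 0) (b := 2 * Real.pi) (C := B)
    (f := fun θ : ℝ => f θ * Complex.exp (-(n * θ * Complex.I))) (fun θ _ => by
      rw [norm_mul]
      have : ‖Complex.exp (-(n * θ * Complex.I))‖ = 1 := by
        rw [Complex.norm_exp]; simp
      rw [this, mul_one]; exact hB θ)
  have hp : |2 * Real.pi - 0| = 2 * Real.pi := by
    rw [sub_zero, abs_of_pos Real.two_pi_pos]
  rw [hp] at h
  unfold fcoeff
  linarith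

theorem exp_periodic (n : ℤ) :
    Function.Periodic (fun θ : ℝ => Complex.exp (-(n * θ * Complex.I))) (2 * Real.pi) := by
  intro θ
  have : -((n : ℂ) * ((θ + 2 * Real.pi : ℝ) : ℂ) * Complex.I)
      = -(n * θ * Complex.I) + ((-n : ℤ) : ℂ) * (2 * Real.pi * Complex.I) := by
    push_cast; ring
  simp only [this, Complex.exp_add, Complex.exp_int_mul_two_pi_mul_I, mul_one]

theorem fcoeff_deriv {f f' : ℝ → ℂ} (hper : Function.Periodic f (2 * Real.pi))
    (hf' : Continuous f') (hd : ∀ θ, HasDerivAt f (f' θ) θ) (n : ℤ) :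
    fcoeff n f' = Complex.I * n * fcoeff n f := by
  have hexp : ∀ θ : ℝ, HasDerivAt (fun θ : ℝ => Complex.exp (-(n * θ * Complex.I)))
      (-(n * Complex.I) * Complex.exp (-(n * θ * Complex.I))) θ := by
    intro θ
    have h1 : HasDerivAt (fun θ : ℝ => -((n : ℂ) * θ * Complex.I)) (-(n * 1 * Complex.I)) θ :=
      ((Complex.ofRealCLM.hasDerivAt.const_mul (n : ℂ)).mul_const Complex.I).neg
    convert h1.cexp using 1
    ring
  have h := intervalIntegral.integral_deriv_mul_eq_sub (a := 0) (b := 2 * Real.pi)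
    (fun θ _ => hd θ) (fun θ _ => hexp θ) (hf'.intervalIntegrable _ _)
    ((by fun_prop : Continuous fun θ : ℝ => -((n : ℂ) * Complex.I) *
      Complex.exp (-(n * θ * Complex.I))).intervalIntegrable _ _)
  have h0 : f (2 * Real.pi) = f 0 := by simpa using hper 0
  have h1 := exp_periodic n 0
  rw [zero_add] at h1
  have h1' : Complex.exp (-(n * ((2 * Real.pi : ℝ) : ℂ) * Complex.I)) =
    Complex.exp (-(n * ((0 : ℝ) : ℂ) * Complex.I)) := h1
  rw [h0, h1', sub_self] at h
  have hcf : Continuous f := continuous_iff_continuousAt.2 fun θ => (hd θ).continuousAt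
  rw [intervalIntegral.integral_add] at h
  · unfold fcoeff
    rw [eq_neg_of_add_eq_zero_left h, ← intervalIntegral.integral_const_mul,
      ← intervalIntegral.integral_neg]
    congr 1
    ext θ
    ring
  · exact (by fun_prop : Continuous fun θ : ℝ => f' θ *
      Complex.exp (-(n * θ * Complex.I))).intervalIntegrable _ _
  · exact (by fun_prop : Continuous fun θ : ℝ => f θ * (-((n : ℂ) * Complex.I) *
      Complex.exp (-(n * θ * Complex.I)))).intervalIntegrable _ _

/-- A summable bound on the coefficients makes the Fourier series converge pointwise to `f`, so mode
bounds become sup bounds. The normalising factor `1/(2π)` is at most one and is discarded. -/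
theorem norm_le_tsum_of_fcoeff_le {f : ℝ → ℂ} (hf : Continuous f)
    (hper : Function.Periodic f (2 * Real.pi)) {b : ℤ → ℝ} (hb : Summable b)
    (hfb : ∀ n, ‖fcoeff n f‖ ≤ b n) (θ : ℝ) : ‖f θ‖ ≤ ∑' n, b n := by
  have : Fact (0 < 2 * Real.pi) := ⟨Real.two_pi_pos⟩
  let g : C(AddCircle (2 * Real.pi), ℂ) :=
    ⟨hper.lift, continuous_coinduced_dom.2 hf⟩
  have hg : ∀ θ : ℝ, g (θ : AddCircle (2 * Real.pi)) = f θ := fun θ => hper.lift_coe θ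
  have hcoef : ∀ n, ‖fourierCoeff g n‖ ≤ b n := by
    intro n
    have h1 : fourierCoeff g n = (1 / (2 * Real.pi)) • fcoeff n f := by
      rw [fourierCoeff_eq_intervalIntegral g n 0, zero_add]
      congr 1
      unfold fcoeff
      congr 1
      ext θ
      rw [hg, fourier_coe_apply, smul_eq_mul, mul_comm]
      congr 2
      have : (Real.pi : ℂ) ≠ 0 := by exact_mod_cast Real.pi_ne_zero
      push_cast
      field_simp
    rw [h1, norm_smul, Real.norm_of_nonneg (by positivity)]
    have h2 : 1 / (2 * Real.pi) ≤ 1 := by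
      rw [div_le_one Real.two_pi_pos]; linarith [Real.pi_gt_three]
    calc _ ≤ 1 * ‖fcoeff n f‖ := by gcongr
      _ ≤ b n := by rw [one_mul]; exact hfb n
  have hsum : Summable (fourierCoeff g) := Summable.of_norm_bounded hb hcoef
  have h := has_pointwise_sum_fourier_series_of_summable hsum (θ : AddCircle (2 * Real.pi))
  rw [hg] at h
  rw [← h.tsum_eq]
  refine tsum_of_norm_bounded hb.hasSum fun n => ?_
  rw [norm_smul]
  have : ‖fourier n (θ : AddCircle (2 * Real.pi))‖ = 1 := by
    rw [fourier_apply]; exact Circle.norm_coe _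
  rw [this, mul_one]
  exact hcoef n

theorem summable_one_div_one_add_int_sq : Summable fun n : ℤ => 1 / (1 + (n : ℝ) ^ 2) := by
  have h : Summable fun n : ℤ => 1 / (n : ℝ) ^ 2 := Real.summable_one_div_int_pow.2 (by norm_num)
  refine Summable.of_norm_bounded_eventually h ?_
  filter_upwards [(Set.finite_singleton (0 : ℤ)).compl_mem_cofinite] with n hn
  have hn' : (n : ℝ) ≠ 0 := by exact_mod_cast hn
  rw [Real.norm_of_nonneg (by positivity)]
  gcongr
  linarith

/-! ### Circles about a point: radial and angular differentiation -/

/-- The unit vector `(cos θ, sin θ)`. -/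
noncomputable def circ (θ : ℝ) : Plane := !₂[Real.cos θ, Real.sin θ]

/-- The tangent direction `(-sin θ, cos θ)`. -/
noncomputable def circPerp (θ : ℝ) : Plane := !₂[-Real.sin θ, Real.cos θ]

theorem circ_eq (θ : ℝ) : circ θ =
    Real.cos θ • EuclideanSpace.single 0 1 + Real.sin θ • EuclideanSpace.single 1 1 := by
  ext i; fin_cases i <;> simp [circ]

theorem circPerp_eq (θ : ℝ) : circPerp θ =
    (-Real.sin θ) • EuclideanSpace.single 0 1 + Real.cos θ • EuclideanSpace.single 1 1 := by
  ext i; fin_cases i <;> simp [circPerp]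

theorem contDiff_circ : ContDiff ℝ ⊤ circ := by
  rw [funext circ_eq]; fun_prop

theorem contDiff_circPerp : ContDiff ℝ ⊤ circPerp := by
  rw [funext circPerp_eq]; fun_prop

theorem continuous_circ : Continuous circ := contDiff_circ.continuous

theorem continuous_circPerp : Continuous circPerp := contDiff_circPerp.continuous

theorem hasDerivAt_circ (θ : ℝ) : HasDerivAt circ (circPerp θ) θ := by
  rw [funext circ_eq, circPerp_eq]
  exact ((Real.hasDerivAt_cos θ).smul_const _).add ((Real.hasDerivAt_sin θ).smul_const _)

theorem norm_circ (θ : ℝ) : ‖circ θ‖ = 1 := by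
  simp [circ, EuclideanSpace.norm_eq]

theorem norm_smul_circ {r : ℝ} (hr : 0 ≤ r) (θ : ℝ) : ‖r • circ θ‖ = r := by
  rw [norm_smul, norm_circ, mul_one, Real.norm_of_nonneg hr]

theorem circ_periodic : Function.Periodic circ (2 * Real.pi) := by
  intro θ; simp [circ]

theorem fderiv_circ (f : Plane → ℂ) (x : Plane) (θ : ℝ) :
    fderiv ℝ f x (circ θ) = Real.cos θ * pd 0 f x + Real.sin θ * pd 1 f x := by
  rw [circ_eq, map_add, map_smul, map_smul]; simp [pd]

theorem fderiv_circPerp (f : Plane → ℂ) (x : Plane) (θ : ℝ) :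
    fderiv ℝ f x (circPerp θ) = -Real.sin θ * pd 0 f x + Real.cos θ * pd 1 f x := by
  rw [circPerp_eq, map_add, map_smul, map_smul]; simp [pd]

theorem exists_circ (e : Circ) : ∃ θ : ℝ, e.1 = circ θ := by
  have h : e.1 0 ^ 2 + e.1 1 ^ 2 = 1 := by
    have h1 : ‖e.1‖ = 1 := by simp
    have h2 := EuclideanSpace.real_norm_sq_eq e.1
    rw [h1, Fin.sum_univ_two] at h2
    linarith
  have hz : ‖(⟨e.1 0, e.1 1⟩ : ℂ)‖ = 1 := by
    rw [Complex.norm_def, Complex.normSq_mk, Real.sqrt_eq_one]; nlinarith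
  refine ⟨Complex.arg ⟨e.1 0, e.1 1⟩, ?_⟩
  have hz0 : (⟨e.1 0, e.1 1⟩ : ℂ) ≠ 0 := by
    intro h0; rw [h0] at hz; simp at hz
  ext i
  fin_cases i
  · simp [circ, Complex.cos_arg hz0, hz]
  · simp [circ, Complex.sin_arg, hz]

/-- Signed radii in `(-R, R)` are admitted so that `r = 0` is an interior point; circle integrals
are then continuous at the centre without a one-sided argument. -/
theorem continuousOn_fderiv_comp_circ {w : Plane → ℂ} {x : Plane} {R : ℝ}
    (hw : ContDiffOn ℝ 1 w (Metric.ball x R)) {v : ℝ → Plane} (hv : Continuous v) :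
    ContinuousOn (fun p : ℝ × ℝ => fderiv ℝ w (x + p.1 • circ p.2) (v p.2))
      (Set.Ioo (-R) R ×ˢ Set.univ) := by
  have h1 := hw.continuousOn_fderiv_of_isOpen Metric.isOpen_ball le_rfl
  have h2 : Continuous fun p : ℝ × ℝ => x + p.1 • circ p.2 := by
    have := continuous_circ
    fun_prop
  refine (h1.comp h2.continuousOn ?_).clm_apply (hv.comp continuous_snd).continuousOn
  rintro ⟨r, θ⟩ ⟨hr, -⟩
  simpa [norm_smul, norm_circ, abs_lt] using hr

theorem mem_ball_add_smul_circ {x : Plane} {R r : ℝ} (hr : r ∈ Set.Ioo (-R) R) (θ : ℝ) :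
    x + r • circ θ ∈ Metric.ball x R := by
  simpa [norm_smul, norm_circ, abs_lt] using hr

theorem continuous_comp_circ {w : Plane → ℂ} {x : Plane} {R r : ℝ}
    (hw : ContinuousOn w (Metric.ball x R)) (hr : r ∈ Set.Ioo (-R) R) :
    Continuous fun θ => w (x + r • circ θ) := by
  have := continuous_circ
  exact hw.comp_continuous (by fun_prop) (mem_ball_add_smul_circ hr)

theorem hasDerivAt_circleIntegral_radius {w : Plane → ℂ} {x : Plane} {R r : ℝ} {g : ℝ → ℂ}
    (hw : ContDiffOn ℝ 1 w (Metric.ball x R)) (hg : Continuous g) (hr : r ∈ Set.Ioo (-R) R) :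
    HasDerivAt (fun s : ℝ => ∫ θ in (0 : ℝ)..2 * Real.pi, w (x + s • circ θ) * g θ)
      (∫ θ in (0 : ℝ)..2 * Real.pi, fderiv ℝ w (x + r • circ θ) (circ θ) * g θ) r := by
  refine hasDerivAt_intervalIntegral_of_continuousOn
    (f := fun s θ => w (x + s • circ θ) * g θ)
    (f' := fun s θ => fderiv ℝ w (x + s • circ θ) (circ θ) * g θ) isOpen_Ioo hr _ _ ?_ ?_ ?_
  · intro s hs
    exact (continuous_comp_circ hw.continuousOn hs).mul hg
  · exact (continuousOn_fderiv_comp_circ hw continuous_circ).mul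
      (hg.comp continuous_snd).continuousOn
  · intro s hs θ
    have h1 : HasFDerivAt w (fderiv ℝ w (x + s • circ θ)) (x + s • circ θ) :=
      ((hw.contDiffAt (Metric.isOpen_ball.mem_nhds
        (mem_ball_add_smul_circ hs θ))).differentiableAt one_ne_zero).hasFDerivAt
    have h2 : HasDerivAt (fun s : ℝ => x + s • circ θ) (circ θ) s := by
      simpa using ((hasDerivAt_id s).smul_const (circ θ)).const_add x
    exact (h1.comp_hasDerivAt s h2).mul_const _

/-- Integration by parts in the angle: `r` times the tangential derivative is `∂/∂θ`, and the
boundary terms cancel by periodicity. -/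
theorem integral_fderiv_circPerp_mul {w : Plane → ℂ} {x : Plane} {R r : ℝ} {g g' : ℝ → ℂ}
    (hw : ContDiffOn ℝ 1 w (Metric.ball x R)) (hg : ∀ θ, HasDerivAt g (g' θ) θ)
    (hg' : Continuous g') (hper : g (2 * Real.pi) = g 0) (hr : r ∈ Set.Ioo (-R) R) :
    r * ∫ θ in (0 : ℝ)..2 * Real.pi, fderiv ℝ w (x + r • circ θ) (circPerp θ) * g θ =
      -∫ θ in (0 : ℝ)..2 * Real.pi, w (x + r • circ θ) * g' θ := by
  have hd : ∀ θ, HasDerivAt (fun θ => w (x + r • circ θ))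
      (r * fderiv ℝ w (x + r • circ θ) (circPerp θ)) θ := by
    intro θ
    have h1 : HasFDerivAt w (fderiv ℝ w (x + r • circ θ)) (x + r • circ θ) :=
      ((hw.contDiffAt (Metric.isOpen_ball.mem_nhds
        (mem_ball_add_smul_circ hr θ))).differentiableAt one_ne_zero).hasFDerivAt
    have h2 : HasDerivAt (fun θ : ℝ => x + r • circ θ) (r • circPerp θ) θ :=
      ((hasDerivAt_circ θ).const_smul r).const_add x
    have h3 := h1.comp_hasDerivAt θ h2
    rw [map_smul, Complex.real_smul] at h3
    exact h3
  have hgc : Continuous g := continuous_iff_continuousAt.2 fun θ => (hg θ).continuousAt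
  have hc1 : Continuous fun θ => fderiv ℝ w (x + r • circ θ) (circPerp θ) :=
    (continuousOn_fderiv_comp_circ hw continuous_circPerp).comp_continuous
      (by fun_prop : Continuous fun θ : ℝ => (r, θ)) fun θ => ⟨hr, trivial⟩
  have hc2 := continuous_comp_circ hw.continuousOn hr
  have h := intervalIntegral.integral_deriv_mul_eq_sub (a := 0) (b := 2 * Real.pi)
    (fun θ _ => hd θ) (fun θ _ => hg θ)
    ((by fun_prop : Continuous fun θ : ℝ =>
      (r : ℂ) * fderiv ℝ w (x + r • circ θ) (circPerp θ)).intervalIntegrable _ _)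
    (hg'.intervalIntegrable _ _)
  have hcirc : circ (2 * Real.pi) = circ 0 := by simpa using circ_periodic 0
  rw [hper, hcirc, sub_self, intervalIntegral.integral_add] at h
  · rw [← eq_neg_of_add_eq_zero_left h, ← intervalIntegral.integral_const_mul]
    congr 1
    ext θ
    ring
  · exact (by fun_prop : Continuous fun θ : ℝ =>
      (r : ℂ) * fderiv ℝ w (x + r • circ θ) (circPerp θ) * g θ).intervalIntegrable _ _
  · exact (hc2.mul hg').intervalIntegrable _ _

/-! ### Mean value property for the first-order system -/

/-- First-order (Hodge) form of the Helmholtz equation on a set. -/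
structure HodgeHelmholtz (k : ℝ) (φ ψ a b : Plane → ℂ) (U : Set Plane) : Prop where
  contDiffOn_φ : ContDiffOn ℝ 1 φ U
  contDiffOn_ψ : ContDiffOn ℝ 1 ψ U
  contDiffOn_a : ContDiffOn ℝ 1 a U
  contDiffOn_b : ContDiffOn ℝ 1 b U
  eq_a : ∀ x ∈ U, a x = pd 0 φ x - pd 1 ψ x
  eq_b : ∀ x ∈ U, b x = pd 1 φ x + pd 0 ψ x
  div_eq : ∀ x ∈ U, pd 0 a x + pd 1 b x = -(k : ℂ) ^ 2 * φ x

theorem HodgeHelmholtz.mono {k : ℝ} {φ ψ a b : Plane → ℂ} {U V : Set Plane}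
    (h : HodgeHelmholtz k φ ψ a b U) (hV : V ⊆ U) : HodgeHelmholtz k φ ψ a b V :=
  ⟨h.1.mono hV, h.2.mono hV, h.3.mono hV, h.4.mono hV, fun x hx => h.5 x (hV hx),
    fun x hx => h.6 x (hV hx), fun x hx => h.7 x (hV hx)⟩

/-- The integral of `w` over the circle of radius `r` about `x`, in the angular measure. -/
noncomputable def angularIntegral (w : Plane → ℂ) (x : Plane) (r : ℝ) : ℂ :=
  ∫ θ in (0 : ℝ)..2 * Real.pi, w (x + r • circ θ)

/-- `N` is the flux of `(a, b)` through the circle, in angular measure. It is the derivative of the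
average of `φ` because the `ψ` part is tangential, and the divergence theorem in the form `N' + N/r
= ∫ div (a, b)` closes the system. Only first derivatives occur, as the `C¹` hypotheses require. -/
theorem HodgeHelmholtz.exists_flux {k : ℝ} {φ ψ a b : Plane → ℂ} {x : Plane} {R : ℝ}
    (h : HodgeHelmholtz k φ ψ a b (Metric.ball x R)) :
    ∃ N : ℝ → ℂ, N 0 = 0 ∧ ContinuousOn N (Set.Ioo (-R) R) ∧
      ContinuousOn (angularIntegral φ x) (Set.Ioo (-R) R) ∧
      ∀ r ∈ Set.Ioo 0 R, HasDerivAt (angularIntegral φ x) (N r) r ∧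
        HasDerivAt N (-(k : ℂ) ^ 2 * angularIntegral φ x r - N r / r) r := by
  have hcos : Continuous fun θ : ℝ => (Real.cos θ : ℂ) := by fun_prop
  have hsin : Continuous fun θ : ℝ => (Real.sin θ : ℂ) := by fun_prop
  have hM : ∀ r ∈ Set.Ioo (-R) R, HasDerivAt (angularIntegral φ x)
      (∫ θ in (0 : ℝ)..2 * Real.pi, fderiv ℝ φ (x + r • circ θ) (circ θ)) r := by
    intro r hr
    have := hasDerivAt_circleIntegral_radius (g := fun _ => 1) h.contDiffOn_φ continuous_const hr
    simp only [mul_one] at this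
    exact this
  let N : ℝ → ℂ := fun r => (∫ θ in (0 : ℝ)..2 * Real.pi, a (x + r • circ θ) * Real.cos θ) +
    ∫ θ in (0 : ℝ)..2 * Real.pi, b (x + r • circ θ) * Real.sin θ
  have hN : ∀ r ∈ Set.Ioo (-R) R, HasDerivAt N _ r := fun r hr =>
    (hasDerivAt_circleIntegral_radius h.contDiffOn_a hcos hr).add
      (hasDerivAt_circleIntegral_radius h.contDiffOn_b hsin hr)
  refine ⟨N, ?_, fun r hr => (hN r hr).continuousAt.continuousWithinAt,
    fun r hr => (hM r hr).continuousAt.continuousWithinAt, ?_⟩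
  · simp only [N, zero_smul, add_zero, intervalIntegral.integral_const_mul]
    rw [intervalIntegral.integral_ofReal, intervalIntegral.integral_ofReal]
    simp
  intro r hr
  have hr' : r ∈ Set.Ioo (-R) R := ⟨by linarith [hr.1, hr.2], hr.2⟩
  have hr0 : (r : ℂ) ≠ 0 := by exact_mod_cast hr.1.ne'
  have hcont : ∀ {w : Plane → ℂ}, ContDiffOn ℝ 1 w (Metric.ball x R) → ∀ {v : ℝ → Plane},
      Continuous v → Continuous fun θ => fderiv ℝ w (x + r • circ θ) (v θ) := fun hw v hv =>
    (continuousOn_fderiv_comp_circ hw hv).comp_continuous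
      (by fun_prop : Continuous fun θ : ℝ => (r, θ)) fun θ => ⟨hr', trivial⟩
  constructor
  · convert hM r hr' using 1
    -- The tangential derivative of `ψ` integrates to zero over the circle, so it can be added to
    -- the flux; the integrand then becomes `∂φ/∂r`.
    have h0 := integral_fderiv_circPerp_mul (g := fun _ => 1) (g' := fun _ => 0) h.contDiffOn_ψ
      (fun θ => hasDerivAt_const _ _) continuous_const rfl hr'
    simp only [mul_one, mul_zero, intervalIntegral.integral_zero, neg_zero] at h0
    have h1 := (mul_eq_zero.1 h0).resolve_left hr0
    have hca := continuous_comp_circ h.contDiffOn_a.continuousOn hr'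
    have hcb := continuous_comp_circ h.contDiffOn_b.continuousOn hr'
    have hcψ := hcont h.contDiffOn_ψ continuous_circPerp
    simp only [N]
    rw [← intervalIntegral.integral_add, ← add_zero (intervalIntegral _ _ _ _), ← h1,
      ← intervalIntegral.integral_add]
    rotate_left
    · exact ((hca.mul hcos).add (hcb.mul hsin)).intervalIntegrable _ _
    · exact hcψ.intervalIntegrable _ _
    · exact (hca.mul hcos).intervalIntegrable _ _
    · exact (hcb.mul hsin).intervalIntegrable _ _
    congr 1
    ext θ
    have hy := mem_ball_add_smul_circ (x := x) hr' θ
    rw [fderiv_circ, fderiv_circPerp, h.eq_a _ hy, h.eq_b _ hy]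
    ring
  · convert hN r hr' using 1
    -- Reading integration by parts backwards displays `N r` with a factor `r`. Hence `N/r` is an
    -- integral of tangential derivatives, and adding the radial ones in `N'` produces the
    -- divergence pointwise.
    have ha := integral_fderiv_circPerp_mul (g := fun θ => ((-Real.sin θ : ℝ) : ℂ))
      (g' := fun θ => ((-Real.cos θ : ℝ) : ℂ)) h.contDiffOn_a
      (fun θ => (Real.hasDerivAt_sin θ).neg.ofReal_comp) (by fun_prop) (by simp) hr'
    have hb := integral_fderiv_circPerp_mul (g := fun θ => ((Real.cos θ : ℝ) : ℂ))
      (g' := fun θ => ((-Real.sin θ : ℝ) : ℂ)) h.contDiffOn_b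
      (fun θ => (Real.hasDerivAt_cos θ).ofReal_comp) (by fun_prop) (by simp) hr'
    have hsum : N r = r * ((∫ θ in (0 : ℝ)..2 * Real.pi,
        fderiv ℝ a (x + r • circ θ) (circPerp θ) * ((-Real.sin θ : ℝ) : ℂ)) +
        ∫ θ in (0 : ℝ)..2 * Real.pi,
          fderiv ℝ b (x + r • circ θ) (circPerp θ) * ((Real.cos θ : ℝ) : ℂ)) := by
      rw [mul_add, ha, hb, ← intervalIntegral.integral_neg, ← intervalIntegral.integral_neg]
      simp [N]
    have hca := hcont h.contDiffOn_a continuous_circ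
    have hcb := hcont h.contDiffOn_b continuous_circ
    have hca' := hcont h.contDiffOn_a continuous_circPerp
    have hcb' := hcont h.contDiffOn_b continuous_circPerp
    rw [hsum, mul_div_cancel_left₀ _ hr0, sub_eq_iff_eq_add, angularIntegral,
      ← intervalIntegral.integral_const_mul, ← intervalIntegral.integral_add,
      ← intervalIntegral.integral_add, ← intervalIntegral.integral_add]
    · congr 1
      ext θ
      have hy := mem_ball_add_smul_circ (x := x) hr' θ
      rw [← h.div_eq _ hy, fderiv_circ, fderiv_circ, fderiv_circPerp, fderiv_circPerp]
      have := Complex.cos_sq_add_sin_sq (θ : ℂ)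
      push_cast
      linear_combination (-pd 0 a (x + r • circ θ) - pd 1 b (x + r • circ θ)) * this
    all_goals exact Continuous.intervalIntegrable (by fun_prop) _ _

/-- The energy `‖δ‖² + k²‖d‖²` has derivative `-2‖δ‖²/r ≤ 0`. The singular coefficient at `r = 0` is
thus dissipative, and continuity there suffices for uniqueness. -/
theorem eq_zero_of_bessel_zero_data {k R : ℝ} (hk : 0 < k) {d δ : ℝ → ℂ}
    (hdc : ContinuousOn d (Set.Ico 0 R)) (hδc : ContinuousOn δ (Set.Ico 0 R))
    (hd0 : d 0 = 0) (hδ0 : δ 0 = 0)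
    (hd : ∀ r ∈ Set.Ioo 0 R, HasDerivAt d (δ r) r)
    (hδ : ∀ r ∈ Set.Ioo 0 R, HasDerivAt δ (-(k : ℂ) ^ 2 * d r - δ r / r) r) :
    ∀ r ∈ Set.Ico 0 R, d r = 0 := by
  let E : ℝ → ℝ := fun r => ‖δ r‖ ^ 2 + k ^ 2 * ‖d r‖ ^ 2
  have hanti : AntitoneOn E (Set.Ico 0 R) := by
    refine antitoneOn_of_hasDerivWithinAt_nonpos (f' := fun r => -2 / r * ‖δ r‖ ^ 2)
      (convex_Ico 0 R) ((hδc.norm.pow 2).add ((hdc.norm.pow 2).const_mul _)) ?_ ?_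
    · intro r hr
      rw [interior_Ico] at hr
      have hr0 : r ≠ 0 := hr.1.ne'
      refine HasDerivAt.hasDerivWithinAt ?_
      have hE : HasDerivAt E _ r :=
        ((hδ r hr).norm_sq).add (((hd r hr).norm_sq).const_mul (k ^ 2))
      refine hE.congr_deriv ?_
      rw [← Complex.normSq_eq_norm_sq, Complex.normSq_apply]
      have : δ r / (r : ℂ) = ((r⁻¹ : ℝ) : ℂ) * δ r := by
        rw [Complex.ofReal_inv]; ring
      rw [this, ← Complex.ofReal_pow]
      simp only [Complex.inner, Complex.mul_re, Complex.conj_re, Complex.conj_im, Complex.sub_re,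
        Complex.sub_im, Complex.mul_im, Complex.neg_re, Complex.neg_im, Complex.ofReal_re,
        Complex.ofReal_im]
      field_simp
      ring
    · intro r hr
      rw [interior_Ico] at hr
      have := hr.1
      have h2 : -2 / r ≤ 0 := div_nonpos_of_nonpos_of_nonneg (by norm_num) this.le
      exact mul_nonpos_of_nonpos_of_nonneg h2 (by positivity)
  intro r hr
  have h0 : E 0 = 0 := by simp [E, hd0, hδ0]
  have h1 : E r ≤ 0 := h0 ▸ hanti ⟨le_rfl, hr.1.trans_lt hr.2⟩ hr hr.1
  have h2 : k ^ 2 * ‖d r‖ ^ 2 ≤ 0 := by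
    have : 0 ≤ ‖δ r‖ ^ 2 := by positivity
    simp only [E] at h1; linarith
  have h3 : ‖d r‖ ^ 2 ≤ 0 := by
    by_contra hcon
    push Not at hcon
    have : 0 < k ^ 2 * ‖d r‖ ^ 2 := by positivity
    linarith
  simpa using h3

/-- A plane wave. -/
noncomputable def planeWave (k : ℝ) (y : Plane) : ℂ := Complex.exp (Complex.I * k * (y 0 : ℝ))

theorem contDiff_planeWave (k : ℝ) {n : WithTop ℕ∞} : ContDiff ℝ n (planeWave k) := by
  have h : ContDiff ℝ n fun y : Plane => (((EuclideanSpace.proj 0 : Plane →L[ℝ] ℝ) y : ℝ) : ℂ) :=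
    Complex.ofRealCLM.contDiff.comp (ContinuousLinearMap.contDiff _)
  exact (contDiff_const.mul h).cexp

theorem fderiv_planeWave (k : ℝ) (y v : Plane) :
    fderiv ℝ (planeWave k) y v = Complex.I * k * (v 0 : ℝ) * planeWave k y := by
  have h1 : HasFDerivAt (fun y : Plane => Complex.I * k * ((y 0 : ℝ) : ℂ))
      ((Complex.I * k) • (Complex.ofRealCLM.comp (EuclideanSpace.proj 0 : Plane →L[ℝ] ℝ))) y :=
    (Complex.ofRealCLM.comp (EuclideanSpace.proj 0 : Plane →L[ℝ] ℝ)).hasFDerivAt.const_mul _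
  have h2 : HasFDerivAt (planeWave k) _ y := h1.cexp
  rw [h2.fderiv]
  simp [planeWave]
  ring

theorem pd_planeWave_zero (k : ℝ) (y : Plane) :
    pd 0 (planeWave k) y = Complex.I * k * planeWave k y := by
  simp [pd, fderiv_planeWave]

theorem pd_planeWave_one (k : ℝ) (y : Plane) : pd 1 (planeWave k) y = 0 := by
  simp [pd, fderiv_planeWave]

theorem pd_const_mul {i : Fin 2} {f : Plane → ℂ} {x : Plane} (c : ℂ)
    (hf : DifferentiableAt ℝ f x) : pd i (fun y => c * f y) x = c * pd i f x := by
  rw [pd, fderiv_const_mul hf]; rfl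

/-- A reference solution with value `1` at the origin. Its circle integral plays the role of `2π
J₀(kr)`, so no theory of Bessel functions is needed. -/
theorem hodgeHelmholtz_planeWave (k : ℝ) (U : Set Plane) :
    HodgeHelmholtz k (planeWave k) (fun _ => 0) (fun y => Complex.I * k * planeWave k y)
      (fun _ => 0) U where
  contDiffOn_φ := (contDiff_planeWave k).contDiffOn
  contDiffOn_ψ := contDiffOn_const
  contDiffOn_a := (contDiff_const.mul (contDiff_planeWave k)).contDiffOn
  contDiffOn_b := contDiffOn_const
  eq_a x _ := by rw [pd_planeWave_zero]; simp [pd]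
  eq_b x _ := by rw [pd_planeWave_one]; simp [pd]
  div_eq x _ := by
    rw [pd_const_mul _ ((contDiff_planeWave k (n := 1)).differentiable one_ne_zero x),
      pd_planeWave_zero]
    have : pd 1 (fun _ => (0 : ℂ)) x = 0 := by simp [pd]
    rw [this]
    linear_combination (k : ℂ) ^ 2 * planeWave k x * Complex.I_sq

/-- Both sides solve the same singular system, with equal values and zero flux at radius `0`, so
their difference vanishes. -/
theorem HodgeHelmholtz.angularIntegral_eq {k : ℝ} (hk : 0 < k) {φ ψ a b : Plane → ℂ} {x : Plane}
    {R : ℝ} (h : HodgeHelmholtz k φ ψ a b (Metric.ball x R)) {r : ℝ} (hr : r ∈ Set.Ico 0 R) :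
    angularIntegral φ x r = φ x * angularIntegral (planeWave k) 0 r := by
  obtain ⟨N, hN0, hNc, hMc, hMN⟩ := h.exists_flux
  obtain ⟨N', hN0', hNc', hMc', hMN'⟩ := (hodgeHelmholtz_planeWave k (Metric.ball 0 R)).exists_flux
  have hsub : Set.Ico 0 R ⊆ Set.Ioo (-R) R := fun s hs => ⟨by linarith [hs.1, hs.2], hs.2⟩
  rw [← sub_eq_zero]
  refine eq_zero_of_bessel_zero_data (d := fun r => angularIntegral φ x r -
    φ x * angularIntegral (planeWave k) 0 r) (δ := fun r => N r - φ x * N' r) hk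
    ((hMc.mono hsub).sub (continuousOn_const.mul (hMc'.mono hsub)))
    ((hNc.mono hsub).sub (continuousOn_const.mul (hNc'.mono hsub))) ?_ (by simp [hN0, hN0'])
    (fun s hs => (hMN s hs).1.sub ((hMN' s hs).1.const_mul _)) (fun s hs => ?_) r hr
  · simp [angularIntegral, planeWave]
    ring
  · refine ((hMN s hs).2.sub ((hMN' s hs).2.const_mul (φ x))).congr_deriv ?_
    ring

/-! ### Smoothness by convolution with a radial bump -/

/-- The profile of a radial bump function supported in the disc of radius `a`. -/
noncomputable def bumpProfile (a r : ℝ) : ℝ := Real.smoothTransition (1 - r ^ 2 / a ^ 2)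

theorem bumpProfile_nonneg (a r : ℝ) : 0 ≤ bumpProfile a r := Real.smoothTransition.nonneg _

theorem bumpProfile_eq_zero {a r : ℝ} (ha : 0 < a) (hr : a ≤ r) : bumpProfile a r = 0 := by
  refine Real.smoothTransition.zero_of_nonpos ?_
  rw [sub_nonpos, le_div_iff₀ (by positivity), one_mul]
  gcongr

theorem contDiff_bumpProfile (a : ℝ) : ContDiff ℝ (⊤ : ℕ∞) (bumpProfile a) :=
  Real.smoothTransition.contDiff.comp (by fun_prop)

/-- The profile depends on `r` only through `r²`, so it stays smooth at the origin, where the norm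
is not. -/
theorem contDiff_bumpProfile_norm (a : ℝ) :
    ContDiff ℝ (⊤ : ℕ∞) fun y : Plane => bumpProfile a ‖y‖ :=
  Real.smoothTransition.contDiff.comp
    (contDiff_const.sub ((contDiff_norm_sq ℝ).div_const _))

theorem hasCompactSupport_bumpProfile_norm {a : ℝ} (ha : 0 < a) :
    HasCompactSupport fun y : Plane => bumpProfile a ‖y‖ := by
  refine HasCompactSupport.intro (isCompact_closedBall (0 : Plane) a) fun y hy => ?_
  rw [mem_closedBall_zero_iff, not_le] at hy
  exact bumpProfile_eq_zero ha hy.le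

theorem integral_plane_eq_polar (F : Plane → ℂ) :
    ∫ y, F y = ∫ p in Set.Ioi (0 : ℝ) ×ˢ Set.Ioo (-Real.pi) Real.pi, p.1 • F (p.1 • circ p.2) := by
  let T := Complex.orthonormalBasisOneI.repr
  have hT : ∀ z : ℂ, T z = !₂[z.re, z.im] := by
    intro z
    ext i
    fin_cases i <;> simp [T]
  rw [← T.measurePreserving.integral_comp T.toHomeomorph.measurableEmbedding,
    ← Complex.integral_comp_polarCoord_symm]
  refine MeasureTheory.setIntegral_congr_fun
    (measurableSet_Ioi.prod measurableSet_Ioo) fun p _ => ?_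
  simp only [Complex.polarCoord_symm_apply, hT]
  congr 2
  ext i
  fin_cases i <;> simp [circ, -Complex.ofReal_cos, -Complex.ofReal_sin]

theorem integral_mul_bumpProfile_eq {w : Plane → ℂ} {x : Plane} {R a : ℝ}
    (hw : ContinuousOn w (Metric.ball x R)) (ha : 0 < a) (haR : a < R) :
    ∫ y, w (x + y) * (bumpProfile a ‖y‖ : ℂ) =
      ∫ r in Set.Ioc 0 a, (r * bumpProfile a r : ℂ) * angularIntegral w x r := by
  rw [integral_plane_eq_polar]
  have h1 : ∫ p in Set.Ioi (0 : ℝ) ×ˢ Set.Ioo (-Real.pi) Real.pi,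
      p.1 • (w (x + p.1 • circ p.2) * (bumpProfile a ‖p.1 • circ p.2‖ : ℂ)) =
      ∫ p in Set.Ioi (0 : ℝ) ×ˢ Set.Ioo (-Real.pi) Real.pi,
      (p.1 * bumpProfile a p.1 : ℂ) * w (x + p.1 • circ p.2) := by
    refine MeasureTheory.setIntegral_congr_fun (measurableSet_Ioi.prod measurableSet_Ioo)
      fun p hp => ?_
    have hp1 : (0 : ℝ) < p.1 := hp.1
    simp only [norm_smul_circ hp1.le, Complex.real_smul]
    ring
  rw [h1, MeasureTheory.setIntegral_eq_of_subset_of_forall_sdiff_eq_zero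
    (s := Set.Ioc 0 a ×ˢ Set.Ioo (-Real.pi) Real.pi) (measurableSet_Ioi.prod measurableSet_Ioo)
    (Set.prod_mono Set.Ioc_subset_Ioi_self subset_rfl)]
  · rw [MeasureTheory.Measure.volume_eq_prod, MeasureTheory.setIntegral_prod]
    · refine MeasureTheory.setIntegral_congr_fun measurableSet_Ioc fun r hr => ?_
      simp only
      rw [MeasureTheory.integral_const_mul, angularIntegral,
        ← MeasureTheory.integral_Ioc_eq_integral_Ioo,
        ← intervalIntegral.integral_of_le (by linarith [Real.pi_pos])]
      congr 1
      have hper : Function.Periodic (fun θ => w (x + r • circ θ)) (2 * Real.pi) := by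
        intro θ; simp only [circ_periodic θ]
      have := hper.intervalIntegral_add_eq (-Real.pi) 0
      rw [zero_add] at this
      rw [← this]
      congr 1
      ring
    · rw [← MeasureTheory.Measure.volume_eq_prod]
      refine MeasureTheory.IntegrableOn.mono_set (t := Set.Icc 0 a ×ˢ Set.Icc (-Real.pi) Real.pi)
        ?_ (Set.prod_mono Set.Ioc_subset_Icc_self Set.Ioo_subset_Icc_self)
      refine ContinuousOn.integrableOn_compact (isCompact_Icc.prod isCompact_Icc) ?_
      have hb := (contDiff_bumpProfile a).continuous
      have hc := continuous_circ
      refine ContinuousOn.mul (Continuous.continuousOn (by fun_prop)) (hw.comp (by fun_prop) ?_)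
      rintro ⟨r, θ⟩ ⟨hr, -⟩
      exact mem_ball_add_smul_circ ⟨by linarith [hr.1], by linarith [hr.2]⟩ θ
  · rintro ⟨r, θ⟩ ⟨⟨hr, hθ⟩, hn⟩
    have hra : a ≤ r := by
      by_contra hcon
      exact hn ⟨⟨hr, (not_le.1 hcon).le⟩, hθ⟩
    simp [bumpProfile_eq_zero ha hra]

/-- For `k a < 1` the phase stays within `[-1, 1]` on the support of the bump, so the real part `cos
(k y₁)` of the wave is nonnegative there, and the integral has positive real part. -/
theorem integral_planeWave_mul_bumpProfile_ne_zero {k a : ℝ} (hk : 0 < k) (ha : 0 < a)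
    (hka : k * a < 1) :
    ∫ y : Plane, planeWave k (0 + y) * (bumpProfile a ‖y‖ : ℂ) ≠ 0 := by
  have hcs := hasCompactSupport_bumpProfile_norm ha
  have hbc := (contDiff_bumpProfile_norm a).continuous
  have hpc : Continuous (planeWave k) := (contDiff_planeWave k (n := 0)).continuous
  have hint : MeasureTheory.Integrable
      fun y : Plane => planeWave k (0 + y) * (bumpProfile a ‖y‖ : ℂ) := by
    refine Continuous.integrable_of_hasCompactSupport (by fun_prop) ?_
    exact HasCompactSupport.mul_left (hcs.comp_left (g := Complex.ofReal) rfl)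
  have hre : ∀ y : Plane, (planeWave k (0 + y) * (bumpProfile a ‖y‖ : ℂ)).re =
      Real.cos (k * y 0) * bumpProfile a ‖y‖ := by
    intro y
    have : planeWave k y = Complex.exp ((k * y 0 : ℝ) * Complex.I) := by
      rw [planeWave]; push_cast; ring_nf
    rw [zero_add, this, Complex.re_mul_ofReal, Complex.exp_ofReal_mul_I_re]
  have hpos : 0 < ∫ y : Plane, Real.cos (k * y 0) * bumpProfile a ‖y‖ := by
    refine Continuous.integral_pos_of_hasCompactSupport_nonneg_nonzero (x := 0) (by fun_prop)
      (HasCompactSupport.mul_left hcs) ?_ ?_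
    · intro y
      by_cases hy : a ≤ ‖y‖
      · simp [bumpProfile_eq_zero ha hy]
      · refine mul_nonneg (Real.cos_nonneg_of_mem_Icc ?_) (bumpProfile_nonneg _ _)
        have h1 : |y 0| ≤ ‖y‖ := by simpa using PiLp.norm_apply_le y 0
        have h2 : |k * y 0| ≤ 1 := by
          rw [abs_mul, abs_of_pos hk]
          have := mul_le_mul_of_nonneg_left (h1.trans (not_le.1 hy).le) hk.le
          linarith
        have h3 := abs_le.1 h2
        have := Real.pi_gt_three
        exact ⟨by linarith, by linarith⟩
    · have : bumpProfile a 0 = 1 := by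
        simp [bumpProfile]
      simp [this]
  intro h0
  have := congrArg Complex.re h0
  rw [← RCLike.re_eq_complex_re, ← integral_re hint, RCLike.re_eq_complex_re] at this
  simp only [hre, Complex.zero_re] at this
  linarith

/-- Integrating the mean value property against the bump shows that convolution with it multiplies
`φ` by a nonzero constant `c` near each point; convolution with a smooth kernel is smooth. -/
theorem HodgeHelmholtz.contDiffOn_top {k : ℝ} (hk : 0 < k) {φ ψ a b : Plane → ℂ} {U : Set Plane}
    (hU : IsOpen U) (h : HodgeHelmholtz k φ ψ a b U) : ContDiffOn ℝ (⊤ : ℕ∞) φ U := by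
  intro x₀ hx₀
  obtain ⟨ε, hε, hball⟩ := Metric.isOpen_iff.1 hU x₀ hx₀
  -- Half the radius, so that the disc of radius `R` about any `x` within `R` of `x₀` stays in `U`,
  -- as does the closed disc of radius `R + α` about `x₀`.
  set R := ε / 2 with hR
  have hRpos : 0 < R := by positivity
  obtain ⟨α, hα, hαR⟩ := exists_between (lt_min hRpos (by positivity : 0 < 1 / k))
  have hα1 : α < R := hαR.trans_le (min_le_left _ _)
  have hα2 : k * α < 1 := by
    have := hαR.trans_le (min_le_right _ _)
    rwa [lt_div_iff₀ hk, mul_comm] at this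
  set c := ∫ y : Plane, planeWave k (0 + y) * (bumpProfile α ‖y‖ : ℂ) with hc
  have hc0 : c ≠ 0 := integral_planeWave_mul_bumpProfile_ne_zero hk hα hα2
  have hmean : ∀ x ∈ Metric.ball x₀ R,
      ∫ y : Plane, φ (x + y) * (bumpProfile α ‖y‖ : ℂ) = φ x * c := by
    intro x hx
    have hsub : Metric.ball x R ⊆ U := by
      refine (Metric.ball_subset_ball' ?_).trans hball
      rw [Metric.mem_ball] at hx
      linarith
    have hx' := h.mono hsub
    rw [integral_mul_bumpProfile_eq hx'.contDiffOn_φ.continuousOn hα hα1, hc,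
      integral_mul_bumpProfile_eq (contDiff_planeWave k (n := 0)).continuous.continuousOn hα hα1,
      ← MeasureTheory.integral_const_mul]
    refine MeasureTheory.setIntegral_congr_fun measurableSet_Ioc fun r hr => ?_
    simp only [hx'.angularIntegral_eq hk ⟨hr.1.le, hr.2.trans_lt hα1⟩]
    ring
  -- `K` contains every point the bump sees from the disc of radius `R`, so cutting `φ` off outside
  -- `K` yields a globally integrable function without changing the convolution there.
  set K := Metric.closedBall x₀ (R + α) with hK
  have hKU : K ⊆ U := (Metric.closedBall_subset_ball (by linarith)).trans hball
  have hint : MeasureTheory.Integrable (K.indicator φ) :=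
    ((h.contDiffOn_φ.continuousOn.mono hKU).integrableOn_compact
      (isCompact_closedBall _ _)).integrable_indicator Metric.isClosed_closedBall.measurableSet
  have hsmooth : ContDiff ℝ (⊤ : ℕ∞) (MeasureTheory.convolution (K.indicator φ)
      (fun y : Plane => (bumpProfile α ‖y‖ : ℂ)) (ContinuousLinearMap.mul ℝ ℂ)
      MeasureTheory.volume) :=
    HasCompactSupport.contDiff_convolution_right _
      ((hasCompactSupport_bumpProfile_norm hα).comp_left (g := Complex.ofReal) rfl)
      hint.locallyIntegrable
      (Complex.ofRealCLM.contDiff.comp (contDiff_bumpProfile_norm α))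
  have heq : ∀ x ∈ Metric.ball x₀ R, φ x = (MeasureTheory.convolution (K.indicator φ)
      (fun y : Plane => (bumpProfile α ‖y‖ : ℂ)) (ContinuousLinearMap.mul ℝ ℂ)
      MeasureTheory.volume) x / c := by
    intro x hx
    rw [eq_div_iff hc0, ← hmean x hx, MeasureTheory.convolution_def]
    simp only [ContinuousLinearMap.mul_apply']
    rw [← MeasureTheory.integral_add_left_eq_self
      (fun t => K.indicator φ t * (bumpProfile α ‖x - t‖ : ℂ)) x]
    congr 1
    ext y
    simp only [sub_add_cancel_left, norm_neg]
    by_cases hy : α ≤ ‖y‖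
    · simp [bumpProfile_eq_zero hα hy]
    · rw [Set.indicator_of_mem]
      rw [hK, Metric.mem_closedBall]
      rw [Metric.mem_ball] at hx
      have : dist (x + y) x₀ ≤ dist (x + y) x + dist x x₀ := dist_triangle _ _ _
      have h2 : dist (x + y) x = ‖y‖ := by simp
      linarith [not_le.1 hy]
  refine ContDiffAt.contDiffWithinAt ?_
  refine (hsmooth.contDiffAt.div_const c).congr_of_eventuallyEq ?_
  filter_upwards [Metric.ball_mem_nhds x₀ hRpos] with x hx using heq x hx

/-! ### Ordinary differential equations at infinity: radiation and outgoing asymptotics -/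

/-- The factor `e^{-ikr}` turns `f' - ikf` into a derivative of size `o(r^{-1/2})`, whose integral
is `o(√r)`. -/
theorem tendsto_div_sqrt_of_sommerfeld {k R : ℝ} (hR : 0 < R) {f f' : ℝ → ℂ}
    (hf : ∀ r, R ≤ r → HasDerivAt f (f' r) r)
    (hs : Tendsto (fun r => √r * ‖f' r - Complex.I * k * f r‖) atTop (𝓝 0)) :
    Tendsto (fun r => ‖f r‖ / √r) atTop (𝓝 0) := by
  rw [Metric.tendsto_atTop]
  intro ε hε
  obtain ⟨A₀, hA₀⟩ := Metric.tendsto_atTop.1 hs (ε / 4) (by positivity)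
  set A := max A₀ R with hA
  let g : ℝ → ℂ := fun r => Complex.exp (-(Complex.I * k * r)) * f r
  have hexp : ∀ r : ℝ, ‖Complex.exp (-(Complex.I * k * r))‖ = 1 := by
    intro r; rw [Complex.norm_exp]; simp
  have hgn : ∀ r, ‖g r‖ = ‖f r‖ := fun r => by simp only [g, norm_mul, hexp, one_mul]
  have hg : ∀ r, R ≤ r → HasDerivAt g (Complex.exp (-(Complex.I * k * r)) *
      (f' r - Complex.I * k * f r)) r := by
    intro r hr
    have h1 : HasDerivAt (fun r : ℝ => -(Complex.I * k * (r : ℂ))) (-(Complex.I * k * 1)) r :=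
      (Complex.ofRealCLM.hasDerivAt.const_mul _).neg
    refine (h1.cexp.mul (hf r hr)).congr_deriv ?_
    ring
  have hbound : ∀ b, A ≤ b → ‖f b‖ ≤ ‖f A‖ + ε / 2 * (√b - √A) := by
    intro b hb
    rw [← hgn, ← hgn]
    have hpos : ∀ r, A ≤ r → 0 < r := fun r hr => hR.trans_le ((le_max_right _ _).trans hr)
    refine image_norm_le_of_norm_deriv_right_le_deriv_boundary'
      (f := g) (B := fun r => ‖g A‖ + ε / 2 * (√r - √A))
      (B' := fun r => ε / 2 * (1 / (2 * √r))) (a := A) (b := b)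
      (fun r hr => (hg r ((le_max_right _ _).trans hr.1)).continuousAt.continuousWithinAt)
      (fun r hr => (hg r ((le_max_right _ _).trans hr.1)).hasDerivWithinAt) (by simp)
      (by fun_prop) (fun r hr => ?_) (fun r hr => ?_) ⟨hb, le_rfl⟩
    · exact ((((Real.hasDerivAt_sqrt (hpos r hr.1).ne').sub_const _).const_mul _).const_add
        _).hasDerivWithinAt
    · rw [norm_mul, hexp, one_mul]
      have h1 := hA₀ r ((le_max_left _ _).trans hr.1)
      rw [Real.dist_eq, sub_zero, abs_of_nonneg (by positivity)] at h1
      have h2 : 0 < √r := Real.sqrt_pos.2 (hpos r hr.1)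
      have h3 : ε / 2 * (1 / (2 * √r)) = ε / 4 / √r := by field_simp; norm_num
      rw [h3, le_div_iff₀ h2]
      linarith
  obtain ⟨A₁, hA₁⟩ := Filter.eventually_atTop.1 (Filter.eventually_ge_atTop
    ((‖f A‖ / (ε / 4)) ^ 2 + 1))
  -- Beyond this radius the initial value `‖f A‖` is at most `(ε/4)√r`; with the `(ε/2)√r` from
  -- integration the total is below `ε√r`.
  refine ⟨max A ((‖f A‖ / (ε / 4)) ^ 2 + 1), fun r hr => ?_⟩
  have h1 := hbound r ((le_max_left _ _).trans hr)
  have h2 : (‖f A‖ / (ε / 4)) ^ 2 + 1 ≤ r := (le_max_right _ _).trans hr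
  have h3 : 0 < √r := Real.sqrt_pos.2 (by nlinarith [sq_nonneg (‖f A‖ / (ε / 4))])
  have h4 : ‖f A‖ / (ε / 4) ≤ √r := Real.le_sqrt_of_sq_le (by linarith)
  rw [div_le_iff₀ (by positivity)] at h4
  rw [Real.dist_eq, sub_zero, abs_of_nonneg (by positivity), div_lt_iff₀ h3]
  have : 0 ≤ √A := Real.sqrt_nonneg _
  nlinarith

theorem exists_limit_of_deriv_bound {C R : ℝ} (hR : 0 < R) {g g' : ℝ → ℂ}
    (hg : ∀ r, R ≤ r → HasDerivAt g (g' r) r) (hC : ∀ r, R ≤ r → ‖g' r‖ ≤ C / r ^ 2) :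
    ∃ L, Tendsto g atTop (𝓝 L) ∧ ∀ r, R ≤ r → ‖g r - L‖ ≤ C / r := by
  have hC0 : 0 ≤ C := by
    have := (norm_nonneg _).trans (hC R le_rfl)
    have h2 : 0 < R ^ 2 := by positivity
    by_contra hcon
    have := div_neg_of_neg_of_pos (not_le.1 hcon) h2
    linarith
  have hb : ∀ a b, R ≤ a → a ≤ b → ‖g b - g a‖ ≤ C / a - C / b := by
    intro a b ha hab
    refine image_norm_le_of_norm_deriv_right_le_deriv_boundary'
      (f := fun r => g r - g a) (f' := g') (B := fun r => C / a - C / r)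
      (B' := fun r => C / r ^ 2) (a := a) (b := b)
      (fun r hr => ((hg r (ha.trans hr.1)).sub_const _).continuousAt.continuousWithinAt)
      (fun r hr => ((hg r (ha.trans hr.1)).sub_const _).hasDerivWithinAt) (by simp)
      (fun r hr => ?_) (fun r hr => ?_) (fun r hr => hC r (ha.trans hr.1)) ⟨hab, le_rfl⟩
    · have : r ≠ 0 := (hR.trans_le (ha.trans hr.1)).ne'
      exact ContinuousAt.continuousWithinAt (by fun_prop (disch := assumption))
    · have : r ≠ 0 := (hR.trans_le (ha.trans hr.1)).ne'
      refine HasDerivAt.hasDerivWithinAt ?_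
      refine (((hasDerivAt_inv this).const_mul C).const_sub (C / a)).congr_deriv ?_
      field_simp
  have hcau : CauchySeq g := by
    refine Metric.cauchySeq_iff'.2 fun ε hε => ⟨max R ((C + 1) / ε), fun b hb' => ?_⟩
    have h1 := hb (max R ((C + 1) / ε)) b (le_max_left _ _) hb'
    have h2 : 0 < max R ((C + 1) / ε) := hR.trans_le (le_max_left _ _)
    have h3 : 0 ≤ C / b := div_nonneg hC0 (h2.le.trans hb')
    have h4 : C / max R ((C + 1) / ε) < ε := by
      rw [div_lt_iff₀ h2]
      have := le_max_right R ((C + 1) / ε)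
      rw [div_le_iff₀ hε] at this
      linarith
    rw [dist_eq_norm]
    linarith
  obtain ⟨L, hL⟩ := cauchySeq_tendsto_of_complete hcau
  refine ⟨L, hL, fun r hr => ?_⟩
  have h1 : Tendsto (fun b => ‖g r - g b‖) atTop (𝓝 ‖g r - L‖) := (hL.const_sub _).norm
  refine le_of_tendsto h1 ?_
  filter_upwards [eventually_ge_atTop r] with b hrb
  rw [norm_sub_rev]
  have := hb r b hr hrb
  have : 0 ≤ C / b := div_nonneg hC0 ((hR.le.trans hr).trans hrb)
  linarith

/-- The identity `ik(f' - ikf) = (f'' + f'/r + k²f) - (f'' - ikf') - f'/r` recovers the radiation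
condition for `f` from that for `f'`. The error `c(‖f‖ + 1)/r²` is shaped to cover both Bessel
modes, with error `n²f/r²`, and rays, with error `O(r^{-2})`. -/
theorem sommerfeld_of_sommerfeld_deriv {k R c : ℝ} (hk : 0 < k) (hR : 0 < R) {f f' f'' : ℝ → ℂ}
    (hf' : ∀ r, R ≤ r → HasDerivAt f' (f'' r) r)
    (hH : ∀ r, R ≤ r → ‖f'' r + f' r / r + k ^ 2 * f r‖ ≤ c * (‖f r‖ + 1) / r ^ 2)
    (hs : Tendsto (fun r => √r * ‖f'' r - Complex.I * k * f' r‖) atTop (𝓝 0)) :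
    Tendsto (fun r => √r * ‖f' r - Complex.I * k * f r‖) atTop (𝓝 0) ∧
      Tendsto (fun r => ‖f r‖ / √r) atTop (𝓝 0) := by
  have hg := tendsto_div_sqrt_of_sommerfeld hR hf' hs
  have hinv : Tendsto (fun r : ℝ => r⁻¹) atTop (𝓝 0) := tendsto_inv_atTop_zero
  have hsqinv : Tendsto (fun r : ℝ => (√r)⁻¹) atTop (𝓝 0) :=
    tendsto_inv_atTop_zero.comp Real.tendsto_sqrt_atTop
  have key : ∀ r : ℝ, Complex.I * k * (f' r - Complex.I * k * f r) =
      (f'' r + f' r / r + k ^ 2 * f r) - (f'' r - Complex.I * k * f' r) - f' r / r := by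
    intro r
    linear_combination -(k : ℂ) ^ 2 * f r * Complex.I_sq
  have hnk : ‖Complex.I * (k : ℂ)‖ = k := by simp [abs_of_pos hk]
  -- Needed first, to control the error term: once `|c|/r² ≤ k²/2`, the part of the error
  -- proportional to `‖f‖` is absorbed into `k²‖f‖`.
  have hf0 : Tendsto (fun r => ‖f r‖ / √r) atTop (𝓝 0) := by
    have hlim : Tendsto (fun r => 2 / k ^ 2 * (|c| * (r⁻¹ * r⁻¹) * (√r)⁻¹ +
        (√r * ‖f'' r - Complex.I * k * f' r‖) * r⁻¹ + k * (‖f' r‖ / √r)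
        + (‖f' r‖ / √r) * r⁻¹)) atTop (𝓝 (2 / k ^ 2 * (|c| * (0 * 0) * 0 + 0 * 0 + k * 0 + 0 * 0))) :=
      ((((((hinv.mul hinv).const_mul |c|).mul hsqinv).add (hs.mul hinv)).add
        (hg.const_mul k)).add (hg.mul hinv)).const_mul _
    simp only [mul_zero, add_zero] at hlim
    refine squeeze_zero' (Eventually.of_forall fun r => by positivity) ?_ hlim
    filter_upwards [eventually_ge_atTop R, eventually_ge_atTop (√(2 * |c| / k ^ 2))] with r hr hr2
    have hr0 : 0 < r := hR.trans_le hr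
    have hsr : 0 < √r := Real.sqrt_pos.2 hr0
    have hss : √r * √r = r := Real.mul_self_sqrt hr0.le
    have hc : |c| / r ^ 2 ≤ k ^ 2 / 2 := by
      have := Real.sqrt_le_left hr0.le |>.1 hr2
      rw [div_le_iff₀ (by positivity)] at this ⊢
      linarith
    have h1 : ‖(k : ℂ) ^ 2 * f r‖ ≤ |c| * (‖f r‖ + 1) / r ^ 2 +
        ‖f'' r - Complex.I * k * f' r‖ + k * ‖f' r‖ + ‖f' r‖ / r := by
      have e : (k : ℂ) ^ 2 * f r = (f'' r + f' r / r + k ^ 2 * f r)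
        - (f'' r - Complex.I * k * f' r) - Complex.I * k * f' r - f' r / r := by ring
      have n1 : ‖Complex.I * k * f' r‖ = k * ‖f' r‖ := by rw [norm_mul, hnk]
      have n2 : ‖f' r / r‖ = ‖f' r‖ / r := by
        rw [norm_div, Complex.norm_of_nonneg hr0.le]
      have n3 : c * (‖f r‖ + 1) / r ^ 2 ≤ |c| * (‖f r‖ + 1) / r ^ 2 := by
        gcongr; exact le_abs_self c
      rw [e]
      refine (norm_sub_le _ _).trans ?_
      refine (add_le_add_left (norm_sub_le _ _) _).trans ?_
      refine (add_le_add_left (add_le_add_left (norm_sub_le _ _) _) _).trans ?_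
      rw [n1, n2]
      linarith [hH r hr]
    have h2 : ‖(k : ℂ) ^ 2 * f r‖ = k ^ 2 * ‖f r‖ := by
      rw [norm_mul, norm_pow, Complex.norm_of_nonneg hk.le]
    have h3 : |c| * (‖f r‖ + 1) / r ^ 2 ≤ k ^ 2 / 2 * ‖f r‖ + |c| / r ^ 2 := by
      have : |c| * (‖f r‖ + 1) / r ^ 2 = |c| / r ^ 2 * ‖f r‖ + |c| / r ^ 2 := by ring
      rw [this]
      gcongr
    have h4 : k ^ 2 / 2 * ‖f r‖ ≤ |c| / r ^ 2 + ‖f'' r - Complex.I * k * f' r‖ + k * ‖f' r‖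
        + ‖f' r‖ / r := by linarith
    have h5 : ‖f r‖ ≤ 2 / k ^ 2 * (|c| / r ^ 2 + ‖f'' r - Complex.I * k * f' r‖ + k * ‖f' r‖
        + ‖f' r‖ / r) := by
      rw [div_mul_eq_mul_div, le_div_iff₀ (by positivity)]; linarith
    rw [div_le_iff₀ hsr]
    refine h5.trans (le_of_eq ?_)
    field_simp
    rw [pow_succ, Real.sq_sqrt hr0.le]
    ring
  refine ⟨?_, hf0⟩
  have hlim : Tendsto (fun r => 1 / k * (|c| * (‖f r‖ / √r * r⁻¹ + (√r)⁻¹ * r⁻¹)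
      + √r * ‖f'' r - Complex.I * k * f' r‖ + ‖f' r‖ / √r)) atTop
      (𝓝 (1 / k * (|c| * (0 * 0 + 0 * 0) + 0 + 0))) :=
    (((((hf0.mul hinv).add (hsqinv.mul hinv)).const_mul |c|).add hs).add hg).const_mul _
  simp only [mul_zero, add_zero] at hlim
  refine squeeze_zero' (Eventually.of_forall fun r => by positivity) ?_ hlim
  filter_upwards [eventually_ge_atTop R] with r hr
  have hr0 : 0 < r := hR.trans_le hr
  have hsr : 0 < √r := Real.sqrt_pos.2 hr0
  have hss : √r * √r = r := Real.mul_self_sqrt hr0.le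
  have h1 : k * ‖f' r - Complex.I * k * f r‖ ≤ |c| * (‖f r‖ + 1) / r ^ 2 +
      ‖f'' r - Complex.I * k * f' r‖ + ‖f' r‖ / r := by
    rw [← hnk, ← norm_mul, hnk, key]
    have n2 : ‖f' r / r‖ = ‖f' r‖ / r := by
      rw [norm_div, Complex.norm_of_nonneg hr0.le]
    have n3 : c * (‖f r‖ + 1) / r ^ 2 ≤ |c| * (‖f r‖ + 1) / r ^ 2 := by
      gcongr; exact le_abs_self c
    refine (norm_sub_le _ _).trans ?_
    refine (add_le_add_left (norm_sub_le _ _) _).trans ?_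
    rw [n2]
    linarith [hH r hr]
  have h2 : ‖f' r - Complex.I * k * f r‖ ≤ 1 / k * (|c| * (‖f r‖ + 1) / r ^ 2 +
      ‖f'' r - Complex.I * k * f' r‖ + ‖f' r‖ / r) := by
    rw [one_div, ← div_eq_inv_mul, le_div_iff₀ hk]; linarith
  calc √r * ‖f' r - Complex.I * k * f r‖ ≤ √r * (1 / k * (|c| * (‖f r‖ + 1) / r ^ 2 +
      ‖f'' r - Complex.I * k * f' r‖ + ‖f' r‖ / r)) := by gcongr
    _ = _ := by
      have e1 : r⁻¹ = (√r)⁻¹ * (√r)⁻¹ := by rw [← mul_inv, hss]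
      have e2 : √r ^ 2 = r := Real.sq_sqrt hr0.le
      have e3 : √r ^ 4 = r ^ 2 := by rw [show √r ^ 4 = (√r ^ 2) ^ 2 by ring, e2]
      simp only [div_eq_mul_inv, e1]
      field_simp
      rw [e3, e2]
      ring

/-- Factor `d²/dr² + k²`: both `e^{ikr}(V' - ikV)` and `e^{-ikr}(V' + ikV)` have derivative
`e^{±ikr}(V'' + k²V) = O(r^{-2})`, so they converge with error `C/r`. Radiation forces the first
limit to be zero; the second gives `L`, since the difference of the two brackets is `2ikV`. -/
theorem exists_outgoing_asymptotics {k R C : ℝ} (hk : 0 < k) (hR : 0 < R) {V V' V'' : ℝ → ℂ}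
    (hV : ∀ r, R ≤ r → HasDerivAt V (V' r) r) (hV' : ∀ r, R ≤ r → HasDerivAt V' (V'' r) r)
    (hC : ∀ r, R ≤ r → ‖V'' r + k ^ 2 * V r‖ ≤ C / r ^ 2)
    (hs : Tendsto (fun r => V' r - Complex.I * k * V r) atTop (𝓝 0)) :
    ∃ L : ℂ, ∀ r, R ≤ r → ‖V' r - Complex.I * k * V r‖ ≤ C / r ∧
      ‖V r - Complex.exp (Complex.I * k * r) * L‖ ≤ C / k / r := by
  have hexp : ∀ r : ℝ, ‖Complex.exp (Complex.I * k * r)‖ = 1 := by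
    intro r; rw [Complex.norm_exp]; simp
  have hexp' : ∀ r : ℝ, ‖Complex.exp (-(Complex.I * k * r))‖ = 1 := by
    intro r; rw [Complex.norm_exp]; simp
  have hlin : ∀ r : ℝ, HasDerivAt (fun r : ℝ => Complex.I * k * (r : ℂ)) (Complex.I * k * 1) r :=
    fun r => Complex.ofRealCLM.hasDerivAt.const_mul _
  obtain ⟨L₁, hL₁, hb₁⟩ := exists_limit_of_deriv_bound (C := C) hR
    (g := fun r => Complex.exp (Complex.I * k * r) * (V' r - Complex.I * k * V r))
    (g' := fun r => Complex.exp (Complex.I * k * r) * (V'' r + k ^ 2 * V r))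
    (fun r hr => by
      refine ((hlin r).cexp.mul ((hV' r hr).sub ((hV r hr).const_mul _))).congr_deriv ?_
      simp only [Pi.sub_apply]
      linear_combination -(k : ℂ) ^ 2 * V r * Complex.exp (Complex.I * k * r) * Complex.I_sq)
    (fun r hr => by rw [norm_mul, hexp, one_mul]; exact hC r hr)
  have hL₁0 : L₁ = 0 := by
    refine tendsto_nhds_unique hL₁ (squeeze_zero_norm (fun r => ?_) (tendsto_norm_zero.comp hs))
    rw [norm_mul, hexp, one_mul]
    rfl
  obtain ⟨L₂, hL₂, hb₂⟩ := exists_limit_of_deriv_bound (C := C) hR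
    (g := fun r => Complex.exp (-(Complex.I * k * r)) * (V' r + Complex.I * k * V r))
    (g' := fun r => Complex.exp (-(Complex.I * k * r)) * (V'' r + k ^ 2 * V r))
    (fun r hr => by
      refine ((hlin r).neg.cexp.mul ((hV' r hr).add ((hV r hr).const_mul _))).congr_deriv ?_
      simp only [Pi.neg_apply, Pi.add_apply]
      linear_combination -(k : ℂ) ^ 2 * V r * Complex.exp (-(Complex.I * k * r)) * Complex.I_sq)
    (fun r hr => by rw [norm_mul, hexp', one_mul]; exact hC r hr)
  have hk0 : (k : ℂ) ≠ 0 := by exact_mod_cast hk.ne'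
  refine ⟨L₂ / (2 * (Complex.I * k)), fun r hr => ?_⟩
  have h1 : ‖V' r - Complex.I * k * V r‖ ≤ C / r := by
    have := hb₁ r hr
    rwa [hL₁0, sub_zero, norm_mul, hexp, one_mul] at this
  refine ⟨h1, ?_⟩
  have h2 := hb₂ r hr
  have e : V r - Complex.exp (Complex.I * k * r) * (L₂ / (2 * (Complex.I * k))) =
      (Complex.exp (Complex.I * k * r) * (Complex.exp (-(Complex.I * k * r)) *
        (V' r + Complex.I * k * V r) - L₂) - (V' r - Complex.I * k * V r)) /
        (2 * (Complex.I * k)) := by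
    have hI := Complex.I_ne_zero
    have hee : Complex.exp (Complex.I * k * r) * Complex.exp (-(Complex.I * k * r)) = 1 := by
      rw [← Complex.exp_add, add_neg_cancel, Complex.exp_zero]
    have h3 : Complex.exp (Complex.I * k * r) * (L₂ / (2 * (Complex.I * k))) *
        (2 * (Complex.I * k)) = Complex.exp (Complex.I * k * r) * L₂ := by field_simp
    rw [eq_div_iff (by simp [hk0])]
    linear_combination -h3 - hee * (V' r + Complex.I * k * V r)
  rw [e, norm_div]
  have hn : ‖2 * (Complex.I * (k : ℂ))‖ = 2 * k := by simp [abs_of_pos hk]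
  rw [hn, div_le_iff₀ (by positivity)]
  refine (norm_sub_le _ _).trans ?_
  rw [norm_mul, hexp, one_mul]
  have : C / k / r * (2 * k) = C / r + C / r := by field_simp; ring
  linarith

/-! ### Global bounds for Liouville-transformed Bessel modes -/

theorem hasDerivAt_re {f : ℝ → ℂ} {f' : ℂ} {r : ℝ} (h : HasDerivAt f f' r) :
    HasDerivAt (fun r => (f r).re) f'.re r :=
  Complex.reCLM.hasFDerivAt.comp_hasDerivAt r h

theorem hasDerivAt_im {f : ℝ → ℂ} {f' : ℂ} {r : ℝ} (h : HasDerivAt f f' r) :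
    HasDerivAt (fun r => (f r).im) f'.im r :=
  Complex.imCLM.hasFDerivAt.comp_hasDerivAt r h

theorem norm_sq_eq_re_im (z : ℂ) : ‖z‖ ^ 2 = z.re ^ 2 + z.im ^ 2 := by
  rw [← Complex.normSq_eq_norm_sq, Complex.normSq_apply]; ring

/-- With `q = k² - m/r²` and `m ≤ 0`, the energy `‖V'‖² + q‖V‖²` decreases while `q ≥ k²`, so the
initial data control `V` without any radiation condition. This serves the mode `n = 0`, where `m =
-1/4`. -/
theorem norm_le_of_mode_nonpos {k R m : ℝ} (hk : 0 < k) (hR : 0 < R) (hm : m ≤ 0)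
    {V V' V'' : ℝ → ℂ}
    (hV : ∀ r, R ≤ r → HasDerivAt V (V' r) r) (hV' : ∀ r, R ≤ r → HasDerivAt V' (V'' r) r)
    (hode : ∀ r, R ≤ r → V'' r = -((k ^ 2 - m / r ^ 2 : ℝ) : ℂ) * V r) {r : ℝ} (hr : R ≤ r) :
    ‖V r‖ ≤ √(1 + k ^ 2 - m / R ^ 2) / k * (‖V R‖ + ‖V' R‖) := by
  let E : ℝ → ℝ := fun r => ((V' r).re ^ 2 + (V' r).im ^ 2) +
    (k ^ 2 - m * (r ^ 2)⁻¹) * ((V r).re ^ 2 + (V r).im ^ 2)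
  have hE : ∀ r, R ≤ r → HasDerivAt E (2 * m / r ^ 3 * ((V r).re ^ 2 + (V r).im ^ 2)) r := by
    intro r hr
    have hr0 : r ≠ 0 := (hR.trans_le hr).ne'
    have h1 := hV r hr
    have h2 := hV' r hr
    have h3 : HasDerivAt (fun r : ℝ => k ^ 2 - m * (r ^ 2)⁻¹)
        (-(m * (-(2 * r) / (r ^ 2) ^ 2))) r := by
      have h4 : HasDerivAt (fun r : ℝ => r ^ 2) (2 * r) r := by simpa using hasDerivAt_pow 2 r
      exact ((h4.inv (by positivity)).const_mul m).const_sub _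
    refine (((hasDerivAt_re h2).pow 2 |>.add ((hasDerivAt_im h2).pow 2)).add
      (h3.mul ((hasDerivAt_re h1).pow 2 |>.add ((hasDerivAt_im h1).pow 2)))).congr_deriv ?_
    rw [hode r hr]
    simp only [Complex.mul_re, Complex.mul_im, Complex.neg_re, Complex.neg_im, Complex.ofReal_re,
      Complex.ofReal_im, Pi.add_apply, Pi.pow_apply]
    field_simp
    ring
  have hanti : AntitoneOn E (Set.Ici R) := by
    refine antitoneOn_of_hasDerivWithinAt_nonpos (convex_Ici R)
      (fun r hr => (hE r hr).continuousAt.continuousWithinAt)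
      (fun r hr => (hE r (interior_subset hr)).hasDerivWithinAt) fun r hr => ?_
    have hr0 : 0 < r := hR.trans_le (interior_subset hr)
    exact mul_nonpos_of_nonpos_of_nonneg (div_nonpos_of_nonpos_of_nonneg (by linarith)
      (by positivity)) (by positivity)
  have h1 := hanti (Set.mem_Ici.2 le_rfl) hr hr
  simp only [E, ← norm_sq_eq_re_im] at h1
  have hr0 : 0 < r := hR.trans_le hr
  have hmr : m * (r ^ 2)⁻¹ ≤ 0 := mul_nonpos_of_nonpos_of_nonneg hm (by positivity)
  have hmR : m / R ^ 2 ≤ 0 := div_nonpos_of_nonpos_of_nonneg hm (by positivity)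
  have hmR' : m * (R ^ 2)⁻¹ = m / R ^ 2 := rfl
  rw [hmR'] at h1
  have h2 : (k * ‖V r‖) ^ 2 ≤ (1 + k ^ 2 - m / R ^ 2) * (‖V R‖ + ‖V' R‖) ^ 2 := by
    have a1 : 0 ≤ ‖V' r‖ ^ 2 := by positivity
    have a2 : 0 ≤ (-(m * (r ^ 2)⁻¹)) * ‖V r‖ ^ 2 := by
      apply mul_nonneg <;> [linarith; positivity]
    have a3 : 0 ≤ (k ^ 2 - m / R ^ 2) * (2 * ‖V R‖ * ‖V' R‖ + ‖V' R‖ ^ 2) := by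
      apply mul_nonneg
      · have : 0 ≤ k ^ 2 := by positivity
        linarith
      · positivity
    have a4 : 0 ≤ ‖V R‖ ^ 2 + 2 * ‖V R‖ * ‖V' R‖ := by positivity
    nlinarith
  rw [div_mul_eq_mul_div, le_div_iff₀ hk, mul_comm]
  refine (sq_le_sq₀ (by positivity) (by positivity)).1 ?_
  rw [mul_pow √_, Real.sq_sqrt]
  · exact h2
  · have : 0 ≤ k ^ 2 := by positivity
    linarith

/-- For `m > 0` the energy `E` increases, so it must be bounded from infinity. There `‖V' - ikV‖² =
‖V'‖² + k²‖V‖² - 2kW` tends to zero and `W` is conserved, whence `E ≤ 2kW(R)`. This bounds `V` where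
`q ≥ k²/2` and `V'` where `q ≥ 0`; where `q ≤ 0`, `‖V‖²` is convex. What matters is that the final
constant is polynomial in `m`. -/
theorem norm_le_of_mode_pos {k R m : ℝ} (hk : 0 < k) (hR : 0 < R) (hm : 0 < m)
    {V V' V'' : ℝ → ℂ}
    (hV : ∀ r, R ≤ r → HasDerivAt V (V' r) r) (hV' : ∀ r, R ≤ r → HasDerivAt V' (V'' r) r)
    (hode : ∀ r, R ≤ r → V'' r = -((k ^ 2 - m / r ^ 2 : ℝ) : ℂ) * V r)
    (hs : Tendsto (fun r => V' r - Complex.I * k * V r) atTop (𝓝 0)) {r : ℝ} (hr : R ≤ r) :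
    ‖V r‖ ≤ (1 + √(4 / k) + √(2 * k) / k) * (1 + m) * (‖V R‖ + ‖V' R‖) := by
  let q : ℝ → ℝ := fun r => k ^ 2 - m * (r ^ 2)⁻¹
  have hq : ∀ r, R ≤ r → HasDerivAt q (2 * m / r ^ 3) r := by
    intro r hr
    have hr0 : r ≠ 0 := (hR.trans_le hr).ne'
    have h4 : HasDerivAt (fun r : ℝ => r ^ 2) (2 * r) r := by simpa using hasDerivAt_pow 2 r
    refine (((h4.inv (by positivity)).const_mul m).const_sub (k ^ 2)).congr_deriv ?_
    field_simp
  have hode' : ∀ r, R ≤ r → V'' r = -((q r : ℝ) : ℂ) * V r := fun r hr => hode r hr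
  -- `W` is the imaginary part of `conj V · V'`, constant because `q` is real.
  let W : ℝ → ℝ := fun r => (V r).re * (V' r).im - (V r).im * (V' r).re
  have hW : ∀ r, R ≤ r → HasDerivAt W 0 r := by
    intro r hr
    refine (((hasDerivAt_re (hV r hr)).mul (hasDerivAt_im (hV' r hr))).sub
      ((hasDerivAt_im (hV r hr)).mul (hasDerivAt_re (hV' r hr)))).congr_deriv ?_
    rw [hode' r hr]
    simp only [Complex.mul_re, Complex.mul_im, Complex.neg_re, Complex.neg_im, Complex.ofReal_re,
      Complex.ofReal_im]
    ring
  have hWc : ∀ r, R ≤ r → W r = W R := fun r hr =>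
    constant_of_has_deriv_right_zero
      (fun s hs => (hW s hs.1).continuousAt.continuousWithinAt)
      (fun s hs => (hW s hs.1).hasDerivWithinAt) r ⟨hr, le_rfl⟩
  let E : ℝ → ℝ := fun r => ((V' r).re ^ 2 + (V' r).im ^ 2) +
    q r * ((V r).re ^ 2 + (V r).im ^ 2)
  have hE : ∀ r, R ≤ r → HasDerivAt E (2 * m / r ^ 3 * ((V r).re ^ 2 + (V r).im ^ 2)) r := by
    intro r hr
    have h1 := hV r hr
    have h2 := hV' r hr
    refine (((hasDerivAt_re h2).pow 2 |>.add ((hasDerivAt_im h2).pow 2)).add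
      ((hq r hr).mul ((hasDerivAt_re h1).pow 2 |>.add ((hasDerivAt_im h1).pow 2)))).congr_deriv ?_
    rw [hode' r hr]
    simp only [Complex.mul_re, Complex.mul_im, Complex.neg_re, Complex.neg_im, Complex.ofReal_re,
      Complex.ofReal_im, Pi.add_apply, Pi.pow_apply]
    ring
  have hmono : MonotoneOn E (Set.Ici R) := by
    refine monotoneOn_of_hasDerivWithinAt_nonneg (convex_Ici R)
      (fun r hr => (hE r hr).continuousAt.continuousWithinAt)
      (fun r hr => (hE r (interior_subset hr)).hasDerivWithinAt) fun r hr => ?_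
    have hr0 : 0 < r := hR.trans_le (interior_subset hr)
    positivity
  have hElim : Tendsto (fun r => ‖V' r - Complex.I * k * V r‖ ^ 2 + 2 * k * W R) atTop
      (𝓝 (2 * k * W R)) := by
    simpa using ((tendsto_norm_zero.comp hs).pow 2).add_const (2 * k * W R)
  have hEW : ∀ r, R ≤ r → E r ≤ 2 * k * W R := by
    intro r hr
    refine ge_of_tendsto hElim ?_
    filter_upwards [eventually_ge_atTop r] with s hrs
    have hRs := hr.trans hrs
    refine (hmono hr hRs hrs).trans ?_
    rw [← hWc s hRs, norm_sq_eq_re_im]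
    have : 0 ≤ m * (s ^ 2)⁻¹ * ((V s).re ^ 2 + (V s).im ^ 2) := by positivity
    simp only [E, q, W, Complex.mul_re, Complex.mul_im, Complex.sub_re, Complex.sub_im,
      Complex.ofReal_re, Complex.ofReal_im, Complex.I_re, Complex.I_im]
    linarith
  have hW0 : 0 ≤ 2 * k * W R := ge_of_tendsto hElim (by
    filter_upwards [eventually_ge_atTop R] with s hRs
    rw [← hWc s hRs, norm_sq_eq_re_im]
    simp only [W, Complex.mul_re, Complex.mul_im, Complex.sub_re, Complex.sub_im,
      Complex.ofReal_re, Complex.ofReal_im, Complex.I_re, Complex.I_im]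
    have : 0 ≤ (V' s).re ^ 2 + (V' s).im ^ 2 + k ^ 2 * ((V s).re ^ 2 + (V s).im ^ 2) := by
      positivity
    linarith)
  set S := ‖V R‖ + ‖V' R‖ with hS
  have hS0 : 0 ≤ S := by positivity
  have hWS : W R ≤ S ^ 2 := by
    have h1 : (W R) = (starRingEnd ℂ (V R) * V' R).im := by
      simp only [W, Complex.mul_im, Complex.conj_re, Complex.conj_im]; ring
    have h2 : W R ≤ ‖V R‖ * ‖V' R‖ := by
      rw [h1]
      refine (Complex.im_le_norm _).trans ?_
      rw [norm_mul, RCLike.norm_conj]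
    nlinarith [norm_nonneg (V R), norm_nonneg (V' R)]
  have hEn : ∀ r, E r = ‖V' r‖ ^ 2 + q r * ‖V r‖ ^ 2 := fun r => by
    rw [norm_sq_eq_re_im, norm_sq_eq_re_im]
  -- Beyond `T` one has `q ≥ k²/2`.
  set T := √(2 * m) / k with hT
  have hTpos : 0 < T := by positivity
  have hT2 : T ^ 2 = 2 * m / k ^ 2 := by
    rw [hT, div_pow, Real.sq_sqrt (by positivity)]
  have bound_oscillatory : ∀ r, R ≤ r → T ≤ r → ‖V r‖ ≤ √(4 / k) * S := by
    intro r hr hTr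
    have hr0 : 0 < r := hR.trans_le hr
    have h1 : k ^ 2 / 2 ≤ q r := by
      have h2 : 2 * m / k ^ 2 ≤ r ^ 2 := by rw [← hT2]; gcongr
      have h3 : m * (r ^ 2)⁻¹ ≤ k ^ 2 / 2 := by
        rw [← div_eq_mul_inv, div_le_iff₀ (by positivity)]
        rw [div_le_iff₀ (by positivity)] at h2
        linarith
      simp only [q]; linarith
    have h2 := hEW r hr
    rw [hEn] at h2
    have h3 : k ^ 2 / 2 * ‖V r‖ ^ 2 ≤ 2 * k * S ^ 2 := by
      have : k ^ 2 / 2 * ‖V r‖ ^ 2 ≤ q r * ‖V r‖ ^ 2 := by gcongr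
      have h5 : 2 * k * W R ≤ 2 * k * S ^ 2 := by gcongr
      have : 0 ≤ ‖V' r‖ ^ 2 := by positivity
      linarith
    refine (sq_le_sq₀ (by positivity) (by positivity)).1 ?_
    rw [mul_pow, Real.sq_sqrt (by positivity), div_mul_eq_mul_div, le_div_iff₀ hk]
    have : k / 2 * (‖V r‖ ^ 2 * k) ≤ k / 2 * (4 * S ^ 2) := by linarith
    exact le_of_mul_le_mul_left this (by positivity)
  -- The turning point `q = 0`. Between `T₀` and `T` only `V'` is bounded, and `V` is recovered by
  -- integrating back from `T`.
  set T₀ := √m / k with hT₀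
  have hT₀pos : 0 < T₀ := by positivity
  have hT₀2 : T₀ ^ 2 = m / k ^ 2 := by
    rw [hT₀, div_pow, Real.sq_sqrt hm.le]
  have hTT : T₀ ≤ T := by rw [hT, hT₀]; gcongr; linarith
  have bound_transition : ∀ r, R ≤ r → T₀ ≤ r → ‖V r‖ ≤ √(4 / k) * S + T * (√(2 * k) * S) := by
    intro r hr hTr
    rcases le_total T r with h | h
    · have := bound_oscillatory r hr h
      have : 0 ≤ T * (√(2 * k) * S) := by positivity
      linarith
    · have h1 : ∀ s, R ≤ s → T₀ ≤ s → ‖V' s‖ ≤ √(2 * k) * S := by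
        intro s hs hTs
        have hs0 : 0 < s := hR.trans_le hs
        have h2 : 0 ≤ q s := by
          have h2 : m / k ^ 2 ≤ s ^ 2 := by rw [← hT₀2]; gcongr
          have h3 : m * (s ^ 2)⁻¹ ≤ k ^ 2 := by
            rw [← div_eq_mul_inv, div_le_iff₀ (by positivity)]
            rw [div_le_iff₀ (by positivity)] at h2
            linarith
          simp only [q]; linarith
        have h3 := hEW s hs
        rw [hEn] at h3
        refine (sq_le_sq₀ (by positivity) (by positivity)).1 ?_
        rw [mul_pow, Real.sq_sqrt (by positivity)]
        have : 0 ≤ q s * ‖V s‖ ^ 2 := by positivity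
        have h5 : 2 * k * W R ≤ 2 * k * S ^ 2 := by gcongr
        linarith
      have h2 := norm_image_sub_le_of_norm_deriv_le_segment' (f := V) (f' := V') (a := r) (b := T)
        (C := √(2 * k) * S) (fun s hs => (hV s (hr.trans hs.1)).hasDerivWithinAt)
        (fun s hs => h1 s (hr.trans hs.1) (hTr.trans hs.1)) T ⟨h, le_rfl⟩
      have h3 := bound_oscillatory T (hr.trans h) le_rfl
      have h4 : ‖V r‖ ≤ ‖V T‖ + ‖V T - V r‖ := by
        have := norm_sub_le (V T) (V T - V r)
        simpa using this
      have h5 : √(2 * k) * S * (T - r) ≤ √(2 * k) * S * T := by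
        have : 0 ≤ r := hR.le.trans hr
        gcongr
        linarith
      linarith
  have bound_all : ‖V r‖ ≤ S + (√(4 / k) * S + T * (√(2 * k) * S)) := by
    rcases le_total T₀ r with h | h
    · have := bound_transition r hr h
      linarith
    -- Before the turning point the maximum of `‖V‖²` is attained at `R` or at `T₀`, both already
    -- controlled; this prevents exponential growth in `n`.
    · have hconv : ConvexOn ℝ (Set.Icc R T₀) fun r => (V r).re ^ 2 + (V r).im ^ 2 := by
        refine convexOn_of_hasDerivWithinAt2_nonneg (convex_Icc R T₀)
          (f' := fun r => 2 * ((V r).re * (V' r).re + (V r).im * (V' r).im))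
          (f'' := fun r => 2 * ((V' r).re ^ 2 + (V' r).im ^ 2 -
            q r * ((V r).re ^ 2 + (V r).im ^ 2)))
          (fun s hs => ?_) (fun s hs => ?_) (fun s hs => ?_) (fun s hs => ?_)
        · exact (((hasDerivAt_re (hV s hs.1)).pow 2).add
            ((hasDerivAt_im (hV s hs.1)).pow 2)).continuousAt.continuousWithinAt
        · have hs' := (interior_subset hs : s ∈ Set.Icc R T₀).1
          refine HasDerivAt.hasDerivWithinAt ?_
          refine (((hasDerivAt_re (hV s hs')).pow 2).add
            ((hasDerivAt_im (hV s hs')).pow 2)).congr_deriv ?_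
          ring
        · have hs' := (interior_subset hs : s ∈ Set.Icc R T₀).1
          refine HasDerivAt.hasDerivWithinAt ?_
          refine ((((hasDerivAt_re (hV s hs')).mul (hasDerivAt_re (hV' s hs'))).add
            ((hasDerivAt_im (hV s hs')).mul (hasDerivAt_im (hV' s hs')))).const_mul
              2).congr_deriv ?_
          rw [hode' s hs']
          simp only [Complex.mul_re, Complex.mul_im, Complex.neg_re, Complex.neg_im,
            Complex.ofReal_re, Complex.ofReal_im]
          ring
        · have hs' := (interior_subset hs : s ∈ Set.Icc R T₀)
          have hs0 : 0 < s := hR.trans_le hs'.1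
          have h2 : q s ≤ 0 := by
            have h2 : s ^ 2 ≤ m / k ^ 2 := by rw [← hT₀2]; gcongr; exact hs'.2
            have h3 : k ^ 2 ≤ m * (s ^ 2)⁻¹ := by
              rw [← div_eq_mul_inv, le_div_iff₀ (by positivity)]
              rw [le_div_iff₀ (by positivity)] at h2
              linarith
            simp only [q]; linarith
          have : 0 ≤ (-q s) * ((V s).re ^ 2 + (V s).im ^ 2) :=
            mul_nonneg (by linarith) (by positivity)
          have : 0 ≤ (V' s).re ^ 2 + (V' s).im ^ 2 := by positivity
          linarith
      have hRT : R ≤ T₀ := hr.trans h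
      have h1 := hconv.le_max_of_mem_Icc (x := R) (y := T₀) (z := r) ⟨le_rfl, hRT⟩ ⟨hRT, le_rfl⟩
        ⟨hr, h⟩
      simp only [← norm_sq_eq_re_im] at h1
      have h2 := bound_transition T₀ hRT le_rfl
      have h3 : ‖V R‖ ≤ S := by rw [hS]; linarith [norm_nonneg (V' R)]
      have h4 : 0 ≤ √(4 / k) * S + T * (√(2 * k) * S) := by positivity
      refine (sq_le_sq₀ (by positivity) (by positivity)).1 (h1.trans (max_le ?_ ?_))
      · gcongr; linarith
      · gcongr; linarith
  have hTm : T ≤ (1 + m) / k := by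
    rw [hT]
    gcongr
    refine Real.sqrt_le_iff.2 ⟨by positivity, by nlinarith [sq_nonneg m]⟩
  have h5 : T * (√(2 * k) * S) ≤ (1 + m) / k * (√(2 * k) * S) := by gcongr
  have h6 : 0 ≤ m * (S + √(4 / k) * S) := by positivity
  have h7 : (1 + √(4 / k) + √(2 * k) / k) * (1 + m) * S =
      S + √(4 / k) * S + m * (S + √(4 / k) * S) + (1 + m) / k * (√(2 * k) * S) := by ring
  rw [h7]
  linarith

/-! ### Polar derivatives and angular modes in an exterior domain -/

/-- The exterior of the closed disc of radius `R` about the origin. -/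
def ext (R : ℝ) : Set Plane := {x | R < ‖x‖}

theorem isOpen_ext (R : ℝ) : IsOpen (ext R) := isOpen_lt continuous_const continuous_norm

theorem smul_circ_mem_ext {R r : ℝ} (hR : 0 ≤ R) (hr : R < r) (θ : ℝ) : r • circ θ ∈ ext R := by
  simpa [ext, norm_smul_circ (hR.trans hr.le)] using hr

/-- The rotation through `π / 2`. -/
noncomputable def rot : Plane →L[ℝ] Plane :=
  (EuclideanSpace.proj 0 : Plane →L[ℝ] ℝ).smulRight (EuclideanSpace.single 1 1) -
    (EuclideanSpace.proj 1 : Plane →L[ℝ] ℝ).smulRight (EuclideanSpace.single 0 1)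

theorem rot_smul_circ (r θ : ℝ) : rot (r • circ θ) = r • circPerp θ := by
  ext i; fin_cases i <;> simp [rot, circ, circPerp]

/-- The angular derivative `∂w/∂θ`. -/
noncomputable def angularDeriv (w : Plane → ℂ) (x : Plane) : ℂ := fderiv ℝ w x (rot x)

theorem contDiffOn_fderiv_top {w : Plane → ℂ} {U : Set Plane} (hU : IsOpen U)
    (hw : ContDiffOn ℝ (⊤ : ℕ∞) w U) : ContDiffOn ℝ (⊤ : ℕ∞) (fderiv ℝ w) U :=
  hw.fderiv_of_isOpen hU (by norm_cast)

theorem contDiffOn_pd_top {w : Plane → ℂ} {U : Set Plane} (hU : IsOpen U)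
    (hw : ContDiffOn ℝ (⊤ : ℕ∞) w U) (i : Fin 2) : ContDiffOn ℝ (⊤ : ℕ∞) (pd i w) U :=
  (contDiffOn_fderiv_top hU hw).clm_apply contDiffOn_const

/-- The linear field `rot` makes `∂/∂θ` a derivative of functions on the plane, with no choice of
angle, so it can be iterated. -/
theorem contDiffOn_angularDeriv {w : Plane → ℂ} {R : ℝ}
    (hw : ContDiffOn ℝ (⊤ : ℕ∞) w (ext R)) : ContDiffOn ℝ (⊤ : ℕ∞) (angularDeriv w) (ext R) :=
  (contDiffOn_fderiv_top (isOpen_ext R) hw).clm_apply rot.contDiff.contDiffOn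

theorem contDiffOn_radialDeriv {w : Plane → ℂ} {R : ℝ} (hR : 0 ≤ R)
    (hw : ContDiffOn ℝ (⊤ : ℕ∞) w (ext R)) : ContDiffOn ℝ (⊤ : ℕ∞) (radialDeriv w) (ext R) := by
  have h0 : ∀ x ∈ ext R, x ≠ 0 := by
    rintro x hx rfl
    have : R < ‖(0 : Plane)‖ := hx
    rw [norm_zero] at this
    linarith
  have h1 : ContDiffOn ℝ (⊤ : ℕ∞) (fun x : Plane => ‖x‖⁻¹ • x) (ext R) :=
    ((contDiffOn_id.norm ℝ h0).inv fun x hx => norm_ne_zero_iff.2 (h0 x hx)).smul contDiffOn_id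
  exact (contDiffOn_fderiv_top (isOpen_ext R) hw).clm_apply h1

theorem radialDeriv_smul_circ {F : Type*} [NormedAddCommGroup F] [NormedSpace ℝ F]
    (w : Plane → F) {r : ℝ} (hr : 0 < r) (θ : ℝ) :
    radialDeriv w (r • circ θ) = fderiv ℝ w (r • circ θ) (circ θ) := by
  rw [radialDeriv, norm_smul_circ hr.le, inv_smul_smul₀ hr.ne']

theorem angularDeriv_smul_circ (w : Plane → ℂ) (r θ : ℝ) :
    angularDeriv w (r • circ θ) = r * fderiv ℝ w (r • circ θ) (circPerp θ) := by
  rw [angularDeriv, rot_smul_circ, map_smul, Complex.real_smul]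

theorem hasDerivAt_radial {w : Plane → ℂ} {r θ : ℝ} (hr : 0 < r)
    (hw : DifferentiableAt ℝ w (r • circ θ)) :
    HasDerivAt (fun s : ℝ => w (s • circ θ)) (radialDeriv w (r • circ θ)) r := by
  have h2 : HasDerivAt (fun s : ℝ => s • circ θ) (circ θ) r := by
    simpa using (hasDerivAt_id r).smul_const (circ θ)
  rw [radialDeriv_smul_circ w hr]
  exact hw.hasFDerivAt.comp_hasDerivAt r h2

theorem hasDerivAt_angular {w : Plane → ℂ} {r θ : ℝ}
    (hw : DifferentiableAt ℝ w (r • circ θ)) :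
    HasDerivAt (fun θ : ℝ => w (r • circ θ)) (angularDeriv w (r • circ θ)) θ := by
  have h2 : HasDerivAt (fun θ : ℝ => r • circ θ) (r • circPerp θ) θ :=
    (hasDerivAt_circ θ).const_smul r
  have h3 := hw.hasFDerivAt.comp_hasDerivAt θ h2
  rw [angularDeriv, rot_smul_circ]
  exact h3

theorem differentiableAt_of_contDiffOn {w : Plane → ℂ} {U : Set Plane} (hU : IsOpen U)
    (hw : ContDiffOn ℝ (⊤ : ℕ∞) w U) {x : Plane} (hx : x ∈ U) : DifferentiableAt ℝ w x :=
  (hw.contDiffAt (hU.mem_nhds hx)).differentiableAt (by simp)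

theorem continuous_on_circle {w : Plane → ℂ} {R r : ℝ} (hR : 0 ≤ R)
    (hw : ContDiffOn ℝ (⊤ : ℕ∞) w (ext R)) (hr : R < r) : Continuous fun θ => w (r • circ θ) := by
  have := continuous_circ
  exact hw.continuousOn.comp_continuous (by fun_prop) (smul_circ_mem_ext hR hr)

/-- The Laplacian in polar coordinates. -/
theorem laplacian_polar {w : Plane → ℂ} {R r θ : ℝ} (hR : 0 ≤ R)
    (hw : ContDiffOn ℝ (⊤ : ℕ∞) w (ext R)) (hr : R < r) :
    radialDeriv (radialDeriv w) (r • circ θ) + radialDeriv w (r • circ θ) / r +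
      angularDeriv (angularDeriv w) (r • circ θ) / r ^ 2 =
      pd 0 (pd 0 w) (r • circ θ) + pd 1 (pd 1 w) (r • circ θ) := by
  have hr0 : 0 < r := hR.trans_lt hr
  have hx := smul_circ_mem_ext hR hr θ
  have hd := fun {w} (hw : ContDiffOn ℝ (⊤ : ℕ∞) w (ext R)) =>
    differentiableAt_of_contDiffOn (isOpen_ext R) hw hx
  have hp := fun i => contDiffOn_pd_top (isOpen_ext R) hw i
  have hrr : radialDeriv (radialDeriv w) (r • circ θ) =
      Real.cos θ * radialDeriv (pd 0 w) (r • circ θ) +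
        Real.sin θ * radialDeriv (pd 1 w) (r • circ θ) := by
    refine (hasDerivAt_radial hr0 (hd (contDiffOn_radialDeriv hR hw))).unique ?_
    refine (((hasDerivAt_radial hr0 (hd (hp 0))).const_mul (Real.cos θ : ℂ)).add
      ((hasDerivAt_radial hr0 (hd (hp 1))).const_mul (Real.sin θ : ℂ))).congr_of_eventuallyEq ?_
    filter_upwards [lt_mem_nhds hr0] with s hs
    rw [radialDeriv_smul_circ w hs, fderiv_circ]
    rfl
  -- Unlike along a ray, the coefficients `-sin θ` and `cos θ` vary here; the extra terms are what
  -- `radialDeriv w / r` cancels.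
  have haa : angularDeriv (angularDeriv w) (r • circ θ) =
      r * ((-Real.cos θ : ℝ) * pd 0 w (r • circ θ) +
        (-Real.sin θ : ℝ) * angularDeriv (pd 0 w) (r • circ θ) +
        ((-Real.sin θ : ℝ) * pd 1 w (r • circ θ) +
        (Real.cos θ : ℝ) * angularDeriv (pd 1 w) (r • circ θ))) := by
    refine (hasDerivAt_angular (hd (contDiffOn_angularDeriv hw))).unique ?_
    have h1 : HasDerivAt (fun θ : ℝ => ((-Real.sin θ : ℝ) : ℂ)) ((-Real.cos θ : ℝ) : ℂ) θ :=
      (Real.hasDerivAt_sin θ).neg.ofReal_comp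
    have h2 : HasDerivAt (fun θ : ℝ => ((Real.cos θ : ℝ) : ℂ)) ((-Real.sin θ : ℝ) : ℂ) θ :=
      (Real.hasDerivAt_cos θ).ofReal_comp
    refine (((h1.mul (hasDerivAt_angular (hd (hp 0)))).add
      (h2.mul (hasDerivAt_angular (hd (hp 1))))).const_mul (r : ℂ)).congr_of_eventuallyEq ?_
    refine Eventually.of_forall fun t => ?_
    simp only [angularDeriv_smul_circ, fderiv_circPerp, Pi.add_apply, Pi.mul_apply]
    push_cast
    ring
  have hr0' : (r : ℂ) ≠ 0 := by exact_mod_cast hr0.ne'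
  rw [hrr, haa, radialDeriv_smul_circ w hr0, radialDeriv_smul_circ _ hr0,
    radialDeriv_smul_circ _ hr0, angularDeriv_smul_circ, angularDeriv_smul_circ]
  simp only [fderiv_circ, fderiv_circPerp]
  have := Complex.cos_sq_add_sin_sq (θ : ℂ)
  push_cast
  field_simp
  linear_combination r * (pd 0 (pd 0 w) (r • circ θ) + pd 1 (pd 1 w) (r • circ θ)) * this

/-- The `n`-th angular Fourier mode of `w` on the circle of radius `r`. -/
noncomputable def mode (n : ℤ) (w : Plane → ℂ) (r : ℝ) : ℂ := fcoeff n fun θ => w (r • circ θ)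

theorem hasDerivAt_mode {w : Plane → ℂ} {R r : ℝ} (hR : 0 ≤ R)
    (hw : ContDiffOn ℝ (⊤ : ℕ∞) w (ext R)) (hr : R < r) (n : ℤ) :
    HasDerivAt (mode n w) (mode n (radialDeriv w) r) r := by
  have hexp : Continuous fun θ : ℝ => Complex.exp (-(n * θ * Complex.I)) := by fun_prop
  refine hasDerivAt_intervalIntegral_of_continuousOn
    (f := fun r θ => w (r • circ θ) * Complex.exp (-(n * θ * Complex.I)))
    (f' := fun r θ => radialDeriv w (r • circ θ) * Complex.exp (-(n * θ * Complex.I)))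
    isOpen_Ioi (Set.mem_Ioi.2 hr) _ _
    (fun s hs => (continuous_on_circle hR hw hs).mul hexp) ?_ (fun s hs θ => ?_)
  · have h1 := continuous_circ
    refine ContinuousOn.mul ((contDiffOn_radialDeriv hR hw).continuousOn.comp
      (Continuous.continuousOn (by fun_prop)) ?_) (hexp.comp continuous_snd).continuousOn
    rintro ⟨s, θ⟩ ⟨hs, -⟩
    exact smul_circ_mem_ext hR hs θ
  · exact (hasDerivAt_radial (hR.trans_lt hs) (differentiableAt_of_contDiffOn (isOpen_ext R) hw
      (smul_circ_mem_ext hR hs θ))).mul_const _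

theorem periodic_on_circle (w : Plane → ℂ) (r : ℝ) :
    Function.Periodic (fun θ => w (r • circ θ)) (2 * Real.pi) := fun θ => by
  simp only [circ_periodic θ]

theorem mode_angularDeriv {w : Plane → ℂ} {R r : ℝ} (hR : 0 ≤ R)
    (hw : ContDiffOn ℝ (⊤ : ℕ∞) w (ext R)) (hr : R < r) (n : ℤ) :
    mode n (angularDeriv w) r = Complex.I * n * mode n w r :=
  fcoeff_deriv (periodic_on_circle w r) (continuous_on_circle hR (contDiffOn_angularDeriv hw) hr)
    (fun θ => hasDerivAt_angular (differentiableAt_of_contDiffOn (isOpen_ext R) hw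
      (smul_circ_mem_ext hR hr θ))) n

theorem mode_angularDeriv_angularDeriv {w : Plane → ℂ} {R r : ℝ} (hR : 0 ≤ R)
    (hw : ContDiffOn ℝ (⊤ : ℕ∞) w (ext R)) (hr : R < r) (n : ℤ) :
    mode n (angularDeriv (angularDeriv w)) r = -(n : ℂ) ^ 2 * mode n w r := by
  rw [mode_angularDeriv hR (contDiffOn_angularDeriv hw) hr, mode_angularDeriv hR hw hr]
  linear_combination (n : ℂ) ^ 2 * mode n w r * Complex.I_sq

theorem fcoeff_linear_comb {f g h : ℝ → ℂ} (hf : Continuous f) (hg : Continuous g)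
    (hh : Continuous h) (a b c : ℂ) (n : ℤ) :
    fcoeff n (fun θ => a * f θ + b * g θ + c * h θ) =
      a * fcoeff n f + b * fcoeff n g + c * fcoeff n h := by
  unfold fcoeff
  rw [← intervalIntegral.integral_const_mul, ← intervalIntegral.integral_const_mul,
    ← intervalIntegral.integral_const_mul, ← intervalIntegral.integral_add,
    ← intervalIntegral.integral_add]
  · congr 1
    ext θ
    ring
  all_goals exact Continuous.intervalIntegrable (by fun_prop) _ _

theorem mode_sub_angularDeriv_angularDeriv {w : Plane → ℂ} {R r : ℝ} (hR : 0 ≤ R)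
    (hw : ContDiffOn ℝ (⊤ : ℕ∞) w (ext R)) (hr : R < r) (n : ℤ) :
    mode n (fun x => w x - angularDeriv (angularDeriv w) x) r =
      (1 + (n : ℂ) ^ 2) * mode n w r := by
  have h2 := contDiffOn_angularDeriv (contDiffOn_angularDeriv hw)
  have h3 := mode_angularDeriv_angularDeriv hR hw hr n
  have hc := continuous_on_circle hR h2 hr
  have h4 := fcoeff_linear_comb (continuous_on_circle hR hw hr) hc continuous_zero 1 (-1) 0 n
  unfold mode at h3 ⊢
  rw [h3] at h4
  simp only [one_mul, zero_mul, add_zero, neg_mul, ← sub_eq_add_neg] at h4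
  rw [h4]
  ring

/-- The operator `1 - ∂²/∂θ²` multiplies the `n`-th mode by `1 + n²`, so each application to a
smooth `w` gains one such factor. -/
theorem exists_mode_decay {w : Plane → ℂ} {R r : ℝ} (hR : 0 ≤ R)
    (hw : ContDiffOn ℝ (⊤ : ℕ∞) w (ext R)) (hr : R < r) (j : ℕ) :
    ∃ B, 0 ≤ B ∧ ∀ n : ℤ, (1 + (n : ℝ) ^ 2) ^ j * ‖mode n w r‖ ≤ B := by
  induction j generalizing w with
  | zero =>
    obtain ⟨B, hB⟩ := (isCompact_Icc (a := 0) (b := 2 * Real.pi)).exists_bound_of_continuousOn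
      (continuous_on_circle hR hw hr).continuousOn
    have hB' : ∀ θ, ‖w (r • circ θ)‖ ≤ B := by
      intro θ
      obtain ⟨t, ht, he⟩ := (periodic_on_circle w r).exists_mem_Ico₀ Real.two_pi_pos θ
      refine le_of_eq_of_le (congrArg norm he) ?_
      exact hB t ⟨ht.1, ht.2.le⟩
    have hB0 : 0 ≤ B := (norm_nonneg _).trans (hB' 0)
    refine ⟨2 * Real.pi * B, by positivity, fun n => ?_⟩
    rw [pow_zero, one_mul]
    exact norm_fcoeff_le hB' n
  | succ j ih =>
    have h2 := contDiffOn_angularDeriv (contDiffOn_angularDeriv hw)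
    obtain ⟨B, hB0, hB⟩ := ih (hw.sub h2)
    refine ⟨B, hB0, fun n => ?_⟩
    have h := hB n
    have h4 : ‖(1 + (n : ℂ) ^ 2)‖ = 1 + (n : ℝ) ^ 2 := by
      have : (1 + (n : ℂ) ^ 2) = ((1 + (n : ℝ) ^ 2 : ℝ) : ℂ) := by push_cast; rfl
      rw [this, Complex.norm_of_nonneg (by positivity)]
    have h5 := mode_sub_angularDeriv_angularDeriv hR hw hr n
    rw [pow_succ, mul_assoc, ← h4, ← norm_mul, h4, ← h5]
    exact h

/-- The angular modes of a solution of the Helmholtz equation solve Bessel's equation. -/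
theorem mode_bessel {k R r : ℝ} {v : Plane → ℂ} (hR : 0 ≤ R)
    (hv : ContDiffOn ℝ (⊤ : ℕ∞) v (ext R))
    (hH : ∀ x ∈ ext R, pd 0 (pd 0 v) x + pd 1 (pd 1 v) x = -(k : ℂ) ^ 2 * v x)
    (hr : R < r) (n : ℤ) :
    mode n (radialDeriv (radialDeriv v)) r + mode n (radialDeriv v) r / r + k ^ 2 * mode n v r =
      n ^ 2 * mode n v r / r ^ 2 := by
  have c0 := continuous_on_circle hR hv hr
  have c1 := continuous_on_circle hR (contDiffOn_radialDeriv hR hv) hr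
  have c2 := continuous_on_circle hR (contDiffOn_angularDeriv (contDiffOn_angularDeriv hv)) hr
  have e : (fun θ => radialDeriv (radialDeriv v) (r • circ θ)) = fun θ =>
      -(k : ℂ) ^ 2 * v (r • circ θ) + (-(1 / r : ℂ)) * radialDeriv v (r • circ θ) +
        (-(1 / r ^ 2 : ℂ)) * angularDeriv (angularDeriv v) (r • circ θ) := by
    ext θ
    have h1 := laplacian_polar (θ := θ) hR hv hr
    rw [hH _ (smul_circ_mem_ext hR hr θ)] at h1
    linear_combination h1
  have h3 := mode_angularDeriv_angularDeriv hR hv hr n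
  unfold mode at h3 ⊢
  rw [e, fcoeff_linear_comb c0 c1 c2, h3]
  ring

/-! ### Uniform decay of the modes and the scalar far field -/

/-- `√r f` and its derivative (the Liouville transform of Bessel's equation). -/
theorem hasDerivAt_sqrt_mul {f : ℝ → ℂ} {f' : ℂ} {r : ℝ} (hr : 0 < r) (hf : HasDerivAt f f' r) :
    HasDerivAt (fun s : ℝ => (√s : ℂ) * f s) (√r * f' + f r / (2 * √r)) r := by
  have h1 := (Real.hasDerivAt_sqrt hr.ne').ofReal_comp
  refine (h1.mul hf).congr_deriv ?_
  push_cast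
  ring

/-- For `V = √r f` this is `V'' = √r (f'' + f'/r - f/(4r²))`: the first-order term is absorbed, at
the price of the shift from `n²` to `n² - 1/4`. -/
theorem hasDerivAt_sqrt_mul_deriv {f f' : ℝ → ℂ} {f'' : ℂ} {r : ℝ} (hr : 0 < r)
    (hf : HasDerivAt f (f' r) r) (hf' : HasDerivAt f' f'' r) :
    HasDerivAt (fun s : ℝ => (√s : ℂ) * f' s + f s / (2 * √s))
      (√r * (f'' + f' r / r) - √r * f r / (4 * r ^ 2)) r := by
  have h1 := (Real.hasDerivAt_sqrt hr.ne').ofReal_comp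
  have hs : 0 < √r := Real.sqrt_pos.2 hr
  have hs0 : (√r : ℂ) ≠ 0 := by exact_mod_cast hs.ne'
  have e2 : (r : ℂ) = (√r : ℂ) ^ 2 := by exact_mod_cast (Real.sq_sqrt hr.le).symm
  refine ((hasDerivAt_sqrt_mul hr hf').add (hf.div (h1.const_mul 2)
    (mul_ne_zero two_ne_zero hs0))).congr_deriv ?_
  rw [e2]
  push_cast
  field_simp
  ring

/-- Differentiating `√r` leaves the extra term `f/(2√r)`, which is why `f = o(√r)` is needed besides
the radiation condition. -/
theorem tendsto_sqrt_mul_sommerfeld {k : ℝ} {f f' : ℝ → ℂ}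
    (h1 : Tendsto (fun r => √r * ‖f' r - Complex.I * k * f r‖) atTop (𝓝 0))
    (h2 : Tendsto (fun r => ‖f r‖ / √r) atTop (𝓝 0)) :
    Tendsto (fun r : ℝ => ((√r : ℂ) * f' r + f r / (2 * √r)) - Complex.I * k * (√r * f r))
      atTop (𝓝 0) := by
  have h3 : Tendsto (fun r => √r * ‖f' r - Complex.I * k * f r‖ + ‖f r‖ / √r) atTop (𝓝 0) := by
    simpa using h1.add h2
  refine squeeze_zero_norm (fun r => ?_) h3
  have e : ((√r : ℂ) * f' r + f r / (2 * √r)) - Complex.I * k * (√r * f r) =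
      √r * (f' r - Complex.I * k * f r) + f r / (2 * √r) := by ring
  rw [e]
  refine (norm_add_le _ _).trans ?_
  rw [norm_mul, norm_div, norm_mul, Complex.norm_of_nonneg (Real.sqrt_nonneg r), Complex.norm_ofNat]
  refine add_le_add le_rfl ?_
  rcases eq_or_lt_of_le (Real.sqrt_nonneg r) with h | h
  · rw [← h]; simp
  · gcongr; linarith

theorem exists_bound_of_sommerfeld {k : ℝ} {v : Plane → ℂ}
    (hS : Tendsto (fun x => √‖x‖ * ‖radialDeriv (radialDeriv v) x -
      Complex.I * k * radialDeriv v x‖) (Bornology.cobounded Plane) (𝓝 0)) {ε : ℝ} (hε : 0 < ε) :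
    ∃ A, ∀ r, A ≤ r → ∀ θ, √r * ‖radialDeriv (radialDeriv v) (r • circ θ) -
      Complex.I * k * radialDeriv v (r • circ θ)‖ < ε := by
  have h := hS.eventually (Metric.ball_mem_nhds 0 hε)
  obtain ⟨A, -, hA⟩ := (Filter.hasBasis_cobounded_norm (E := Plane)).eventually_iff.1 h
  refine ⟨max A 0, fun r hr θ => ?_⟩
  have hr0 : 0 ≤ r := (le_max_right _ _).trans hr
  have h1 := hA (x := r • circ θ) (by
    simpa [norm_smul_circ hr0] using (le_max_left _ _).trans hr)
  rw [norm_smul_circ hr0, Real.dist_eq, sub_zero,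
    abs_of_nonneg (by positivity)] at h1
  exact h1

/-- Uniformity of the radiation condition in the direction lets it pass under the angular integral.
-/
theorem tendsto_mode_sommerfeld {k R : ℝ} {v : Plane → ℂ} (hR : 0 ≤ R)
    (hv : ContDiffOn ℝ (⊤ : ℕ∞) v (ext R))
    (hS : Tendsto (fun x => √‖x‖ * ‖radialDeriv (radialDeriv v) x -
      Complex.I * k * radialDeriv v x‖) (Bornology.cobounded Plane) (𝓝 0)) (n : ℤ) :
    Tendsto (fun r => √r * ‖mode n (radialDeriv (radialDeriv v)) r -
      Complex.I * k * mode n (radialDeriv v) r‖) atTop (𝓝 0) := by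
  rw [Metric.tendsto_atTop]
  intro ε hε
  obtain ⟨A, hA⟩ := exists_bound_of_sommerfeld hS (ε := ε / (4 * Real.pi))
    (by have := Real.pi_pos; positivity)
  refine ⟨max A (R + 1), fun r hr => ?_⟩
  have hrR : R < r := by linarith [(le_max_right A (R + 1)).trans hr]
  have hr0 : 0 < r := hR.trans_lt hrR
  have c1 := continuous_on_circle hR (contDiffOn_radialDeriv hR hv) hrR
  have c2 := continuous_on_circle hR (contDiffOn_radialDeriv hR (contDiffOn_radialDeriv hR hv)) hrR
  have h1 := fcoeff_linear_comb c2 c1 continuous_zero (√r : ℂ) (-(√r * (Complex.I * k))) 0 n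
  simp only [zero_mul, add_zero] at h1
  have h2 : ‖fcoeff n fun θ => (√r : ℂ) * radialDeriv (radialDeriv v) (r • circ θ) +
      -(√r * (Complex.I * k)) * radialDeriv v (r • circ θ)‖ ≤
      2 * Real.pi * (ε / (4 * Real.pi)) := by
    refine norm_fcoeff_le (fun θ => ?_) n
    refine le_trans (le_of_eq ?_) (hA r ((le_max_left _ _).trans hr) θ).le
    rw [← Complex.norm_of_nonneg (Real.sqrt_nonneg r), ← norm_mul]
    rw [Complex.norm_of_nonneg (Real.sqrt_nonneg r)]
    congr 1
    ring
  rw [Real.dist_eq, sub_zero, abs_of_nonneg (by positivity)]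
  have h3 : √r * ‖mode n (radialDeriv (radialDeriv v)) r -
      Complex.I * k * mode n (radialDeriv v) r‖ = ‖fcoeff n fun θ =>
      (√r : ℂ) * radialDeriv (radialDeriv v) (r • circ θ) +
      -(√r * (Complex.I * k)) * radialDeriv v (r • circ θ)‖ := by
    rw [h1]
    conv_lhs => rw [← Complex.norm_of_nonneg (Real.sqrt_nonneg r)]
    rw [← norm_mul]
    simp only [mode]
    congr 1
    ring
  rw [h3]
  refine h2.trans_lt ?_
  have := Real.pi_pos
  field_simp
  linarith

/-- Uniform bound for all angular modes of a radiating solution. -/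
theorem exists_mode_bound {k R₀ R : ℝ} {v : Plane → ℂ} (hk : 0 < k) (hR₀ : 0 ≤ R₀) (hR : R₀ < R)
    (hv : ContDiffOn ℝ (⊤ : ℕ∞) v (ext R₀))
    (hH : ∀ x ∈ ext R₀, pd 0 (pd 0 v) x + pd 1 (pd 1 v) x = -(k : ℂ) ^ 2 * v x)
    (hS : Tendsto (fun x => √‖x‖ * ‖radialDeriv (radialDeriv v) x -
      Complex.I * k * radialDeriv v x‖) (Bornology.cobounded Plane) (𝓝 0)) :
    ∃ B, 0 ≤ B ∧ ∀ n : ℤ, ∀ r, R ≤ r → √r * ‖mode n v r‖ ≤ B / (1 + (n : ℝ) ^ 2) ^ 2 := by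
  have hRpos : 0 < R := hR₀.trans_lt hR
  have hv' := contDiffOn_radialDeriv hR₀ hv
  -- Three powers of `1 + n²` at radius `R`: one pays for the loss in the mode estimate, and two
  -- survive in the conclusion.
  obtain ⟨B₀, hB₀, hb₀⟩ := exists_mode_decay hR₀ hv hR 3
  obtain ⟨B₁, hB₁, hb₁⟩ := exists_mode_decay hR₀ hv' hR 3
  set C₁ := 1 + √(4 / k) + √(2 * k) / k
  set C₂ := √(1 + k ^ 2 - (-(1 / 4)) / R ^ 2) / k
  have hC₁ : 0 ≤ C₁ := by positivity
  have hC₂ : 0 ≤ C₂ := by positivity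
  set c := √R + 1 / (2 * √R) with hc
  have hsR : 0 < √R := Real.sqrt_pos.2 hRpos
  refine ⟨(C₁ + C₂) * (c * B₀ + √R * B₁), by positivity, fun n r hr => ?_⟩
  have hpos : ∀ s, R ≤ s → 0 < s := fun s hs => hRpos.trans_le hs
  have hlt : ∀ s, R ≤ s → R₀ < s := fun s hs => hR.trans_le hs
  have hf : ∀ s, R ≤ s → HasDerivAt (mode n v) (mode n (radialDeriv v) s) s := fun s hs =>
    hasDerivAt_mode hR₀ hv (hlt s hs) n
  have hf' : ∀ s, R ≤ s → HasDerivAt (mode n (radialDeriv v))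
      (mode n (radialDeriv (radialDeriv v)) s) s := fun s hs =>
    hasDerivAt_mode hR₀ hv' (hlt s hs) n
  have hode := fun s (hs : R ≤ s) => mode_bessel hR₀ hv hH (hlt s hs) n
  obtain ⟨hs1, hs2⟩ := sommerfeld_of_sommerfeld_deriv (c := (n : ℝ) ^ 2) hk hRpos hf'
    (fun s hs => by
      rw [hode s hs]
      have e : ‖(n : ℂ) ^ 2 * mode n v s / s ^ 2‖ = (n : ℝ) ^ 2 * ‖mode n v s‖ / s ^ 2 := by
        rw [norm_div, norm_mul, norm_pow, norm_pow, Complex.norm_of_nonneg (hpos s hs).le,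
          Complex.norm_intCast, sq_abs]
      rw [e]
      gcongr
      linarith) (tendsto_mode_sommerfeld hR₀ hv hS n)
  have hV : ∀ s, R ≤ s → HasDerivAt (fun s : ℝ => (√s : ℂ) * mode n v s) _ s := fun s hs =>
    hasDerivAt_sqrt_mul (hpos s hs) (hf s hs)
  have hV' : ∀ s, R ≤ s → HasDerivAt (fun s : ℝ => (√s : ℂ) * mode n (radialDeriv v) s +
      mode n v s / (2 * √s)) _ s := fun s hs =>
    hasDerivAt_sqrt_mul_deriv (hpos s hs) (hf s hs) (hf' s hs)
  have hVV : ∀ s, R ≤ s → (√s : ℂ) * (mode n (radialDeriv (radialDeriv v)) s +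
      mode n (radialDeriv v) s / s) - √s * mode n v s / (4 * s ^ 2) =
      -((k ^ 2 - ((n : ℝ) ^ 2 - 1 / 4) / s ^ 2 : ℝ) : ℂ) * (√s * mode n v s) := by
    intro s hs
    have h1 := hode s hs
    push_cast
    have hs0 : (s : ℂ) ≠ 0 := by exact_mod_cast (hpos s hs).ne'
    linear_combination (√s : ℂ) * h1
  have hsom := tendsto_sqrt_mul_sommerfeld hs1 hs2
  have hN : 0 < 1 + (n : ℝ) ^ 2 := by positivity
  have hbound : ‖(√r : ℂ) * mode n v r‖ ≤ (C₁ + C₂) * (1 + (n : ℝ) ^ 2) *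
      (‖(√R : ℂ) * mode n v R‖ + ‖(√R : ℂ) * mode n (radialDeriv v) R + mode n v R / (2 * √R)‖) := by
    set S := ‖(√R : ℂ) * mode n v R‖ +
      ‖(√R : ℂ) * mode n (radialDeriv v) R + mode n v R / (2 * √R)‖ with hSdef
    have hS0 : 0 ≤ S := by positivity
    -- The coefficient `m = n² - 1/4` is negative exactly for `n = 0`.
    rcases eq_or_ne n 0 with h0 | h0
    · have h1 : ‖(√r : ℂ) * mode n v r‖ ≤ C₂ * S :=
        norm_le_of_mode_nonpos (m := -(1 / 4)) hk hRpos (by norm_num) hV hV'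
          (fun s hs => by rw [hVV s hs, h0]; push_cast; ring) hr
      have h2 : 0 ≤ C₁ * S := by positivity
      have h3 : (1 + (n : ℝ) ^ 2) = 1 := by simp [h0]
      rw [h3, mul_one, add_mul]
      linarith
    · have hn1 : (1 : ℝ) ≤ (n : ℝ) ^ 2 := by
        have : 0 < n ^ 2 := by positivity
        exact_mod_cast this
      have h1 : ‖(√r : ℂ) * mode n v r‖ ≤ C₁ * (1 + ((n : ℝ) ^ 2 - 1 / 4)) * S :=
        norm_le_of_mode_pos hk hRpos (by linarith) hV hV' hVV hsom hr
      refine h1.trans ?_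
      gcongr <;> linarith
  have hSn : ‖(√R : ℂ) * mode n v R‖ +
      ‖(√R : ℂ) * mode n (radialDeriv v) R + mode n v R / (2 * √R)‖ ≤
      c * ‖mode n v R‖ + √R * ‖mode n (radialDeriv v) R‖ := by
    have h1 := norm_add_le ((√R : ℂ) * mode n (radialDeriv v) R) (mode n v R / (2 * √R))
    rw [norm_mul, norm_div, norm_mul, Complex.norm_of_nonneg hsR.le, Complex.norm_ofNat] at h1
    rw [norm_mul (√R : ℂ), Complex.norm_of_nonneg hsR.le]
    have e : c * ‖mode n v R‖ = √R * ‖mode n v R‖ + ‖mode n v R‖ / (2 * √R) := by rw [hc]; ring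
    linarith
  rw [norm_mul, Complex.norm_of_nonneg (Real.sqrt_nonneg r)] at hbound
  rw [le_div_iff₀ (by positivity)]
  calc √r * ‖mode n v r‖ * (1 + (n : ℝ) ^ 2) ^ 2
      ≤ (C₁ + C₂) * (1 + (n : ℝ) ^ 2) * (c * ‖mode n v R‖ + √R * ‖mode n (radialDeriv v) R‖) *
        (1 + (n : ℝ) ^ 2) ^ 2 := by
        refine mul_le_mul_of_nonneg_right (hbound.trans ?_) (by positivity)
        gcongr
    _ = (C₁ + C₂) * (c * ((1 + (n : ℝ) ^ 2) ^ 3 * ‖mode n v R‖) +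
        √R * ((1 + (n : ℝ) ^ 2) ^ 3 * ‖mode n (radialDeriv v) R‖)) := by ring
    _ ≤ (C₁ + C₂) * (c * B₀ + √R * B₁) := by
        gcongr
        · exact hb₀ n
        · exact hb₁ n

theorem norm_le_of_mode_le {w : Plane → ℂ} {R r K : ℝ} (hR : 0 ≤ R)
    (hw : ContDiffOn ℝ (⊤ : ℕ∞) w (ext R)) (hr : R < r)
    (hK : ∀ n : ℤ, √r * ‖mode n w r‖ ≤ K * (1 / (1 + (n : ℝ) ^ 2))) (θ : ℝ) :
    √r * ‖w (r • circ θ)‖ ≤ K * ∑' n : ℤ, 1 / (1 + (n : ℝ) ^ 2) := by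
  have hsr : 0 < √r := Real.sqrt_pos.2 (hR.trans_lt hr)
  have h := norm_le_tsum_of_fcoeff_le (continuous_on_circle hR hw hr) (periodic_on_circle w r)
    (summable_one_div_one_add_int_sq.mul_left (K / √r)) (fun n => by
      have h1 := hK n
      rw [div_mul_eq_mul_div, le_div_iff₀ hsr, mul_comm]
      exact h1) θ
  rw [tsum_mul_left, div_mul_eq_mul_div, le_div_iff₀ hsr, mul_comm] at h
  exact h

/-- Of the two powers of `1 + n²`, one absorbs up to two angular derivatives and the other makes the
series of modes summable. -/
theorem exists_angular_bounds {k R₀ R : ℝ} {v : Plane → ℂ} (hk : 0 < k) (hR₀ : 0 ≤ R₀)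
    (hR : R₀ < R) (hv : ContDiffOn ℝ (⊤ : ℕ∞) v (ext R₀))
    (hH : ∀ x ∈ ext R₀, pd 0 (pd 0 v) x + pd 1 (pd 1 v) x = -(k : ℂ) ^ 2 * v x)
    (hS : Tendsto (fun x => √‖x‖ * ‖radialDeriv (radialDeriv v) x -
      Complex.I * k * radialDeriv v x‖) (Bornology.cobounded Plane) (𝓝 0)) :
    ∃ K, 0 ≤ K ∧ ∀ r, R ≤ r → ∀ θ, √r * ‖v (r • circ θ)‖ ≤ K ∧
      √r * ‖angularDeriv v (r • circ θ)‖ ≤ K ∧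
      √r * ‖angularDeriv (angularDeriv v) (r • circ θ)‖ ≤ K := by
  obtain ⟨B, hB0, hB⟩ := exists_mode_bound hk hR₀ hR hv hH hS
  refine ⟨B * ∑' n : ℤ, 1 / (1 + (n : ℝ) ^ 2),
    mul_nonneg hB0 (tsum_nonneg fun n => by positivity), fun r hr θ => ?_⟩
  have hr' : R₀ < r := hR.trans_le hr
  have hv1 := contDiffOn_angularDeriv hv
  have hv2 := contDiffOn_angularDeriv hv1
  have key : ∀ n : ℤ, ∀ t : ℝ, t ≤ 1 + (n : ℝ) ^ 2 →
      √r * (t * ‖mode n v r‖) ≤ B * (1 / (1 + (n : ℝ) ^ 2)) := by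
    intro n t ht
    have hN : 0 < 1 + (n : ℝ) ^ 2 := by positivity
    calc √r * (t * ‖mode n v r‖) ≤ √r * ((1 + (n : ℝ) ^ 2) * ‖mode n v r‖) := by gcongr
      _ = (1 + (n : ℝ) ^ 2) * (√r * ‖mode n v r‖) := by ring
      _ ≤ (1 + (n : ℝ) ^ 2) * (B / (1 + (n : ℝ) ^ 2) ^ 2) := by gcongr; exact hB n r hr
      _ = B * (1 / (1 + (n : ℝ) ^ 2)) := by field_simp
  refine ⟨norm_le_of_mode_le hR₀ hv hr' (fun n => ?_) θ,
    norm_le_of_mode_le hR₀ hv1 hr' (fun n => ?_) θ, norm_le_of_mode_le hR₀ hv2 hr' (fun n => ?_) θ⟩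
  · have := key n 1 (by nlinarith [sq_nonneg (n : ℝ)])
    rwa [one_mul] at this
  · rw [mode_angularDeriv hR₀ hv hr', norm_mul, norm_mul, Complex.norm_I, one_mul,
      Complex.norm_intCast]
    refine key n _ ?_
    nlinarith [sq_abs (n : ℝ), sq_nonneg (|(n : ℝ)| - 1)]
  · rw [mode_angularDeriv_angularDeriv hR₀ hv hr', norm_mul, norm_neg, norm_pow,
      Complex.norm_intCast, sq_abs]
    exact key n _ (by linarith)

/-- Far field asymptotics of a solution of the Helmholtz equation whose radial derivative
is radiating. -/
theorem exists_far_field {k R₀ R : ℝ} {v : Plane → ℂ} (hk : 0 < k) (hR₀ : 0 ≤ R₀)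
    (hR : R₀ < R) (hv : ContDiffOn ℝ (⊤ : ℕ∞) v (ext R₀))
    (hH : ∀ x ∈ ext R₀, pd 0 (pd 0 v) x + pd 1 (pd 1 v) x = -(k : ℂ) ^ 2 * v x)
    (hS : Tendsto (fun x => √‖x‖ * ‖radialDeriv (radialDeriv v) x -
      Complex.I * k * radialDeriv v x‖) (Bornology.cobounded Plane) (𝓝 0)) :
    ∃ (C : ℝ) (L : ℝ → ℂ), 0 ≤ C ∧ ∀ θ r, R ≤ r →
      ‖v (r • circ θ) - outgoing k r * L θ‖ ≤ C / (r * √r) ∧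
      ‖radialDeriv v (r • circ θ) - Complex.I * k * v (r • circ θ)‖ ≤ C / (r * √r) ∧
      ‖angularDeriv v (r • circ θ)‖ ≤ C / √r := by
  obtain ⟨K, hK0, hK⟩ := exists_angular_bounds hk hR₀ hR hv hH hS
  have hRpos : 0 < R := hR₀.trans_lt hR
  have hpos : ∀ s, R ≤ s → 0 < s := fun s hs => hRpos.trans_le hs
  have hlt : ∀ s, R ≤ s → R₀ < s := fun s hs => hR.trans_le hs
  have hsR : 0 < √R := Real.sqrt_pos.2 hRpos
  have hL : ∀ θ : ℝ, ∃ L : ℂ, ∀ r, R ≤ r →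
      ‖v (r • circ θ) - outgoing k r * L‖ ≤ (2 * K / k) / (r * √r) ∧
      ‖radialDeriv v (r • circ θ) - Complex.I * k * v (r • circ θ)‖ ≤ 3 * K / (r * √r) := by
    intro θ
    set f : ℝ → ℂ := fun r => v (r • circ θ) with hfdef
    set f' : ℝ → ℂ := fun r => radialDeriv v (r • circ θ) with hfdef'
    set f'' : ℝ → ℂ := fun r => radialDeriv (radialDeriv v) (r • circ θ) with hfdef''
    have hf : ∀ s, R ≤ s → HasDerivAt f (f' s) s := fun s hs => hasDerivAt_radial (hpos s hs)
      (differentiableAt_of_contDiffOn (isOpen_ext _) hv (smul_circ_mem_ext hR₀ (hlt s hs) θ))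
    have hf' : ∀ s, R ≤ s → HasDerivAt f' (f'' s) s := fun s hs => hasDerivAt_radial (hpos s hs)
      (differentiableAt_of_contDiffOn (isOpen_ext _) (contDiffOn_radialDeriv hR₀ hv)
        (smul_circ_mem_ext hR₀ (hlt s hs) θ))
    -- On a fixed ray the angular part of the Laplacian is treated as a known forcing of size
    -- `O(s^{-5/2})`.
    have hode : ∀ s, R ≤ s → f'' s + f' s / s + k ^ 2 * f s =
        -(angularDeriv (angularDeriv v) (s • circ θ) / s ^ 2) := by
      intro s hs
      have h1 := laplacian_polar (θ := θ) hR₀ hv (hlt s hs)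
      rw [hH _ (smul_circ_mem_ext hR₀ (hlt s hs) θ)] at h1
      simp only [f, f', f'']
      linear_combination h1
    have hHn : ∀ s, R ≤ s → √s * ‖f'' s + f' s / s + k ^ 2 * f s‖ ≤ K / s ^ 2 := by
      intro s hs
      rw [hode s hs, norm_neg, norm_div, norm_pow, Complex.norm_of_nonneg (hpos s hs).le,
        ← mul_div_assoc]
      gcongr
      exact (hK s hs θ).2.2
    have hsom : Tendsto (fun r => √r * ‖f'' r - Complex.I * k * f' r‖) atTop (𝓝 0) := by
      rw [Metric.tendsto_atTop]
      intro ε hε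
      obtain ⟨A, hA⟩ := exists_bound_of_sommerfeld hS hε
      refine ⟨A, fun r hr => ?_⟩
      rw [Real.dist_eq, sub_zero, abs_of_nonneg (by positivity)]
      exact hA r hr θ
    obtain ⟨hs1, hs2⟩ := sommerfeld_of_sommerfeld_deriv (c := K / √R) hk hRpos hf'
      (fun s hs => by
        have h1 := hHn s hs
        have hs0 := hpos s hs
        have hss : √R ≤ √s := Real.sqrt_le_sqrt hs
        have h2 : √R * ‖f'' s + f' s / s + k ^ 2 * f s‖ ≤ K / s ^ 2 :=
          le_trans (by gcongr) h1
        have h3 : ‖f'' s + f' s / s + k ^ 2 * f s‖ ≤ K / s ^ 2 / √R := by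
          rw [le_div_iff₀ hsR]; linarith
        refine h3.trans ?_
        have : K / s ^ 2 / √R = K / √R * (0 + 1) / s ^ 2 := by ring
        rw [this]
        gcongr
        exact norm_nonneg _) hsom
    -- One `K` bounds the angular forcing; the other generously bounds the Liouville term `√s
    -- f/(4s²)`.
    obtain ⟨L, hL⟩ := exists_outgoing_asymptotics (C := 2 * K) hk hRpos
      (fun s hs => hasDerivAt_sqrt_mul (hpos s hs) (hf s hs))
      (fun s hs => hasDerivAt_sqrt_mul_deriv (hpos s hs) (hf s hs) (hf' s hs))
      (fun s hs => by
        have hs0 := hpos s hs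
        have e : (√s : ℂ) * (f'' s + f' s / s) - √s * f s / (4 * s ^ 2) + k ^ 2 * (√s * f s) =
          √s * (f'' s + f' s / s + k ^ 2 * f s) - √s * f s / (4 * s ^ 2) := by ring
        rw [e]
        refine (norm_sub_le _ _).trans ?_
        rw [norm_mul, norm_div, norm_mul, norm_mul, norm_pow, Complex.norm_of_nonneg hs0.le,
          Complex.norm_of_nonneg (Real.sqrt_nonneg s), Complex.norm_ofNat]
        have h2 : √s * ‖f s‖ / (4 * s ^ 2) ≤ K / (1 * s ^ 2) := by
          gcongr
          · exact (hK s hs θ).1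
          · norm_num
        have h3 : 2 * K / s ^ 2 = K / s ^ 2 + K / (1 * s ^ 2) := by ring
        rw [h3]
        exact add_le_add (hHn s hs) h2)
      (tendsto_sqrt_mul_sommerfeld hs1 hs2)
    refine ⟨L, fun r hr => ?_⟩
    have hr0 := hpos r hr
    have hsr : 0 < √r := Real.sqrt_pos.2 hr0
    have hsr0 : (√r : ℂ) ≠ 0 := by exact_mod_cast hsr.ne'
    obtain ⟨h1, h2⟩ := hL r hr
    constructor
    · have e : f r - outgoing k r * L = ((√r : ℂ) * f r - Complex.exp (Complex.I * k * r) * L) / √r := by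
        rw [outgoing]; field_simp
      rw [e, norm_div, Complex.norm_of_nonneg hsr.le, ← div_div]
      gcongr
    · have e : f' r - Complex.I * k * f r = (((√r : ℂ) * f' r + f r / (2 * √r) -
          Complex.I * k * (√r * f r)) - f r / (2 * √r)) / √r := by
        field_simp; ring
      have h3 : ‖f r / (2 * (√r : ℂ))‖ ≤ K / r := by
        rw [norm_div, norm_mul, Complex.norm_of_nonneg hsr.le, Complex.norm_ofNat,
          div_le_div_iff₀ (by positivity) hr0]
        have h4 := (hK r hr θ).1
        have h5 : ‖f r‖ * r = √r * (√r * ‖f r‖) := by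
          rw [← mul_assoc, Real.mul_self_sqrt hr0.le]; ring
        rw [h5]
        have : √r * (√r * ‖f r‖) ≤ √r * K := by gcongr
        have : 0 ≤ √r * K := by positivity
        linarith
      rw [e, norm_div, Complex.norm_of_nonneg hsr.le, ← div_div (3 * K)]
      refine div_le_div_of_nonneg_right ?_ hsr.le
      refine (norm_sub_le _ _).trans ?_
      have : 3 * K / r = 2 * K / r + K / r := by ring
      rw [this]
      exact add_le_add h1 h3
  choose L hL using hL
  refine ⟨2 * K / k + 3 * K, L, by positivity, fun θ r hr => ?_⟩
  have hr0 := hpos r hr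
  have hsr : 0 < √r := Real.sqrt_pos.2 hr0
  have hKk : 0 ≤ 2 * K / k := by positivity
  refine ⟨(hL θ r hr).1.trans ?_, (hL θ r hr).2.trans ?_, ?_⟩
  · gcongr; linarith
  · gcongr; linarith
  · rw [le_div_iff₀ hsr, mul_comm]
    linarith [(hK r hr θ).2.1]

/-! ### From the Navier equation to the two potentials -/

theorem pd_pd_eq {f : Plane → ℂ} {x : Plane} (hf : ContDiffAt ℝ 2 f x) (i j : Fin 2) :
    pd i (pd j f) x = fderiv ℝ (fderiv ℝ f) x (EuclideanSpace.single i 1)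
      (EuclideanSpace.single j 1) := by
  have h1 : DifferentiableAt ℝ (fderiv ℝ f) x :=
    (hf.fderiv_right (m := 1) (by norm_num)).differentiableAt one_ne_zero
  have h2 : HasFDerivAt (fun y => fderiv ℝ f y (EuclideanSpace.single j 1)) _ x :=
    h1.hasFDerivAt.clm_apply (hasFDerivAt_const _ _)
  unfold pd
  rw [h2.fderiv]
  simp

theorem pd_comm {f : Plane → ℂ} {x : Plane} (hf : ContDiffAt ℝ 2 f x) (i j : Fin 2) :
    pd i (pd j f) x = pd j (pd i f) x := by
  rw [pd_pd_eq hf, pd_pd_eq hf]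
  exact hf.isSymmSndFDerivAt (by simp) _ _

theorem laplacian_eq_pd {f : Plane → ℂ} {x : Plane} (hf : ContDiffAt ℝ 2 f x) :
    Laplacian.laplacian f x = pd 0 (pd 0 f) x + pd 1 (pd 1 f) x := by
  rw [InnerProductSpace.laplacian_eq_iteratedFDeriv_orthonormalBasis f
    (EuclideanSpace.basisFun (Fin 2) ℝ)]
  simp [Fin.sum_univ_two, iteratedFDeriv_two_apply, pd_pd_eq hf]

theorem laplacian_apply {u : Plane → CVec} {x : Plane} (hu : ContDiffAt ℝ 2 u x) (i : Fin 2) :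
    Laplacian.laplacian u x i = Laplacian.laplacian (fun y => u y i) x :=
  (hu.laplacian_CLM_comp_left (l := (PiLp.proj 2 (𝕜 := ℝ) (fun _ : Fin 2 => ℂ) i))).symm

theorem contDiffOn_apply {u : Plane → CVec} {U : Set Plane} {n : WithTop ℕ∞}
    (hu : ContDiffOn ℝ n u U) (i : Fin 2) : ContDiffOn ℝ n (fun y => u y i) U :=
  (PiLp.proj 2 (𝕜 := ℝ) (fun _ : Fin 2 => ℂ) i).contDiff.comp_contDiffOn hu

theorem contDiffOn_pd {f : Plane → ℂ} {U : Set Plane} (hU : IsOpen U)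
    (hf : ContDiffOn ℝ 2 f U) (i : Fin 2) : ContDiffOn ℝ 1 (pd i f) U :=
  (hf.fderiv_of_isOpen hU (by norm_num)).clm_apply contDiffOn_const

theorem pd_add {f g : Plane → ℂ} {x : Plane} (hf : DifferentiableAt ℝ f x)
    (hg : DifferentiableAt ℝ g x) (i : Fin 2) :
    pd i (fun y => f y + g y) x = pd i f x + pd i g x := by
  rw [pd, fderiv_fun_add hf hg]; rfl

theorem pd_sub {f g : Plane → ℂ} {x : Plane} (hf : DifferentiableAt ℝ f x)
    (hg : DifferentiableAt ℝ g x) (i : Fin 2) :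
    pd i (fun y => f y - g y) x = pd i f x - pd i g x := by
  rw [pd, fderiv_fun_sub hf hg]; rfl

theorem pd_neg (f : Plane → ℂ) (x : Plane) (i : Fin 2) :
    pd i (fun y => -f y) x = -pd i f x := by
  rw [pd, fderiv_fun_neg]; rfl

theorem pd_congr {f g : Plane → ℂ} {U : Set Plane} (hU : IsOpen U) (h : ∀ y ∈ U, f y = g y)
    {x : Plane} (hx : x ∈ U) (i : Fin 2) : pd i f x = pd i g x := by
  have : f =ᶠ[𝓝 x] g := by filter_upwards [hU.mem_nhds hx] with y hy using h y hy
  rw [pd, this.fderiv_eq]; rfl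

/-- A quarter turn sends `(a, b)` to `(b, -a)`, whose divergence is the curl of `(a, b)`; the
potentials become `(ψ, -φ)`. The wave number may change, since the curl has its own. -/
theorem HodgeHelmholtz.rotate {k : ℝ} {φ ψ a b : Plane → ℂ} {U : Set Plane} {k' : ℝ}
    (h : HodgeHelmholtz k φ ψ a b U)
    (hcurl : ∀ x ∈ U, pd 0 b x - pd 1 a x = -(k' : ℂ) ^ 2 * ψ x) :
    HodgeHelmholtz k' ψ (fun y => -φ y) b (fun y => -a y) U where
  contDiffOn_φ := h.contDiffOn_ψ
  contDiffOn_ψ := h.contDiffOn_φ.neg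
  contDiffOn_a := h.contDiffOn_b
  contDiffOn_b := h.contDiffOn_a.neg
  eq_a x hx := by rw [h.eq_b x hx, pd_neg]; ring
  eq_b x hx := by rw [h.eq_a x hx, pd_neg]; ring
  div_eq x hx := by rw [pd_neg, ← sub_eq_add_neg, hcurl x hx]

/-- Taking the divergence of `(a, b) = grad φ + grad^⊥ ψ` cancels the mixed derivatives of `ψ`,
whose symmetry is available because `ψ` is already known to be smooth. -/
theorem HodgeHelmholtz.helmholtz {k : ℝ} {φ ψ a b : Plane → ℂ} {U : Set Plane} (hU : IsOpen U)
    (h : HodgeHelmholtz k φ ψ a b U) (hψ : ContDiffOn ℝ (⊤ : ℕ∞) ψ U) :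
    ∀ x ∈ U, pd 0 (pd 0 φ) x + pd 1 (pd 1 φ) x = -(k : ℂ) ^ 2 * φ x := by
  intro x hx
  have hd := fun {f : Plane → ℂ} (hf : ContDiffOn ℝ 1 f U) =>
    (hf.contDiffAt (hU.mem_nhds hx)).differentiableAt one_ne_zero
  have hp := fun i => differentiableAt_of_contDiffOn hU (contDiffOn_pd_top hU hψ i) hx
  have h0 := pd_congr hU (f := pd 0 φ) (g := fun y => a y + pd 1 ψ y)
    (fun y hy => by rw [h.eq_a y hy]; ring) hx 0
  have h1 := pd_congr hU (f := pd 1 φ) (g := fun y => b y - pd 0 ψ y)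
    (fun y hy => by rw [h.eq_b y hy]; ring) hx 1
  rw [h0, h1, pd_add (hd h.contDiffOn_a) (hp 1), pd_sub (hd h.contDiffOn_b) (hp 0),
    pd_comm ((hψ.contDiffAt (hU.mem_nhds hx)).of_le (by norm_cast)) 0 1, ← h.div_eq x hx]
  ring

/-- Symmetry of second derivatives splits `Δu` into `grad div u + grad^⊥ div^⊥ u`; dividing by `ω²`
produces the coefficients `(2μ + lam)/ω² = 1/k_p²` and `μ/ω² = 1/k_s²`. -/
theorem HodgeHelmholtz.of_navier {D : Set Plane} {lam μ ω : ℝ} (hμ : 0 < μ)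
    (hlam : 0 < 2 * μ + lam) (hω : 0 < ω) {u : Plane → CVec} (hu : IsRadiatingNavier D lam μ ω u) :
    HodgeHelmholtz (waveP lam μ ω) (fun x => -(1 / (waveP lam μ ω : ℂ) ^ 2) * div u x)
      (fun x => -(1 / (waveS μ ω : ℂ) ^ 2) * divPerp u x) (fun y => u y 0) (fun y => u y 1)
      (closure D)ᶜ := by
  have hU : IsOpen (closure D)ᶜ := isClosed_closure.isOpen_compl
  have hc := contDiffOn_apply hu.contDiffOn
  have hdiv : ContDiffOn ℝ 1 (div u) (closure D)ᶜ :=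
    (contDiffOn_pd hU (hc 0) 0).add (contDiffOn_pd hU (hc 1) 1)
  have hcurl : ContDiffOn ℝ 1 (divPerp u) (closure D)ᶜ :=
    (contDiffOn_pd hU (hc 1) 0).sub (contDiffOn_pd hU (hc 0) 1)
  have hkp : (1 / (waveP lam μ ω : ℂ) ^ 2) = (2 * μ + lam) / ω ^ 2 := by
    have : 1 / (waveP lam μ ω) ^ 2 = (2 * μ + lam) / ω ^ 2 := by
      rw [waveP, div_pow, Real.sq_sqrt hlam.le, one_div_div]
    exact_mod_cast congrArg Complex.ofReal this
  have hks : (1 / (waveS μ ω : ℂ) ^ 2) = μ / ω ^ 2 := by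
    have : 1 / (waveS μ ω) ^ 2 = μ / ω ^ 2 := by
      rw [waveS, div_pow, Real.sq_sqrt hμ.le, one_div_div]
    exact_mod_cast congrArg Complex.ofReal this
  have hω0 : (ω : ℂ) ≠ 0 := by exact_mod_cast hω.ne'
  have hd := fun {f : Plane → ℂ} (hf : ContDiffOn ℝ 1 f (closure D)ᶜ) {x : Plane}
    (hx : x ∈ (closure D)ᶜ) => (hf.contDiffAt (hU.mem_nhds hx)).differentiableAt one_ne_zero
  have hpdiv : ∀ x ∈ (closure D)ᶜ, ∀ i, pd i (div u) x =
      pd i (pd 0 fun y => u y 0) x + pd i (pd 1 fun y => u y 1) x := fun x hx i =>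
    pd_add (hd (contDiffOn_pd hU (hc 0) 0) hx) (hd (contDiffOn_pd hU (hc 1) 1) hx) i
  have hpcurl : ∀ x ∈ (closure D)ᶜ, ∀ i, pd i (divPerp u) x =
      pd i (pd 0 fun y => u y 1) x - pd i (pd 1 fun y => u y 0) x := fun x hx i =>
    pd_sub (hd (contDiffOn_pd hU (hc 1) 0) hx) (hd (contDiffOn_pd hU (hc 0) 1) hx) i
  have hcat := fun i {x : Plane} (hx : x ∈ (closure D)ᶜ) => (hc i).contDiffAt (hU.mem_nhds hx)
  have hnav : ∀ x ∈ (closure D)ᶜ, ∀ i, (μ : ℂ) * (pd 0 (pd 0 fun y => u y i) x +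
      pd 1 (pd 1 fun y => u y i) x) + (lam + μ) * pd i (div u) x + ω ^ 2 * u x i = 0 := by
    intro x hx i
    have h1 := congrArg (fun z : CVec => z i) (hu.navier x hx)
    have h2 := laplacian_apply (hu.contDiffOn.contDiffAt (hU.mem_nhds hx)) i
    rw [laplacian_eq_pd (hcat i hx)] at h2
    rw [← h2]
    have h3 : grad (div u) x i = pd i (div u) x := by fin_cases i <;> rfl
    rw [← h3]
    simpa [lameOp] using h1
  refine ⟨contDiffOn_const.mul hdiv, contDiffOn_const.mul hcurl, (hc 0).of_le (by norm_num),
    (hc 1).of_le (by norm_num), fun x hx => ?_, fun x hx => ?_, fun x hx => ?_⟩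
  · have h1 := hnav x hx 0
    rw [pd_const_mul _ (hd hdiv hx), pd_const_mul _ (hd hcurl hx), hkp, hks, hpcurl x hx]
    rw [hpdiv x hx, pd_comm (hcat 1 hx) 0 1] at *
    field_simp
    linear_combination h1
  · have h1 := hnav x hx 1
    rw [pd_const_mul _ (hd hdiv hx), pd_const_mul _ (hd hcurl hx), hkp, hks, hpcurl x hx]
    rw [hpdiv x hx, pd_comm (hcat 0 hx) 1 0] at *
    field_simp
    linear_combination h1
  · have hk : (waveP lam μ ω : ℂ) ≠ 0 := by
      have : 0 < waveP lam μ ω := div_pos hω (Real.sqrt_pos.2 hlam)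
      exact_mod_cast this.ne'
    simp only [div]
    field_simp

theorem curl_eq_of_navier {μ ω : ℝ} (hμ : 0 < μ) (hω : 0 < ω) (u : Plane → CVec) (x : Plane) :
    pd 0 (fun y => u y 1) x - pd 1 (fun y => u y 0) x =
      -(waveS μ ω : ℂ) ^ 2 * (-(1 / (waveS μ ω : ℂ) ^ 2) * divPerp u x) := by
  have hk : (waveS μ ω : ℂ) ≠ 0 := by
    have : 0 < waveS μ ω := div_pos hω (Real.sqrt_pos.2 hμ)
    exact_mod_cast this.ne'
  simp only [divPerp]
  field_simp

/-! ### Transfer of the radiation conditions -/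

theorem eventually_mem_ext (R : ℝ) : ∀ᶠ x in Bornology.cobounded Plane, x ∈ ext R := by
  refine (Filter.hasBasis_cobounded_norm (E := Plane)).eventually_iff.2 ⟨R + 1, trivial, ?_⟩
  intro x hx
  have : R + 1 ≤ ‖x‖ := hx
  show R < ‖x‖
  linarith

theorem SommerfeldCondition.congr {F : Type*} [NormedAddCommGroup F] [NormedSpace ℝ F]
    [NormedSpace ℂ F] {k R : ℝ} {f g : Plane → F} (hf : SommerfeldCondition k f)
    (h : ∀ x ∈ ext R, f x = g x) : SommerfeldCondition k g := by
  refine Tendsto.congr' ?_ hf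
  filter_upwards [eventually_mem_ext R] with x hx
  have h1 : f =ᶠ[𝓝 x] g := by filter_upwards [(isOpen_ext R).mem_nhds hx] with y hy using h y hy
  simp only [radialDeriv, h1.fderiv_eq, h x hx]

theorem SommerfeldCondition.apply {k R : ℝ} {w : Plane → CVec} (hw : SommerfeldCondition k w)
    (hd : ∀ x ∈ ext R, DifferentiableAt ℝ w x) (i : Fin 2) :
    SommerfeldCondition k (fun y => w y i) := by
  have h1 : Tendsto (fun x : Plane => (√‖x‖ • (radialDeriv w x - (Complex.I * (k : ℂ)) • w x)) i)
      (Bornology.cobounded Plane) (𝓝 0) := by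
    have := ((PiLp.proj 2 (𝕜 := ℝ) (fun _ : Fin 2 => ℂ) i).continuous.tendsto 0).comp hw
    simpa [Function.comp_def] using this
  refine Tendsto.congr' ?_ h1
  filter_upwards [eventually_mem_ext R] with x hx
  have h2 : HasFDerivAt (fun y => w y i) _ x :=
    (PiLp.proj 2 (𝕜 := ℝ) (fun _ : Fin 2 => ℂ) i).hasFDerivAt.comp x (hd x hx).hasFDerivAt
  simp [radialDeriv, h2.fderiv]

theorem SommerfeldCondition.neg {k : ℝ} {f : Plane → ℂ} (hf : SommerfeldCondition k f) :
    SommerfeldCondition k (fun y => -f y) := by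
  have h : Tendsto _ _ _ := Tendsto.neg hf
  rw [neg_zero] at h
  refine h.congr fun x => ?_
  have : fderiv ℝ (fun y => -f y) x = -fderiv ℝ f x := fderiv_fun_neg
  simp only [radialDeriv, this, smul_eq_mul, Complex.real_smul, neg_apply]
  ring

theorem exists_eq_smul_circ {x : Plane} (hx : x ≠ 0) : ∃ θ : ℝ, x = ‖x‖ • circ θ := by
  have hn : ‖x‖ ≠ 0 := norm_ne_zero_iff.2 hx
  obtain ⟨θ, hθ⟩ := exists_circ ⟨‖x‖⁻¹ • x, by simp [norm_smul, hn]⟩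
  refine ⟨θ, ?_⟩
  rw [← hθ, smul_inv_smul₀ hn]

/-- Along a ray the direction is constant, so `∂v/∂r` is a fixed combination of `∂₁v` and `∂₂v` with
coefficients bounded by one, and inherits their radiation condition uniformly. -/
theorem tendsto_radial_sommerfeld {k R : ℝ} {v : Plane → ℂ} (hR : 0 ≤ R)
    (hv : ContDiffOn ℝ (⊤ : ℕ∞) v (ext R)) (h0 : SommerfeldCondition k (pd 0 v))
    (h1 : SommerfeldCondition k (pd 1 v)) :
    Tendsto (fun x => √‖x‖ * ‖radialDeriv (radialDeriv v) x -
      Complex.I * k * radialDeriv v x‖) (Bornology.cobounded Plane) (𝓝 0) := by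
  have h2 := (tendsto_norm_zero.comp h0).add (tendsto_norm_zero.comp h1)
  rw [add_zero] at h2
  refine squeeze_zero' (Eventually.of_forall fun x => by positivity) ?_ h2
  filter_upwards [eventually_mem_ext R] with x hx
  have hx0 : 0 < ‖x‖ := hR.trans_lt hx
  obtain ⟨θ, hθ⟩ := exists_eq_smul_circ (norm_pos_iff.1 hx0)
  have hp := fun i => contDiffOn_pd_top (isOpen_ext R) hv i
  have hd := fun {w} (hw : ContDiffOn ℝ (⊤ : ℕ∞) w (ext R)) =>
    differentiableAt_of_contDiffOn (isOpen_ext R) hw (hθ ▸ hx : ‖x‖ • circ θ ∈ ext R)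
  have hrr : radialDeriv (radialDeriv v) (‖x‖ • circ θ) =
      Real.cos θ * radialDeriv (pd 0 v) (‖x‖ • circ θ) +
        Real.sin θ * radialDeriv (pd 1 v) (‖x‖ • circ θ) := by
    refine (hasDerivAt_radial hx0 (hd (contDiffOn_radialDeriv hR hv))).unique ?_
    refine (((hasDerivAt_radial hx0 (hd (hp 0))).const_mul (Real.cos θ : ℂ)).add
      ((hasDerivAt_radial hx0 (hd (hp 1))).const_mul (Real.sin θ : ℂ))).congr_of_eventuallyEq ?_
    filter_upwards [lt_mem_nhds hx0] with s hs
    rw [radialDeriv_smul_circ v hs, fderiv_circ]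
    rfl
  have hr : radialDeriv v (‖x‖ • circ θ) = Real.cos θ * pd 0 v (‖x‖ • circ θ) +
      Real.sin θ * pd 1 v (‖x‖ • circ θ) := by
    rw [radialDeriv_smul_circ v hx0, fderiv_circ]
  rw [← hθ] at hrr hr
  have e : radialDeriv (radialDeriv v) x - Complex.I * k * radialDeriv v x =
      Real.cos θ * (radialDeriv (pd 0 v) x - Complex.I * k * pd 0 v x) +
      Real.sin θ * (radialDeriv (pd 1 v) x - Complex.I * k * pd 1 v x) := by
    rw [hrr, hr]; ring
  rw [e]
  simp only [Function.comp_apply, smul_eq_mul, norm_smul, Real.norm_of_nonneg (Real.sqrt_nonneg _)]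
  rw [← mul_add]
  gcongr
  refine (norm_add_le _ _).trans ?_
  rw [norm_mul, norm_mul, Complex.norm_real, Complex.norm_real]
  have c1 : ‖Real.cos θ‖ ≤ 1 := Real.abs_cos_le_one θ
  have c2 : ‖Real.sin θ‖ ≤ 1 := Real.abs_sin_le_one θ
  exact add_le_add (mul_le_of_le_one_left (norm_nonneg _) c1)
    (mul_le_of_le_one_left (norm_nonneg _) c2)

theorem differentiableAt_mk {f g : Plane → ℂ} {x : Plane} (hf : DifferentiableAt ℝ f x)
    (hg : DifferentiableAt ℝ g x) : DifferentiableAt ℝ (fun y => (!₂[f y, g y] : CVec)) x := by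
  have e : (fun y => (!₂[f y, g y] : CVec)) = fun y =>
      f y • (EuclideanSpace.single 0 1 : CVec) + g y • (EuclideanSpace.single 1 1 : CVec) := by
    ext y i; fin_cases i <;> simp
  rw [e]
  exact (hf.smul_const _).add (hg.smul_const _)

/-- The compressional part is `grad φ` near infinity, so its condition can be read off
componentwise. -/
theorem sommerfeld_pd_of_compressionalPart {k R : ℝ} {u : Plane → CVec} {φ : Plane → ℂ}
    (hφ : φ = fun x => -(1 / (k : ℂ) ^ 2) * div u x)
    (hdiv : ∀ x ∈ ext R, DifferentiableAt ℝ (div u) x) (hs : ContDiffOn ℝ (⊤ : ℕ∞) φ (ext R))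
    (h : SommerfeldCondition k (compressionalPart k u)) (i : Fin 2) :
    SommerfeldCondition k (pd i φ) := by
  have hd := fun i x (hx : x ∈ ext R) =>
    differentiableAt_of_contDiffOn (isOpen_ext R) (contDiffOn_pd_top (isOpen_ext R) hs i) hx
  have h1 : SommerfeldCondition k (grad φ) := h.congr (R := R) fun x hx => by
    have := fun i => pd_const_mul (i := i) (-(1 / (k : ℂ) ^ 2)) (hdiv x hx)
    rw [← hφ] at this
    ext j
    fin_cases j <;> simp [compressionalPart, grad, this]
  have h2 := h1.apply (R := R) (fun x hx => differentiableAt_mk (hd 0 x hx) (hd 1 x hx)) i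
  fin_cases i <;> exact h2

theorem sommerfeld_pd_of_shearPart {k R : ℝ} {u : Plane → CVec} {ψ : Plane → ℂ}
    (hψ : ψ = fun x => -(1 / (k : ℂ) ^ 2) * divPerp u x)
    (hdiv : ∀ x ∈ ext R, DifferentiableAt ℝ (divPerp u) x) (hs : ContDiffOn ℝ (⊤ : ℕ∞) ψ (ext R))
    (h : SommerfeldCondition k (shearPart k u)) (i : Fin 2) :
    SommerfeldCondition k (pd i ψ) := by
  have hd := fun i x (hx : x ∈ ext R) =>
    differentiableAt_of_contDiffOn (isOpen_ext R) (contDiffOn_pd_top (isOpen_ext R) hs i) hx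
  have h1 : SommerfeldCondition k (gradPerp ψ) := h.congr (R := R) fun x hx => by
    have := fun i => pd_const_mul (i := i) (-(1 / (k : ℂ) ^ 2)) (hdiv x hx)
    rw [← hψ] at this
    ext j
    fin_cases j <;> simp [shearPart, gradPerp, this]
  have h2 := h1.apply (R := R) (fun x hx => differentiableAt_mk (hd 1 x hx).neg (hd 0 x hx))
  fin_cases i
  · exact h2 1
  · have := (h2 0).neg
    simpa [gradPerp] using this

theorem sommerfeld_of_far_field {k R C : ℝ} {v : Plane → ℂ} (hR : 0 < R)
    (h : ∀ θ r, R ≤ r →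
      ‖radialDeriv v (r • circ θ) - Complex.I * k * v (r • circ θ)‖ ≤ C / (r * √r)) :
    SommerfeldCondition k v := by
  have h1 : Tendsto (fun x : Plane => C / ‖x‖) (Bornology.cobounded Plane) (𝓝 0) :=
    tendsto_norm_cobounded_atTop.const_div_atTop C
  refine squeeze_zero_norm' ?_ h1
  filter_upwards [eventually_mem_ext R] with x hx
  have hx0 : 0 < ‖x‖ := hR.trans hx
  obtain ⟨θ, hθ⟩ := exists_eq_smul_circ (norm_pos_iff.1 hx0)
  have h2 := h θ ‖x‖ (le_of_lt hx)
  rw [← hθ] at h2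
  rw [norm_smul, Real.norm_of_nonneg (Real.sqrt_nonneg _), smul_eq_mul]
  have hs : 0 < √‖x‖ := Real.sqrt_pos.2 hx0
  calc √‖x‖ * ‖radialDeriv v x - Complex.I * k * v x‖ ≤ √‖x‖ * (C / (‖x‖ * √‖x‖)) := by gcongr
    _ = C / ‖x‖ := by field_simp

/-! ### Far field patterns: uniqueness and the elastic expansion -/

theorem rpow_neg_three_halves {r : ℝ} (hr : 0 < r) : r ^ (-(3 / 2) : ℝ) = 1 / (r * √r) := by
  rw [Real.rpow_neg hr.le, one_div, show (3 / 2 : ℝ) = 1 + 1 / 2 by norm_num, Real.rpow_add hr,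
    Real.rpow_one, ← Real.sqrt_eq_rpow]

theorem norm_outgoing (k : ℝ) {r : ℝ} : ‖outgoing k r‖ = 1 / √r := by
  rw [outgoing, norm_div, Complex.norm_of_nonneg (Real.sqrt_nonneg r), Complex.norm_exp]
  simp

/-- The outgoing factor has modulus exactly `r^{-1/2}`, which an `O(r^{-3/2})` bound cannot
accommodate. -/
theorem eq_zero_of_outgoing_le {k C R : ℝ} (hR : 0 < R) {z : ℂ}
    (h : ∀ r, R ≤ r → ‖outgoing k r * z‖ ≤ C * r ^ (-(3 / 2) : ℝ)) : z = 0 := by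
  have h1 : ∀ r, R ≤ r → ‖z‖ ≤ C / r := by
    intro r hr
    have hr0 : 0 < r := hR.trans_le hr
    have hs : 0 < √r := Real.sqrt_pos.2 hr0
    have h2 := h r hr
    rw [norm_mul, norm_outgoing, rpow_neg_three_halves hr0, one_div_mul_eq_div,
      div_le_iff₀ hs] at h2
    refine h2.trans (le_of_eq ?_)
    field_simp
  have h2 : Tendsto (fun r : ℝ => C / r) atTop (𝓝 0) := tendsto_id.const_div_atTop C
  have h3 : ‖z‖ ≤ 0 := ge_of_tendsto h2 (by
    filter_upwards [eventually_ge_atTop R] with r hr using h1 r hr)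
  simpa using h3

theorem IsFarField.unique {k : ℝ} {v : Plane → ℂ} {f g : Circ → ℂ} (hf : IsFarField k v f)
    (hg : IsFarField k v g) : f = g := by
  obtain ⟨C, R, hR, hC⟩ := hf
  obtain ⟨C', R', hR', hC'⟩ := hg
  ext e
  rw [← sub_eq_zero]
  refine eq_zero_of_outgoing_le (k := k) (C := C + C') (R := max R R')
    (hR.trans_le (le_max_left _ _)) fun r hr => ?_
  have h1 := hC e r ((le_max_left _ _).trans hr)
  have h2 := hC' e r ((le_max_right _ _).trans hr)
  have e1 : outgoing k r * (f e - g e) = (v (r • e.1) - outgoing k r * g e) -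
    (v (r • e.1) - outgoing k r * f e) := by ring
  rw [e1, add_mul]
  exact (norm_sub_le _ _).trans (by linarith)

theorem sq_add_sq_of_circ (e : Circ) : ((e.1 0 : ℝ) : ℂ) ^ 2 + ((e.1 1 : ℝ) : ℂ) ^ 2 = 1 := by
  obtain ⟨θ, hθ⟩ := exists_circ e
  rw [hθ]
  simp [circ]

theorem norm_coord_le (e : Circ) (i : Fin 2) : ‖((e.1 i : ℝ) : ℂ)‖ ≤ 1 := by
  have h := PiLp.norm_apply_le e.1 i
  have h1 : ‖e.1‖ = 1 := by simp
  rw [h1] at h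
  rwa [Complex.norm_real]

/-- Each coefficient is recovered by pairing with the orthonormal frame. This decouples the two
patterns, so no comparison of the oscillations `e^{ik_p r}` and `e^{ik_s r}` is needed. -/
theorem norm_dir_coeff_le (e : Circ) (A B : ℂ) : ‖A‖ ≤ 2 * ‖A • dir e + B • dirPerp e‖ ∧
    ‖B‖ ≤ 2 * ‖A • dir e + B • dirPerp e‖ := by
  set w := A • dir e + B • dirPerp e with hw
  have h0 : w 0 = A * (e.1 0 : ℝ) - B * (e.1 1 : ℝ) := by simp [hw, dir, dirPerp]; ring
  have h1 : w 1 = A * (e.1 1 : ℝ) + B * (e.1 0 : ℝ) := by simp [hw, dir, dirPerp]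
  have hs := sq_add_sq_of_circ e
  have n := fun i => PiLp.norm_apply_le w i
  have key : ∀ i j, ‖((e.1 i : ℝ) : ℂ) * w 0‖ + ‖((e.1 j : ℝ) : ℂ) * w 1‖ ≤ 2 * ‖w‖ := by
    intro i j
    rw [norm_mul, norm_mul]
    have a1 := mul_le_of_le_one_left (norm_nonneg (w 0)) (norm_coord_le e i)
    have a2 := mul_le_of_le_one_left (norm_nonneg (w 1)) (norm_coord_le e j)
    linarith [n 0, n 1]
  constructor
  · have : A = (e.1 0 : ℝ) * w 0 + (e.1 1 : ℝ) * w 1 := by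
      rw [h0, h1]; linear_combination -A * hs
    rw [this]
    exact (norm_add_le _ _).trans (key 0 1)
  · have : B = (e.1 0 : ℝ) * w 1 - (e.1 1 : ℝ) * w 0 := by
      rw [h0, h1]; linear_combination -B * hs
    rw [this]
    refine (norm_sub_le _ _).trans ?_
    rw [add_comm]
    exact key 1 0

theorem IsElasticFarField.unique {kp ks : ℝ} {u : Plane → CVec} {f g f' g' : Circ → ℂ}
    (h : IsElasticFarField kp ks u f g) (h' : IsElasticFarField kp ks u f' g') :
    f = f' ∧ g = g' := by
  obtain ⟨C, R, hR, hC⟩ := h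
  obtain ⟨C', R', hR', hC'⟩ := h'
  have key : ∀ e r, max R R' ≤ r → ‖(outgoing kp r * (f e - f' e)) • dir e +
      (outgoing ks r * (g e - g' e)) • dirPerp e‖ ≤ (C + C') * r ^ (-(3 / 2) : ℝ) := by
    intro e r hr
    have h1 := hC e r ((le_max_left _ _).trans hr)
    have h2 := hC' e r ((le_max_right _ _).trans hr)
    have e1 : (outgoing kp r * (f e - f' e)) • dir e + (outgoing ks r * (g e - g' e)) • dirPerp e =
      (u (r • e.1) - ((outgoing kp r * f' e) • dir e + (outgoing ks r * g' e) • dirPerp e)) -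
      (u (r • e.1) - ((outgoing kp r * f e) • dir e + (outgoing ks r * g e) • dirPerp e)) := by
      module
    rw [e1, add_mul]
    exact (norm_sub_le _ _).trans (by linarith)
  have hR0 : 0 < max R R' := hR.trans_le (le_max_left _ _)
  constructor
  · ext e
    rw [← sub_eq_zero]
    refine eq_zero_of_outgoing_le (k := kp) (C := 2 * (C + C')) hR0 fun r hr => ?_
    have h1 := (norm_dir_coeff_le e (outgoing kp r * (f e - f' e))
      (outgoing ks r * (g e - g' e))).1
    linarith [key e r hr]
  · ext e
    rw [← sub_eq_zero]
    refine eq_zero_of_outgoing_le (k := ks) (C := 2 * (C + C')) hR0 fun r hr => ?_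
    have h1 := (norm_dir_coeff_le e (outgoing kp r * (f e - f' e))
      (outgoing ks r * (g e - g' e))).2
    linarith [key e r hr]

theorem norm_dir (e : Circ) : ‖dir e‖ = 1 := by
  have h := EuclideanSpace.real_norm_sq_eq e.1
  have h1 : ‖e.1‖ = 1 := by simp
  rw [h1, Fin.sum_univ_two] at h
  rw [EuclideanSpace.norm_eq, Real.sqrt_eq_one, Fin.sum_univ_two]
  simp only [dir, PiLp.toLp_apply, Matrix.cons_val_zero, Matrix.cons_val_one, Complex.norm_real,
    Real.norm_eq_abs, sq_abs]
  linarith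

theorem norm_dirPerp (e : Circ) : ‖dirPerp e‖ = 1 := by
  have h := EuclideanSpace.real_norm_sq_eq e.1
  have h1 : ‖e.1‖ = 1 := by simp
  rw [h1, Fin.sum_univ_two] at h
  rw [EuclideanSpace.norm_eq, Real.sqrt_eq_one, Fin.sum_univ_two]
  simp only [dirPerp, PiLp.toLp_apply, Matrix.cons_val_zero, Matrix.cons_val_one, norm_neg,
    Complex.norm_real, Real.norm_eq_abs, sq_abs]
  linarith

/-- In the polar frame, `u` has radial component `∂φ/∂r - r⁻¹∂ψ/∂θ` and tangential component `∂ψ/∂r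
+ r⁻¹∂φ/∂θ`. Radial derivatives are `ik` times the potentials up to `O(r^{-3/2})`, and the angular
terms gain a factor `1/r`. -/
theorem HodgeHelmholtz.norm_sub_elastic_le {k kp ks r C C' θ : ℝ} {φ ψ : Plane → ℂ}
    {u : Plane → CVec} {U : Set Plane} {L L' : ℂ} (hkp : 0 < kp) (hks : 0 < ks)
    (h : HodgeHelmholtz k φ ψ (fun y => u y 0) (fun y => u y 1) U) (hr : 0 < r)
    {e : Circ} (he : e.1 = circ θ) (hU : r • circ θ ∈ U)
    (h1 : ‖φ (r • circ θ) - outgoing kp r * L‖ ≤ C / (r * √r))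
    (h2 : ‖radialDeriv φ (r • circ θ) - Complex.I * kp * φ (r • circ θ)‖ ≤ C / (r * √r))
    (h3 : ‖angularDeriv φ (r • circ θ)‖ ≤ C / √r)
    (h1' : ‖ψ (r • circ θ) - outgoing ks r * L'‖ ≤ C' / (r * √r))
    (h2' : ‖radialDeriv ψ (r • circ θ) - Complex.I * ks * ψ (r • circ θ)‖ ≤ C' / (r * √r))
    (h3' : ‖angularDeriv ψ (r • circ θ)‖ ≤ C' / √r) :
    ‖u (r • e.1) - ((outgoing kp r * (Complex.I * kp * L)) • dir e +
      (outgoing ks r * (Complex.I * ks * L')) • dirPerp e)‖ ≤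
      ((2 + kp) * C + (2 + ks) * C') * r ^ (-(3 / 2) : ℝ) := by
  have hs : 0 < √r := Real.sqrt_pos.2 hr
  have hr0 : (r : ℂ) ≠ 0 := by exact_mod_cast hr.ne'
  rw [rpow_neg_three_halves hr]
  set x := r • circ θ with hx
  -- `A` and `B` are the frame components of the error, each split into radiation defect, far field
  -- remainder and angular term.
  set A := (radialDeriv φ x - Complex.I * kp * φ x) +
    Complex.I * kp * (φ x - outgoing kp r * L) - angularDeriv ψ x / r with hA
  set B := (radialDeriv ψ x - Complex.I * ks * ψ x) +
    Complex.I * ks * (ψ x - outgoing ks r * L') + angularDeriv φ x / r with hB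
  have hnk : ∀ {k : ℝ}, 0 < k → ‖Complex.I * (k : ℂ)‖ = k := fun hk => by simp [abs_of_pos hk]
  have nA : ‖A‖ ≤ ((1 + kp) * C + C') * (1 / (r * √r)) := by
    refine (norm_sub_le _ _).trans ((add_le_add_left (norm_add_le _ _) _).trans ?_)
    rw [norm_mul, hnk hkp, norm_div, Complex.norm_of_nonneg hr.le]
    have a1 : kp * ‖φ x - outgoing kp r * L‖ ≤ kp * (C / (r * √r)) := by gcongr
    have a2 : ‖angularDeriv ψ x‖ / r ≤ C' / √r / r := by gcongr
    have a3 : ((1 + kp) * C + C') * (1 / (r * √r)) = C / (r * √r) + kp * (C / (r * √r)) +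
      C' / √r / r := by field_simp
    linarith
  have nB : ‖B‖ ≤ ((1 + ks) * C' + C) * (1 / (r * √r)) := by
    refine (norm_add_le _ _).trans ((add_le_add_left (norm_add_le _ _) _).trans ?_)
    rw [norm_mul, hnk hks, norm_div, Complex.norm_of_nonneg hr.le]
    have a1 : ks * ‖ψ x - outgoing ks r * L'‖ ≤ ks * (C' / (r * √r)) := by gcongr
    have a2 : ‖angularDeriv φ x‖ / r ≤ C / √r / r := by gcongr
    have a3 : ((1 + ks) * C' + C) * (1 / (r * √r)) = C' / (r * √r) + ks * (C' / (r * √r)) +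
      C / √r / r := by field_simp
    linarith
  have key : u (r • e.1) - ((outgoing kp r * (Complex.I * kp * L)) • dir e +
      (outgoing ks r * (Complex.I * ks * L')) • dirPerp e) = A • dir e + B • dirPerp e := by
    have e1 := radialDeriv_smul_circ φ hr θ
    have e2 := radialDeriv_smul_circ ψ hr θ
    have e3 := angularDeriv_smul_circ φ r θ
    have e4 := angularDeriv_smul_circ ψ r θ
    rw [fderiv_circ] at e1 e2
    rw [fderiv_circPerp] at e3 e4
    have ha := h.eq_a _ hU
    have hb := h.eq_b _ hU
    have hcs : ((Real.cos θ : ℝ) : ℂ) ^ 2 + ((Real.sin θ : ℝ) : ℂ) ^ 2 = 1 := by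
      exact_mod_cast Real.cos_sq_add_sin_sq θ
    rw [← hx] at e1 e2 e3 e4
    have c0 : (dir e 0 : ℂ) = (Real.cos θ : ℝ) := by simp [dir, he, circ]
    have c1 : (dir e 1 : ℂ) = (Real.sin θ : ℝ) := by simp [dir, he, circ]
    have d0 : (dirPerp e 0 : ℂ) = -(Real.sin θ : ℝ) := by simp [dirPerp, he, circ]
    have d1 : (dirPerp e 1 : ℂ) = (Real.cos θ : ℝ) := by simp [dirPerp, he, circ]
    have hA' : A = (Real.cos θ : ℝ) * u x 0 + (Real.sin θ : ℝ) * u x 1 -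
        outgoing kp r * (Complex.I * kp * L) := by
      rw [hA, e1, e4, ha, hb, mul_div_cancel_left₀ _ hr0]; ring
    have hB' : B = -(Real.sin θ : ℝ) * u x 0 + (Real.cos θ : ℝ) * u x 1 -
        outgoing ks r * (Complex.I * ks * L') := by
      rw [hB, e2, e3, ha, hb, mul_div_cancel_left₀ _ hr0]; ring
    rw [he, ← hx, hA', hB']
    ext i
    fin_cases i
    · simp only [Fin.zero_eta, PiLp.sub_apply, PiLp.add_apply, PiLp.smul_apply, smul_eq_mul, c0, d0]
      linear_combination -u x 0 * hcs
    · simp only [Fin.mk_one, PiLp.sub_apply, PiLp.add_apply, PiLp.smul_apply, smul_eq_mul, c1, d1]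
      linear_combination -u x 1 * hcs
  rw [key]
  refine (norm_add_le _ _).trans ?_
  rw [norm_smul, norm_smul, norm_dir, norm_dirPerp, mul_one, mul_one]
  linarith

theorem isRadiatingHelmholtz_of_contDiffOn_top {D : Set Plane} {k : ℝ} {v : Plane → ℂ}
    (hv : ContDiffOn ℝ (⊤ : ℕ∞) v (closure D)ᶜ)
    (hH : ∀ x ∈ (closure D)ᶜ, pd 0 (pd 0 v) x + pd 1 (pd 1 v) x = -(k : ℂ) ^ 2 * v x)
    (hS : SommerfeldCondition k v) : IsRadiatingHelmholtz D k v := by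
  have h2 : ContDiffOn ℝ 2 v (closure D)ᶜ := hv.of_le (by norm_cast)
  refine ⟨h2, fun x hx => ?_, hS⟩
  rw [laplacian_eq_pd (h2.contDiffAt (isClosed_closure.isOpen_compl.mem_nhds hx)), hH x hx]
  ring

theorem isFarField_of_bound {k R C : ℝ} {v : Plane → ℂ} {L : ℝ → ℂ} {θ : Circ → ℝ} (hR : 0 < R)
    (hθ : ∀ e : Circ, e.1 = circ (θ e))
    (h : ∀ θ r, R ≤ r → ‖v (r • circ θ) - outgoing k r * L θ‖ ≤ C / (r * √r)) :
    IsFarField k v fun e => L (θ e) := by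
  refine ⟨C, R, hR, fun e r hr => ?_⟩
  rw [rpow_neg_three_halves (hR.trans_le hr), hθ e, mul_one_div]
  exact h _ r hr

end Elastic

/-! ### Conclusion for the scattered elastic field -/

theorem mainTheorem1 (D : Set Elastic.Plane) (hD : Bornology.IsBounded D)
    (lam μ ω : ℝ) (hμ : 0 < μ) (hlam : 0 < 2 * μ + lam) (hω : 0 < ω)
    (u : Elastic.Plane → Elastic.CVec) (hu : Elastic.IsRadiatingNavier D lam μ ω u)
    (kp ks : ℝ) (hkp : kp = Elastic.waveP lam μ ω) (hks : ks = Elastic.waveS μ ω)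
    (φ ψ : Elastic.Plane → ℂ)
    (hφ : φ = fun x => -(1 / (kp : ℂ) ^ 2) * Elastic.div u x)
    (hψ : ψ = fun x => -(1 / (ks : ℂ) ^ 2) * Elastic.divPerp u x) :
    Elastic.IsRadiatingHelmholtz D kp φ ∧ Elastic.IsRadiatingHelmholtz D ks ψ ∧
    (∃ upInf usInf : Elastic.Circ → ℂ, Elastic.IsElasticFarField kp ks u upInf usInf) ∧
    ∀ upInf usInf : Elastic.Circ → ℂ, Elastic.IsElasticFarField kp ks u upInf usInf →
      (∀ φInf : Elastic.Circ → ℂ, Elastic.IsFarField kp φ φInf ↔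
        φInf = fun e => 1 / (Complex.I * (kp : ℂ)) * upInf e) ∧
      (∀ ψInf : Elastic.Circ → ℂ, Elastic.IsFarField ks ψ ψInf ↔
        ψInf = fun e => 1 / (Complex.I * (ks : ℂ)) * usInf e) := by
  have hkp0 : 0 < kp := hkp ▸ div_pos hω (Real.sqrt_pos.2 hlam)
  have hks0 : 0 < ks := hks ▸ div_pos hω (Real.sqrt_pos.2 hμ)
  have hU : IsOpen (closure D)ᶜ := isClosed_closure.isOpen_compl
  have hp := Elastic.HodgeHelmholtz.of_navier hμ hlam hω hu
  rw [← hkp, ← hks, ← hφ, ← hψ] at hp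
  have hs := hp.rotate (k' := ks) fun x _ => by
    rw [hψ, hks]; exact Elastic.curl_eq_of_navier hμ hω u x
  have hφs := hp.contDiffOn_top hkp0 hU
  have hψs := hs.contDiffOn_top hks0 hU
  have hφH := hp.helmholtz hU hψs
  have hψH := hs.helmholtz hU hφs.neg
  obtain ⟨R₀, hR₀⟩ := hD.closure.subset_closedBall (0 : Elastic.Plane)
  set R := max R₀ 0 with hRdef
  have hR : 0 ≤ R := le_max_right _ _
  have hext : Elastic.ext R ⊆ (closure D)ᶜ := fun x hx hxD => by
    have h1 := hR₀ hxD
    rw [mem_closedBall_zero_iff] at h1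
    have h2 : R < ‖x‖ := hx
    linarith [le_max_left R₀ 0]
  have hc := Elastic.contDiffOn_apply hu.contDiffOn
  have hdiff := fun {f : Elastic.Plane → ℂ} (hf : ContDiffOn ℝ 1 f (closure D)ᶜ) x
    (hx : x ∈ Elastic.ext R) =>
    (hf.contDiffAt (hU.mem_nhds (hext hx))).differentiableAt one_ne_zero
  have hpdS := Elastic.sommerfeld_pd_of_compressionalPart hφ
    (hdiff ((Elastic.contDiffOn_pd hU (hc 0) 0).add (Elastic.contDiffOn_pd hU (hc 1) 1)))
    (hφs.mono hext) (hkp ▸ hu.radiation_p)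
  have hsdS := Elastic.sommerfeld_pd_of_shearPart hψ
    (hdiff ((Elastic.contDiffOn_pd hU (hc 1) 0).sub (Elastic.contDiffOn_pd hU (hc 0) 1)))
    (hψs.mono hext) (hks ▸ hu.radiation_s)
  obtain ⟨C, L, hC, hL⟩ := Elastic.exists_far_field (R := R + 1) hkp0 hR (by linarith)
    (hφs.mono hext) (fun x hx => hφH x (hext hx))
    (Elastic.tendsto_radial_sommerfeld hR (hφs.mono hext) (hpdS 0) (hpdS 1))
  obtain ⟨C', L', hC', hL'⟩ := Elastic.exists_far_field (R := R + 1) hks0 hR (by linarith)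
    (hψs.mono hext) (fun x hx => hψH x (hext hx))
    (Elastic.tendsto_radial_sommerfeld hR (hψs.mono hext) (hsdS 0) (hsdS 1))
  have hR1 : 0 < R + 1 := by linarith
  -- The limits `L` and `L'` were built per angle; picking one angle for each direction turns them
  -- into functions on the circle without proving periodicity.
  choose θ hθ using Elastic.exists_circ
  have hφfar := Elastic.isFarField_of_bound hR1 hθ fun t r hr => (hL t r hr).1
  have hψfar := Elastic.isFarField_of_bound hR1 hθ fun t r hr => (hL' t r hr).1
  have hufar : Elastic.IsElasticFarField kp ks u (fun e => Complex.I * kp * L (θ e))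
      (fun e => Complex.I * ks * L' (θ e)) := by
    refine ⟨(2 + kp) * C + (2 + ks) * C', R + 1, hR1, fun e r hr => ?_⟩
    have hr' : R < r := by linarith
    obtain ⟨h1, h2, h3⟩ := hL (θ e) r hr
    obtain ⟨h1', h2', h3'⟩ := hL' (θ e) r hr
    exact hp.norm_sub_elastic_le hkp0 hks0 (hR.trans_lt hr') (hθ e)
      (hext (Elastic.smul_circ_mem_ext hR hr' _)) h1 h2 h3 h1' h2' h3'
  refine ⟨Elastic.isRadiatingHelmholtz_of_contDiffOn_top hφs hφH
      (Elastic.sommerfeld_of_far_field hR1 fun t r hr => (hL t r hr).2.1),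
    Elastic.isRadiatingHelmholtz_of_contDiffOn_top hψs hψH
      (Elastic.sommerfeld_of_far_field hR1 fun t r hr => (hL' t r hr).2.1),
    ⟨_, _, hufar⟩, fun upInf usInf h => ?_⟩
  -- Uniqueness of the elastic pattern reduces an arbitrary pair to the constructed one, whose
  -- entries are `ik` times those of the potentials.
  obtain ⟨rfl, rfl⟩ := h.unique hufar
  have hI := Complex.I_ne_zero
  have hkp1 : (kp : ℂ) ≠ 0 := by exact_mod_cast hkp0.ne'
  have hks1 : (ks : ℂ) ≠ 0 := by exact_mod_cast hks0.ne'
  have e1 : (fun e => 1 / (Complex.I * (kp : ℂ)) * (Complex.I * kp * L (θ e))) =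
      fun e => L (θ e) := by
    ext e; field_simp
  have e2 : (fun e => 1 / (Complex.I * (ks : ℂ)) * (Complex.I * ks * L' (θ e))) =
      fun e => L' (θ e) := by
    ext e; field_simp
  rw [e1, e2]
  exact ⟨fun φInf => ⟨fun h => h.unique hφfar, fun h => h ▸ hφfar⟩,
    fun ψInf => ⟨fun h => h.unique hψfar, fun h => h ▸ hψfar⟩⟩
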